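/- Let $(M,g,I,J)$ be a compact connected generalized Kähler (GK) manifold: $M$ is a compact connected smooth manifold without boundary, $g$ is a Riemannian metric, $I$ and $J$ are integrable complex structures compatible with $g$, and, with $\omega_I=gI$, $\omega_J=gJ$, one has $d^c_I\omega_I=H=-d^c_J\omega_J$ and $dH=0$. Assume that $(M,g,I,J)$ is of symplectic type, i.e. $I+J$ is invertible at every point of $M$, or $I-J$ is invertible at every point of $M$. Assume further that it is a steady gradient generalized Kähler-Ricci soliton with soliton potential $f\in C^\infty(M,\mathbb R)$, i.e. $$\mathrm{Rc}-\tfrac14 H^2+\nabla^2 f=0,\qquad d^*H+i_{\nabla f}H=0,$$ where $\mathrm{Rc}$ is the Ricci tensor of $g$ and $(H^2)_{ij}=H_{ikl}H_j{}^{kl}$. Then $f$ is constant, and $(M,g,I)$ and $(M,g,J)$ are Kähler and Ricci-flat: $d\omega_I=0$, $d\omega_J=0$, $\mathrm{Rc}=0$. In particular $H=0$. -/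

import Mathlib

open scoped Manifold ContDiff Topology

noncomputable section

namespace GenKahler

/-- The model space `ℝ^m` of an `m`-dimensional manifold. -/
abbrev Coord (m : ℕ) : Type := EuclideanSpace ℝ (Fin m)

/-! ## Tensor calculus on open subsets of `ℝ^m`

Tensor fields on an open subset are functions on all of `ℝ^m` of which only the values on that
subset matter; every operation below is local. -/

section Coordinates

variable {m : ℕ}

/-- The `i`-th coordinate vector. -/
def e (i : Fin m) : Coord m := EuclideanSpace.single i 1

/-- The partial derivative `∂_i u`. -/
def pd (i : Fin m) (u : Coord m → ℝ) (y : Coord m) : ℝ := fderiv ℝ u y (e i)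

/-- The matrix `g_{ij}` of a metric in coordinates. -/
def gram (G : Coord m → Coord m →L[ℝ] Coord m →L[ℝ] ℝ) (y : Coord m) :
    Matrix (Fin m) (Fin m) ℝ := Matrix.of fun i j => G y (e i) (e j)

/-- The Christoffel symbols of the Levi-Civita connection,
`Γ^k_{ij} = 1/2 g^{kl} (∂_i g_{jl} + ∂_j g_{il} - ∂_l g_{ij})`. -/
def christoffel (G : Coord m → Coord m →L[ℝ] Coord m →L[ℝ] ℝ) (k i j : Fin m) (y : Coord m) : ℝ :=
  (1 / 2 : ℝ) * ∑ l, (gram G y)⁻¹ k l *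
    (pd i (fun z => gram G z j l) y + pd j (fun z => gram G z i l) y
      - pd l (fun z => gram G z i j) y)

/-- The Ricci tensor
`Rc_{ij} = ∂_k Γ^k_{ij} - ∂_i Γ^k_{kj} + Γ^k_{kl} Γ^l_{ij} - Γ^k_{il} Γ^l_{kj}`
(positive on round spheres). -/
def ricci (G : Coord m → Coord m →L[ℝ] Coord m →L[ℝ] ℝ) (i j : Fin m) (y : Coord m) : ℝ :=
  ∑ k, (pd k (christoffel G k i j) y - pd i (christoffel G k k j) y)
    + ∑ k, ∑ l, (christoffel G k k l y * christoffel G l i j y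
      - christoffel G k i l y * christoffel G l k j y)

/-- The Hessian `(∇² u)_{ij} = ∂_i ∂_j u - Γ^k_{ij} ∂_k u`. -/
def hessian (G : Coord m → Coord m →L[ℝ] Coord m →L[ℝ] ℝ) (u : Coord m → ℝ)
    (i j : Fin m) (y : Coord m) : ℝ :=
  pd i (pd j u) y - ∑ k, christoffel G k i j y * pd k u y

/-- The component `H_{ijk}` of a 3-form. -/
def comp3 (H : Coord m → Coord m [⋀^Fin 3]→L[ℝ] ℝ) (i j k : Fin m) (y : Coord m) : ℝ :=
  H y ![e i, e j, e k]

/-- `(H²)_{ij} = g^{kp} g^{lq} H_{ikl} H_{jpq}`. -/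
def formSq (G : Coord m → Coord m →L[ℝ] Coord m →L[ℝ] ℝ)
    (H : Coord m → Coord m [⋀^Fin 3]→L[ℝ] ℝ) (i j : Fin m) (y : Coord m) : ℝ :=
  ∑ k, ∑ l, ∑ p, ∑ q,
    (gram G y)⁻¹ k p * (gram G y)⁻¹ l q * comp3 H i k l y * comp3 H j p q y

/-- The covariant derivative `∇_l H_{ijk}` of a 3-form. -/
def covDeriv3 (G : Coord m → Coord m →L[ℝ] Coord m →L[ℝ] ℝ)
    (H : Coord m → Coord m [⋀^Fin 3]→L[ℝ] ℝ) (l i j k : Fin m) (y : Coord m) : ℝ :=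
  pd l (comp3 H i j k) y
    - ∑ p, (christoffel G p l i y * comp3 H p j k y + christoffel G p l j y * comp3 H i p k y
      + christoffel G p l k y * comp3 H i j p y)

/-- The codifferential `(d^* H)_{jk} = - g^{li} ∇_l H_{ijk}` of a 3-form. -/
def codiff3 (G : Coord m → Coord m →L[ℝ] Coord m →L[ℝ] ℝ)
    (H : Coord m → Coord m [⋀^Fin 3]→L[ℝ] ℝ) (j k : Fin m) (y : Coord m) : ℝ :=
  - ∑ l, ∑ i, (gram G y)⁻¹ l i * covDeriv3 G H l i j k y

/-- The contraction `(i_{∇u} H)_{jk} = g^{li} ∂_l u H_{ijk}` with the gradient of `u`. -/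
def gradContract (G : Coord m → Coord m →L[ℝ] Coord m →L[ℝ] ℝ) (u : Coord m → ℝ)
    (H : Coord m → Coord m [⋀^Fin 3]→L[ℝ] ℝ) (j k : Fin m) (y : Coord m) : ℝ :=
  ∑ l, ∑ i, (gram G y)⁻¹ l i * pd l u y * comp3 H i j k y

/-- The Nijenhuis tensor `[AV, AW] - A[AV, W] - A[V, AW] - [V, W]` of an almost complex
structure `A`, evaluated on two vector fields. -/
def nijenhuis (A : Coord m → Coord m →L[ℝ] Coord m) (V W : Coord m → Coord m) (y : Coord m) :
    Coord m :=
  VectorField.lieBracket ℝ (fun z => A z (V z)) (fun z => A z (W z)) y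
    - A y (VectorField.lieBracket ℝ (fun z => A z (V z)) W y)
    - A y (VectorField.lieBracket ℝ V (fun z => A z (W z)) y)
    - VectorField.lieBracket ℝ V W y

/-- The operator `d^c = A ∘ d ∘ A⁻¹ = √-1 (∂̄ - ∂)` of an almost complex structure `A`, which acts
on forms by `(A α)(X, Y, …) = α(A⁻¹ X, A⁻¹ Y, …)`, where `A⁻¹ = -A`. -/
def dc (A : Coord m → Coord m →L[ℝ] Coord m) {k : ℕ} (α : Coord m → Coord m [⋀^Fin k]→L[ℝ] ℝ)
    (y : Coord m) : Coord m [⋀^Fin (k + 1)]→L[ℝ] ℝ :=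
  (extDeriv (fun z => (α z).compContinuousLinearMap (A z)) y).compContinuousLinearMap (-(A y))

end Coordinates

/-! ## Tensor fields on manifolds and their coordinate expressions -/

section Manifolds

variable {m : ℕ} {M : Type*} [TopologicalSpace M] [ChartedSpace (Coord m) M]

/-- The tangent space of `M` at `x`. -/
abbrev T (m : ℕ) {M : Type*} [TopologicalSpace M] [ChartedSpace (Coord m) M] (x : M) : Type :=
  TangentSpace 𝓘(ℝ, Coord m) x

/-- Smooth Riemannian metrics. -/
abbrev Metric (m : ℕ) (M : Type*) [TopologicalSpace M] [ChartedSpace (Coord m) M]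
    [IsManifold 𝓘(ℝ, Coord m) ∞ M] : Type _ :=
  Bundle.ContMDiffRiemannianMetric 𝓘(ℝ, Coord m) ∞ (Coord m) (T m (M := M))

/-- Smooth almost complex structures. -/
structure AlmostComplex (m : ℕ) (M : Type*) [TopologicalSpace M] [ChartedSpace (Coord m) M]
    [IsManifold 𝓘(ℝ, Coord m) ∞ M] where
  /-- The endomorphism of each tangent space. -/
  toEnd (x : M) : T m x →L[ℝ] T m x
  sq (x : M) (v : T m x) : toEnd x (toEnd x v) = -v
  contMDiff : ContMDiff 𝓘(ℝ, Coord m) (𝓘(ℝ, Coord m).prod 𝓘(ℝ, Coord m →L[ℝ] Coord m)) ∞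
    (fun x => (Bundle.TotalSpace.mk' (Coord m →L[ℝ] Coord m) x (toEnd x) :
      Bundle.TotalSpace (Coord m →L[ℝ] Coord m) (fun x : M => T m x →L[ℝ] T m x)))

/-- The smooth charts of `M`. -/
abbrev charts (m : ℕ) (M : Type*) [TopologicalSpace M] [ChartedSpace (Coord m) M] :
    Set (OpenPartialHomeomorph M (Coord m)) :=
  IsManifold.maximalAtlas 𝓘(ℝ, Coord m) ∞ M

/-- The derivative of a chart at the point with coordinates `y`. -/
def dChart (φ : OpenPartialHomeomorph M (Coord m)) (y : Coord m) :
    T m (φ.symm y) →L[ℝ] Coord m :=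
  mfderiv 𝓘(ℝ, Coord m) 𝓘(ℝ, Coord m) φ (φ.symm y)

/-- The derivative of the inverse of a chart at the point with coordinates `y`. -/
def dChartSymm (φ : OpenPartialHomeomorph M (Coord m)) (y : Coord m) :
    Coord m →L[ℝ] T m (φ.symm y) :=
  mfderiv 𝓘(ℝ, Coord m) 𝓘(ℝ, Coord m) φ.symm y

/-- Differential forms (without regularity) on `M`. -/
abbrev Form (m : ℕ) (M : Type*) [TopologicalSpace M] [ChartedSpace (Coord m) M] (k : ℕ) : Type _ :=
  ∀ x : M, T m x [⋀^Fin k]→L[ℝ] ℝ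

/-- The coordinate expression of a differential form: its pull-back by the inverse chart. -/
def Form.inChart {k : ℕ} (α : Form m M k) (φ : OpenPartialHomeomorph M (Coord m)) (y : Coord m) :
    Coord m [⋀^Fin k]→L[ℝ] ℝ :=
  (α (φ.symm y)).compContinuousLinearMap (dChartSymm φ y)

variable [IsManifold 𝓘(ℝ, Coord m) ∞ M]

/-- The coordinate expression of a metric: its pull-back by the inverse chart. -/
def metricInChart (g : Metric m M) (φ : OpenPartialHomeomorph M (Coord m)) (y : Coord m) :
    Coord m →L[ℝ] Coord m →L[ℝ] ℝ :=
  ((dChartSymm φ y).precomp ℝ).comp ((g.inner (φ.symm y)).comp (dChartSymm φ y))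

/-- The coordinate expression of an almost complex structure: its conjugate by the derivative of
the chart. -/
def AlmostComplex.inChart (I : AlmostComplex m M) (φ : OpenPartialHomeomorph M (Coord m))
    (y : Coord m) : Coord m →L[ℝ] Coord m :=
  (dChart φ y).comp ((I.toEnd (φ.symm y)).comp (dChartSymm φ y))

/-- Integrability: the Nijenhuis tensor vanishes. -/
def AlmostComplex.Integrable (I : AlmostComplex m M) : Prop :=
  ∀ φ ∈ charts m M, ∀ V W : Coord m → Coord m,
    ContDiffOn ℝ ∞ V φ.target → ContDiffOn ℝ ∞ W φ.target →
      ∀ y ∈ φ.target, nijenhuis (I.inChart φ) V W y = 0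

/-- `g` is compatible with (Hermitian for) `I`. -/
def Compatible (g : Metric m M) (I : AlmostComplex m M) : Prop :=
  ∀ (x : M) (v w : T m x), g.inner x (I.toEnd x v) (I.toEnd x w) = g.inner x v w

/-- The fundamental form `ω_I = g I`, that is, `ω_I(v, w) = g(I v, w)`. -/
def fundamentalForm (g : Metric m M) (I : AlmostComplex m M) (h : Compatible g I) :
    Form m M 2 := fun x =>
  { toFun := fun v => g.inner x (I.toEnd x (v 0)) (v 1)
    map_update_add' := by
      intro _ v i a b
      fin_cases i <;> simp [Function.update]
    map_update_smul' := by
      intro _ v i c a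
      fin_cases i <;> simp [Function.update]
    map_eq_zero_of_eq' := by
      intro v i j hv hij
      have key : ∀ a : T m x, g.inner x (I.toEnd x a) a = 0 := by
        intro a
        have h1 := h x (I.toEnd x a) a
        rw [I.sq, map_neg, neg_apply, g.symm x a] at h1
        linarith
      have h01 : v 0 = v 1 := by
        fin_cases i <;> fin_cases j <;> simp_all
      simp only [h01, key]
    cont := by
      let B : Coord m →L[ℝ] Coord m →L[ℝ] ℝ := (g.inner x).comp (I.toEnd x)
      have hB : Continuous fun v : Fin 2 → Coord m => B (v 0) (v 1) := by fun_prop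
      exact hB }

/-- `(M, g, I)` is Kähler: `I` is an integrable complex structure, `g` is compatible with `I`, and
the fundamental form is closed. -/
def IsKahler (g : Metric m M) (I : AlmostComplex m M) : Prop :=
  I.Integrable ∧ ∃ h : Compatible g I, ∀ φ ∈ charts m M, ∀ y ∈ φ.target,
    extDeriv ((fundamentalForm g I h).inChart φ) y = 0

/-- `g` is Ricci-flat. -/
def RicciFlat (g : Metric m M) : Prop :=
  ∀ φ ∈ charts m M, ∀ y ∈ φ.target, ∀ i j, ricci (metricInChart g φ) i j y = 0

/-- The coordinate expression of the 3-form `d^c_I ω_I`. -/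
def dcFundamental (g : Metric m M) (I : AlmostComplex m M) (h : Compatible g I)
    (φ : OpenPartialHomeomorph M (Coord m)) : Coord m → Coord m [⋀^Fin 3]→L[ℝ] ℝ :=
  dc (I.inChart φ) ((fundamentalForm g I h).inChart φ)

end Manifolds

/-- Generalized Kähler structures on `M`: a Riemannian metric `g` and two compatible integrable
complex structures `I`, `J` such that `d^c_I ω_I = H = -d^c_J ω_J` and `dH = 0`. -/
structure GKStructure (m : ℕ) (M : Type*) [TopologicalSpace M] [ChartedSpace (Coord m) M]
    [IsManifold 𝓘(ℝ, Coord m) ∞ M] where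
  g : Metric m M
  I : AlmostComplex m M
  J : AlmostComplex m M
  integrable_I : I.Integrable
  integrable_J : J.Integrable
  compatible_I : Compatible g I
  compatible_J : Compatible g J
  dc_eq : ∀ φ ∈ charts m M, ∀ y ∈ φ.target,
    dcFundamental g I compatible_I φ y = -dcFundamental g J compatible_J φ y
  closed : ∀ φ ∈ charts m M, ∀ y ∈ φ.target,
    extDeriv (dcFundamental g I compatible_I φ) y = 0

namespace GKStructure

variable {m : ℕ} {M : Type*} [TopologicalSpace M] [ChartedSpace (Coord m) M]
  [IsManifold 𝓘(ℝ, Coord m) ∞ M]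

/-- The coordinate expression of the torsion `H = d^c_I ω_I`. -/
def torsion (K : GKStructure m M) (φ : OpenPartialHomeomorph M (Coord m)) :
    Coord m → Coord m [⋀^Fin 3]→L[ℝ] ℝ :=
  dcFundamental K.g K.I K.compatible_I φ

/-- Symplectic type: `I + J` is invertible at every point, or `I - J` is. -/
def SymplecticType (K : GKStructure m M) : Prop :=
  (∀ x : M, IsUnit (K.I.toEnd x + K.J.toEnd x)) ∨ (∀ x : M, IsUnit (K.I.toEnd x - K.J.toEnd x))

/-- `K` is a steady gradient generalized Kähler-Ricci soliton with soliton potential `f`: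
`f` is smooth, `Rc - 1/4 H² + ∇² f = 0` and `d^* H + i_{∇f} H = 0`. -/
def IsSteadySoliton (K : GKStructure m M) (f : M → ℝ) : Prop :=
  ContMDiff 𝓘(ℝ, Coord m) 𝓘(ℝ, ℝ) ∞ f ∧
  ∀ φ ∈ charts m M, ∀ y ∈ φ.target, ∀ i j,
    ricci (metricInChart K.g φ) i j y
        - 1 / 4 * formSq (metricInChart K.g φ) (K.torsion φ) i j y
        + hessian (metricInChart K.g φ) (f ∘ φ.symm) i j y = 0 ∧
      codiff3 (metricInChart K.g φ) (K.torsion φ) i j y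
        + gradContract (metricInChart K.g φ) (f ∘ φ.symm) (K.torsion φ) i j y = 0

/-- The torsion 3-form vanishes identically. -/
def TorsionFree (K : GKStructure m M) : Prop :=
  ∀ φ ∈ charts m M, ∀ y ∈ φ.target, K.torsion φ y = 0

end GKStructure

end GenKahler

end

set_option linter.unusedSectionVars false

/-! The torsion is globally exact in symplectic type, and the second soliton equation makes it
coclosed for the weighted measure `exp (-f) dV`; a weighted harmonic form that is exact on a compact
manifold vanishes. The rest is the rigidity of compact steady gradient Ricci solitons.

Choose `s = ±1` with `P = I + sJ` invertible, put `Q = I - sJ` and `b = g(Q P⁻¹ ·, ·)`. The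
operators `P` and `Q` are `g`-skew and anticommute, so `b` is a 2-form. Integrability expresses `∇I`
and `∇J` through `H` (`IsHermitianDerivative.two_mul_eq`), and a cyclic sum then gives `db = H`
(`fderiv_potential_cyclic`).

Contracting `H` with `b` in its last two indices gives a 1-form `α`. Since `d^*H + i_{∇f}H = 0`, the
divergence of `exp (-f) α` contains no derivative of `H` and equals `exp (-f)/3` times the sum of
the squares of the components of `H` in an orthonormal frame. A divergence of constant sign on a
compact manifold vanishes, so `H = 0`. Hence `dω_I = dω_J = 0`, and the first equation becomes `Rc +
∇²f = 0`.

For such an `f` the Bochner formula and the contracted Bianchi identity give `Δ|∇f|² = ⟨∇f, ∇|∇f|²⟩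
+ 2|∇²f|²`, that is, `div(exp (-f) ∇|∇f|²) = 2 exp (-f) |∇²f|²`. So `∇²f = 0`; then `div(f∇f) =
|∇f|²`, so `∇f = 0`, and both `Rc = 0` and the constancy of `f` follow.

All three vanishing arguments use one principle, `IsCovectorField.sum_pd_eq_zero`: a 1-form whose
divergence is nonnegative has zero divergence. It rests on a divergence theorem for vector
densities, which needs no orientation, and it allows every divergence to be computed at the centre
of a chart with `g = 1` and `∂g = 0`. There the divergence of `α` is `Σ ∂_i α_i`, covariant
derivatives become partial derivatives, and the curvature identities become algebra in the partial
derivatives of the metric. -/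

noncomputable section

namespace GenKahler

/-! ### Coordinate changes, transformation laws and smoothness of coordinate expressions -/

section Charts

variable {m : ℕ} {M : Type*} [TopologicalSpace M] {φ ψ : OpenPartialHomeomorph M (Coord m)}
  {y : Coord m}

/-- The coordinate change from the chart `ψ` to the chart `φ`. -/
def transition (φ ψ : OpenPartialHomeomorph M (Coord m)) (y : Coord m) : Coord m :=
  φ (ψ.symm y)

theorem transition_mem_target (hy' : ψ.symm y ∈ φ.source) : transition φ ψ y ∈ φ.target :=
  φ.map_source hy'

theorem symm_transition (hy' : ψ.symm y ∈ φ.source) :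
    φ.symm (transition φ ψ y) = ψ.symm y :=
  φ.left_inv hy'

theorem transition_transition (hy : y ∈ ψ.target) (hy' : ψ.symm y ∈ φ.source) :
    transition ψ φ (transition φ ψ y) = y := by
  unfold transition
  rw [φ.left_inv hy', ψ.right_inv hy]

theorem eventually_overlap (hy : y ∈ ψ.target) (hy' : ψ.symm y ∈ φ.source) :
    ∀ᶠ z in 𝓝 y, z ∈ ψ.target ∧ ψ.symm z ∈ φ.source :=
  (ψ.open_target.eventually_mem hy).and
    ((ψ.continuousAt_symm hy).eventually (φ.open_source.eventually_mem hy'))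

variable [ChartedSpace (Coord m) M] [IsManifold 𝓘(ℝ, Coord m) ∞ M]

theorem contDiffAt_transition (hφ : φ ∈ charts m M) (hψ : ψ ∈ charts m M) (hy : y ∈ ψ.target)
    (hy' : ψ.symm y ∈ φ.source) : ContDiffAt ℝ ∞ (transition φ ψ) y := by
  have h1 := contMDiffAt_of_mem_maximalAtlas hφ hy'
  have h2 := contMDiffAt_symm_of_mem_maximalAtlas hψ hy
  exact (h1.comp y h2).contDiffAt

theorem fderiv_transition_comp (hφ : φ ∈ charts m M) (hψ : ψ ∈ charts m M) (hy : y ∈ ψ.target)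
    (hy' : ψ.symm y ∈ φ.source) :
    (fderiv ℝ (transition ψ φ) (transition φ ψ y)).comp (fderiv ℝ (transition φ ψ) y)
      = ContinuousLinearMap.id ℝ (Coord m) := by
  have h1 : DifferentiableAt ℝ (transition ψ φ) (transition φ ψ y) :=
    (contDiffAt_transition hψ hφ (transition_mem_target hy')
      (by rw [symm_transition hy']; exact ψ.map_target hy)).differentiableAt (by simp)
  have h2 := (contDiffAt_transition hφ hψ hy hy').differentiableAt (by simp)
  rw [← fderiv_comp y h1 h2]
  have : transition ψ φ ∘ transition φ ψ =ᶠ[𝓝 y] id := by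
    filter_upwards [eventually_overlap hy hy'] with z hz
    exact transition_transition hz.1 hz.2
  rw [this.fderiv_eq, fderiv_id]

theorem det_fderiv_transition_ne_zero (hφ : φ ∈ charts m M) (hψ : ψ ∈ charts m M)
    (hy : y ∈ ψ.target) (hy' : ψ.symm y ∈ φ.source) :
    (fderiv ℝ (transition φ ψ) y).det ≠ 0 := by
  intro h
  have h1 := congrArg (fun L : Coord m →L[ℝ] Coord m => L.det)
    (fderiv_transition_comp hφ hψ hy hy')
  have h2 := LinearMap.det_comp
    (fderiv ℝ (transition ψ φ) (transition φ ψ y)).toLinearMap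
    (fderiv ℝ (transition φ ψ) y).toLinearMap
  have h3 : (fderiv ℝ (transition φ ψ) y).toLinearMap.det = 0 := h
  rw [h3, mul_zero] at h2
  have h4 : LinearMap.det (ContinuousLinearMap.id ℝ (Coord m)).toLinearMap = 0 :=
    h1.symm.trans h2
  simp at h4

theorem mdifferentiableAt_chart (hφ : φ ∈ charts m M) {x : M} (hx : x ∈ φ.source) :
    MDifferentiableAt 𝓘(ℝ, Coord m) 𝓘(ℝ, Coord m) φ x :=
  (contMDiffAt_of_mem_maximalAtlas hφ hx).mdifferentiableAt (by simp)

theorem mdifferentiableAt_chart_symm (hφ : φ ∈ charts m M) (hy : y ∈ φ.target) :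
    MDifferentiableAt 𝓘(ℝ, Coord m) 𝓘(ℝ, Coord m) φ.symm y :=
  (contMDiffAt_symm_of_mem_maximalAtlas hφ hy).mdifferentiableAt (by simp)

theorem mdifferentiable_chart (hφ : φ ∈ charts m M) :
    φ.MDifferentiable 𝓘(ℝ, Coord m) 𝓘(ℝ, Coord m) :=
  ⟨fun _ hx => (mdifferentiableAt_chart hφ hx).mdifferentiableWithinAt,
    fun _ hx => (mdifferentiableAt_chart_symm hφ hx).mdifferentiableWithinAt⟩

theorem dChart_dChartSymm (hφ : φ ∈ charts m M) (hy : y ∈ φ.target) (v : Coord m) :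
    dChart φ y (dChartSymm φ y v) = v :=
  DFunLike.congr_fun ((mdifferentiable_chart hφ).comp_symm_deriv hy) v

theorem dChartSymm_dChart (hφ : φ ∈ charts m M) (hy : y ∈ φ.target) (v : T m (φ.symm y)) :
    dChartSymm φ y (dChart φ y v) = v := by
  have h := (mdifferentiable_chart hφ).symm_comp_deriv (φ.map_target hy)
  rw [φ.right_inv hy] at h
  exact DFunLike.congr_fun h v

/-- Chain rule for `φ.symm ∘ transition φ ψ = ψ.symm` near `y`. The two sides lie in tangent spaces
at points that are equal but not definitionally so; they are compared in `Coord m`, which every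
tangent space unfolds to. -/
theorem dChartSymm_transition (hφ : φ ∈ charts m M) (hψ : ψ ∈ charts m M) (hy : y ∈ ψ.target)
    (hy' : ψ.symm y ∈ φ.source) (v : Coord m) :
    (dChartSymm ψ y v : Coord m) =
      dChartSymm φ (transition φ ψ y) (fderiv ℝ (transition φ ψ) y v) := by
  have h1 := mdifferentiableAt_chart_symm hφ (transition_mem_target hy')
  have h2 : MDifferentiableAt 𝓘(ℝ, Coord m) 𝓘(ℝ, Coord m) (transition φ ψ) y :=
    ((contDiffAt_transition hφ hψ hy hy').differentiableAt (by simp)).mdifferentiableAt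
  have h3 := mfderiv_comp y h1 h2
  have h4 : φ.symm ∘ transition φ ψ =ᶠ[𝓝 y] ψ.symm := by
    filter_upwards [eventually_overlap hy hy'] with z hz
    exact symm_transition hz.2
  have h5 := h4.mfderiv_eq (I := 𝓘(ℝ, Coord m)) (I' := 𝓘(ℝ, Coord m))
  rw [mfderiv_eq_fderiv] at h3
  have h6 : (mfderiv 𝓘(ℝ, Coord m) 𝓘(ℝ, Coord m) (φ.symm ∘ transition φ ψ) y v : Coord m)
    = mfderiv 𝓘(ℝ, Coord m) 𝓘(ℝ, Coord m) ψ.symm y v := DFunLike.congr_fun h5 v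
  exact h6.symm.trans (DFunLike.congr_fun h3 v)

/-! ### Transformation laws of the coordinate expressions -/

theorem metric_inner_congr (g : Metric m M) {x x' : M} (h : x = x') (v w : Coord m) :
    g.inner x (v : T m x) (w : T m x) = g.inner x' (v : T m x') (w : T m x') := by
  subst h; rfl

theorem almostComplex_congr (I : AlmostComplex m M) {x x' : M} (h : x = x') (v : Coord m) :
    (I.toEnd x (v : T m x) : Coord m) = I.toEnd x' (v : T m x') := by
  subst h; rfl

theorem metricInChart_apply (g : Metric m M) (v w : Coord m) :
    metricInChart g φ y v w = g.inner (φ.symm y) (dChartSymm φ y v) (dChartSymm φ y w) := rfl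

theorem inChart_apply (I : AlmostComplex m M) (v : Coord m) :
    I.inChart φ y v = dChart φ y (I.toEnd (φ.symm y) (dChartSymm φ y v)) := rfl

theorem dChartSymm_inChart (I : AlmostComplex m M) (hφ : φ ∈ charts m M) (hy : y ∈ φ.target)
    (v : Coord m) :
    dChartSymm φ y (I.inChart φ y v) = I.toEnd (φ.symm y) (dChartSymm φ y v) := by
  rw [inChart_apply, dChartSymm_dChart hφ hy]

theorem dChartSymm_injective (hφ : φ ∈ charts m M) (hy : y ∈ φ.target) :
    Function.Injective (dChartSymm φ y) :=
  Function.LeftInverse.injective (g := dChart φ y) (dChart_dChartSymm hφ hy)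

theorem metricInChart_transition (g : Metric m M) (hφ : φ ∈ charts m M) (hψ : ψ ∈ charts m M)
    (hy : y ∈ ψ.target) (hy' : ψ.symm y ∈ φ.source) (v w : Coord m) :
    metricInChart g ψ y v w = metricInChart g φ (transition φ ψ y)
      (fderiv ℝ (transition φ ψ) y v) (fderiv ℝ (transition φ ψ) y w) := by
  refine (metric_inner_congr g (symm_transition hy').symm (dChartSymm ψ y v)
    (dChartSymm ψ y w)).trans ?_
  rw [dChartSymm_transition hφ hψ hy hy' v, dChartSymm_transition hφ hψ hy hy' w]
  rfl

theorem inChart_transition (I : AlmostComplex m M) (hφ : φ ∈ charts m M) (hψ : ψ ∈ charts m M)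
    (hy : y ∈ ψ.target) (hy' : ψ.symm y ∈ φ.source) (v : Coord m) :
    fderiv ℝ (transition φ ψ) y (I.inChart ψ y v) =
      I.inChart φ (transition φ ψ y) (fderiv ℝ (transition φ ψ) y v) := by
  apply dChartSymm_injective hφ (transition_mem_target hy')
  rw [dChartSymm_inChart I hφ (transition_mem_target hy')]
  have h1 := dChartSymm_transition hφ hψ hy hy' (I.inChart ψ y v)
  have h2 := dChartSymm_transition hφ hψ hy hy' v
  have h3 := dChartSymm_inChart I hψ hy v
  have h4 := almostComplex_congr I (symm_transition hy').symm (dChartSymm ψ y v)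
  exact h1.symm.trans (Eq.trans (α := Coord m) h3 (Eq.trans (α := Coord m) h4
    (congrArg (fun u : Coord m => (I.toEnd (φ.symm (transition φ ψ y)) u : Coord m)) h2)))

theorem inChart_sq (I : AlmostComplex m M) (hφ : φ ∈ charts m M) (hy : y ∈ φ.target)
    (v : Coord m) : I.inChart φ y (I.inChart φ y v) = -v := by
  rw [inChart_apply, dChartSymm_inChart I hφ hy, I.sq, map_neg, dChart_dChartSymm hφ hy]

theorem metricInChart_compatible {g : Metric m M} {I : AlmostComplex m M} (h : Compatible g I)
    (hφ : φ ∈ charts m M) (hy : y ∈ φ.target) (v w : Coord m) :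
    metricInChart g φ y (I.inChart φ y v) (I.inChart φ y w) = metricInChart g φ y v w := by
  rw [metricInChart_apply, metricInChart_apply, dChartSymm_inChart I hφ hy,
    dChartSymm_inChart I hφ hy, h]

theorem metricInChart_symm (g : Metric m M) (v w : Coord m) :
    metricInChart g φ y v w = metricInChart g φ y w v :=
  g.symm _ _ _

theorem metricInChart_pos (g : Metric m M) (hφ : φ ∈ charts m M) (hy : y ∈ φ.target)
    {v : Coord m} (hv : v ≠ 0) : 0 < metricInChart g φ y v v := by
  apply g.pos
  intro h
  exact hv (dChartSymm_injective hφ hy (h.trans (map_zero _).symm))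

theorem fundamentalForm_inChart_apply {g : Metric m M} {I : AlmostComplex m M}
    (h : Compatible g I) (hφ : φ ∈ charts m M) (hy : y ∈ φ.target) (v : Fin 2 → Coord m) :
    (fundamentalForm g I h).inChart φ y v = metricInChart g φ y (I.inChart φ y (v 0)) (v 1) := by
  rw [metricInChart_apply, dChartSymm_inChart I hφ hy]
  rfl

/-! ### Smoothness of the coordinate expressions -/

/-- The coordinate fields are images of constant fields under the tangent map of `φ.symm`. Smooth
tensors are evaluated on them to obtain smooth components. -/
theorem contMDiffAt_dChartSymm (hφ : φ ∈ charts m M) (hy : y ∈ φ.target) (v : Coord m) :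
    ContMDiffAt 𝓘(ℝ, Coord m) (𝓘(ℝ, Coord m).prod 𝓘(ℝ, Coord m)) ∞
      (fun z => (Bundle.TotalSpace.mk' (Coord m) (φ.symm z) (dChartSymm φ z v) :
        TangentBundle 𝓘(ℝ, Coord m) M)) y := by
  have h1 := (contMDiffOn_symm_of_mem_maximalAtlas hφ).contMDiffOn_tangentMapWithin
    (m := ∞) (by simp) φ.open_target.uniqueMDiffOn
  have h2 : ContMDiff 𝓘(ℝ, Coord m) (𝓘(ℝ, Coord m).prod 𝓘(ℝ, Coord m)) ∞
      (fun z : Coord m => (Bundle.TotalSpace.mk' (Coord m) z v :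
        TangentBundle 𝓘(ℝ, Coord m) (Coord m))) := by
    exact contMDiff_vectorSpace_iff_contDiff.2 contDiff_const
  have h3 := h1.comp h2.contMDiffOn (s := φ.target) (fun z hz => hz)
  have h4 := h3.contMDiffAt (φ.open_target.mem_nhds hy)
  refine h4.congr_of_eventuallyEq ?_
  filter_upwards [φ.open_target.mem_nhds hy] with z hz
  simp only [Function.comp, tangentMapWithin, dChartSymm]
  rw [mfderivWithin_of_isOpen φ.open_target hz]
  rfl

theorem contDiffAt_dChart_apply (hφ : φ ∈ charts m M) (hy : y ∈ φ.target)
    (V : ∀ z : Coord m, T m (φ.symm z))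
    (hV : ContMDiffAt 𝓘(ℝ, Coord m) (𝓘(ℝ, Coord m).prod 𝓘(ℝ, Coord m)) ∞
      (fun z => (Bundle.TotalSpace.mk' (Coord m) (φ.symm z) (V z) :
        TangentBundle 𝓘(ℝ, Coord m) M)) y) :
    ContDiffAt ℝ ∞ (fun z => (dChart φ z (V z) : Coord m)) y := by
  have h1 := (contMDiffOn_of_mem_maximalAtlas hφ).contMDiffOn_tangentMapWithin
    (m := ∞) (by simp) φ.open_source.uniqueMDiffOn
  have hs : IsOpen (Bundle.TotalSpace.proj ⁻¹' φ.source :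
      Set (TangentBundle 𝓘(ℝ, Coord m) M)) :=
    φ.open_source.preimage (FiberBundle.continuous_proj _ _)
  have h2 := (h1.contMDiffAt (hs.mem_nhds (x := ⟨φ.symm y, V y⟩) (φ.map_target hy))).comp y hV
  have h3 := (contMDiff_snd_tangentBundle_modelSpace (Coord m) 𝓘(ℝ, Coord m)
    (n := ∞)).contMDiffAt.comp y h2
  refine h3.contDiffAt.congr_of_eventuallyEq ?_
  filter_upwards [φ.open_target.mem_nhds hy] with z hz
  simp only [Function.comp, tangentMapWithin, dChart]
  rw [mfderivWithin_of_isOpen φ.open_source (φ.map_target hz)]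
  rfl

theorem contDiffAt_clm_of_apply {F : Type*} [NormedAddCommGroup F] [NormedSpace ℝ F]
    {f : Coord m → Coord m →L[ℝ] F} (h : ∀ v, ContDiffAt ℝ ∞ (fun z => f z v) y) :
    ContDiffAt ℝ ∞ f y := by
  let d := Module.finrank ℝ (Coord m)
  have hd : d = Module.finrank ℝ (Fin d → ℝ) := (Module.finrank_fin_fun ℝ).symm
  let e₁ := ContinuousLinearEquiv.ofFinrankEq hd
  let e₂ := (e₁.arrowCongr (1 : F ≃L[ℝ] F)).trans (ContinuousLinearEquiv.piRing (Fin d))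
  rw [← Function.id_comp f, ← e₂.symm_comp_self]
  exact e₂.symm.contDiff.contDiffAt.comp y (contDiffAt_pi.mpr fun i => h _)

theorem contDiffAt_metricInChart (g : Metric m M) (hφ : φ ∈ charts m M) (hy : y ∈ φ.target) :
    ContDiffAt ℝ ∞ (metricInChart g φ) y := by
  refine contDiffAt_clm_of_apply fun v => contDiffAt_clm_of_apply fun w => ?_
  have hg := g.contMDiff.contMDiffAt.comp y (contMDiffAt_symm_of_mem_maximalAtlas hφ hy)
  have h := ContMDiffAt.clm_bundle_apply₂ (F₁ := Coord m) (F₂ := Coord m) (F₃ := ℝ)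
    (E₃ := Bundle.Trivial M ℝ) hg
    (contMDiffAt_dChartSymm hφ hy v) (contMDiffAt_dChartSymm hφ hy w)
  rw [Bundle.contMDiffAt_totalSpace] at h
  exact h.2.contDiffAt

theorem contDiffAt_inChart (I : AlmostComplex m M) (hφ : φ ∈ charts m M) (hy : y ∈ φ.target) :
    ContDiffAt ℝ ∞ (I.inChart φ) y := by
  refine contDiffAt_clm_of_apply fun v => ?_
  have hI := I.contMDiff.contMDiffAt.comp y (contMDiffAt_symm_of_mem_maximalAtlas hφ hy)
  exact contDiffAt_dChart_apply hφ hy _ (ContMDiffAt.clm_bundle_apply (F₁ := Coord m)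
    (F₂ := Coord m) hI (contMDiffAt_dChartSymm hφ hy v))

theorem contDiffAt_comp_symm {f : M → ℝ} (hf : ContMDiff 𝓘(ℝ, Coord m) 𝓘(ℝ, ℝ) ∞ f)
    (hφ : φ ∈ charts m M) (hy : y ∈ φ.target) : ContDiffAt ℝ ∞ (f ∘ φ.symm) y :=
  (hf.contMDiffAt.comp y (contMDiffAt_symm_of_mem_maximalAtlas hφ hy)).contDiffAt

end Charts

/-! ### Smoothness of forms and of their exterior derivatives -/

section FormCalculus

variable {m : ℕ} {y : Coord m} {k : ℕ}

theorem coord_eq_sum (v : Coord m) : v = ∑ i, v i • e i := by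
  have h := (EuclideanSpace.basisFun (Fin m) ℝ).sum_repr v
  simpa [e] using h.symm

theorem form_apply_eq_sum (α : Coord m [⋀^Fin k]→L[ℝ] ℝ) (v : Fin k → Coord m) :
    α v = ∑ r : Fin k → Fin m, (∏ j, v j (r j)) * α (fun j => e (r j)) := by
  have h : v = fun j => ∑ i, v j i • e i := funext fun j => coord_eq_sum (v j)
  conv_lhs => rw [h]
  have h2 := α.toMultilinearMap.map_sum (fun j i => v j i • e i)
  refine h2.trans (Finset.sum_congr rfl fun r _ => ?_)
  exact α.toMultilinearMap.map_smul_univ _ _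

/-- Evaluation on tuples of basis vectors is a linear injection into a finite-dimensional space; a
linear left inverse recovers `α` from finitely many smooth components. -/
theorem contDiffAt_form_of_apply {α : Coord m → Coord m [⋀^Fin k]→L[ℝ] ℝ}
    (h : ∀ v, ContDiffAt ℝ ∞ (fun z => α z v) y) : ContDiffAt ℝ ∞ α y := by
  let Φ : (Coord m [⋀^Fin k]→L[ℝ] ℝ) →ₗ[ℝ] ((Fin k → Fin m) → ℝ) :=
    { toFun := fun β r => β (fun j => e (r j))
      map_add' := fun _ _ => rfl
      map_smul' := fun _ _ => rfl }
  have hΦ : LinearMap.ker Φ = ⊥ := by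
    refine LinearMap.ker_eq_bot'.2 fun β hβ => ?_
    ext v
    rw [form_apply_eq_sum]
    refine Finset.sum_eq_zero fun r _ => ?_
    have : β (fun j => e (r j)) = 0 := congrFun hβ r
    rw [this, mul_zero]
  obtain ⟨L, hL⟩ := Φ.exists_leftInverse_of_injective hΦ
  have h1 : α = fun z => L.toContinuousLinearMap (Φ (α z)) := by
    funext z
    exact (LinearMap.congr_fun hL (α z)).symm
  rw [h1]
  exact L.toContinuousLinearMap.contDiff.contDiffAt.comp y (contDiffAt_pi.2 fun r => h _)

theorem contDiffAt_form_const_apply {α : Coord m → Coord m [⋀^Fin k]→L[ℝ] ℝ}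
    (h : ContDiffAt ℝ ∞ α y) (v : Fin k → Coord m) : ContDiffAt ℝ ∞ (fun z => α z v) y := by
  let L : (Coord m [⋀^Fin k]→L[ℝ] ℝ) →L[ℝ] ℝ :=
    ContinuousAlternatingMap.apply ℝ (Coord m) ℝ v
  exact L.contDiff.contDiffAt.comp y h

theorem contDiffAt_form_apply {α : Coord m → Coord m [⋀^Fin k]→L[ℝ] ℝ}
    (h : ContDiffAt ℝ ∞ α y) {V : Fin k → Coord m → Coord m}
    (hV : ∀ j, ContDiffAt ℝ ∞ (V j) y) : ContDiffAt ℝ ∞ (fun z => α z (fun j => V j z)) y := by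
  rw [show (fun z => α z (fun j => V j z)) = fun z => ∑ r : Fin k → Fin m,
      (∏ j, V j z (r j)) * α z (fun j => e (r j)) from funext fun z => form_apply_eq_sum _ _]
  refine ContDiffAt.sum fun r _ => (contDiffAt_prod fun j _ => ?_).mul
    (contDiffAt_form_const_apply h _)
  exact contDiffAt_euclidean.1 (hV j) (r j)

theorem contDiffAt_extDeriv {α : Coord m → Coord m [⋀^Fin k]→L[ℝ] ℝ}
    (h : ContDiffAt ℝ ∞ α y) : ContDiffAt ℝ ∞ (extDeriv α) y :=
  ContDiffAt.comp (g := ContinuousAlternatingMap.alternatizeUncurryFinCLM ℝ (Coord m) ℝ) y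
    (ContinuousLinearMap.contDiff _).contDiffAt (h.fderiv_right (m := ∞) (by simp))

end FormCalculus

/-! ### The fundamental form and its `d^c` in charts -/

section Torsion

variable {m : ℕ} {M : Type*} [TopologicalSpace M] [ChartedSpace (Coord m) M]
  [IsManifold 𝓘(ℝ, Coord m) ∞ M] {φ ψ : OpenPartialHomeomorph M (Coord m)} {y : Coord m}
  {g : Metric m M} {I : AlmostComplex m M}

theorem contDiffAt_fundamentalForm_inChart (h : Compatible g I) (hφ : φ ∈ charts m M)
    (hy : y ∈ φ.target) : ContDiffAt ℝ ∞ ((fundamentalForm g I h).inChart φ) y := by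
  refine contDiffAt_form_of_apply fun v => ?_
  have h1 : ContDiffAt ℝ ∞ (fun z => metricInChart g φ z (I.inChart φ z (v 0)) (v 1)) y :=
    ((contDiffAt_metricInChart g hφ hy).clm_apply
      ((contDiffAt_inChart I hφ hy).clm_apply contDiffAt_const)).clm_apply contDiffAt_const
  refine h1.congr_of_eventuallyEq ?_
  filter_upwards [φ.open_target.mem_nhds hy] with z hz
  exact fundamentalForm_inChart_apply h hφ hz v

/-- `ω_I` is `I`-invariant, so the inner action of `I` in `d^c` does nothing. -/
theorem dcFundamental_eq (h : Compatible g I) (hφ : φ ∈ charts m M) (hy : y ∈ φ.target) :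
    dcFundamental g I h φ y =
      (extDeriv ((fundamentalForm g I h).inChart φ) y).compContinuousLinearMap
        (-(I.inChart φ y)) := by
  unfold dcFundamental dc
  congr 1
  apply Filter.EventuallyEq.extDeriv_eq
  filter_upwards [φ.open_target.mem_nhds hy] with z hz
  ext v
  rw [ContinuousAlternatingMap.compContinuousLinearMap_apply,
    fundamentalForm_inChart_apply h hφ hz, fundamentalForm_inChart_apply h hφ hz]
  exact metricInChart_compatible h hφ hz _ _

theorem contDiffAt_dcFundamental (h : Compatible g I) (hφ : φ ∈ charts m M) (hy : y ∈ φ.target) :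
    ContDiffAt ℝ ∞ (dcFundamental g I h φ) y := by
  have h1 : ContDiffAt ℝ ∞ (fun z =>
      (extDeriv ((fundamentalForm g I h).inChart φ) z).compContinuousLinearMap
        (-(I.inChart φ z))) y := by
    refine contDiffAt_form_of_apply fun v => ?_
    exact contDiffAt_form_apply
      (contDiffAt_extDeriv (contDiffAt_fundamentalForm_inChart h hφ hy))
      (fun j => (contDiffAt_inChart I hφ hy).neg.clm_apply contDiffAt_const)
  refine h1.congr_of_eventuallyEq ?_
  filter_upwards [φ.open_target.mem_nhds hy] with z hz
  exact dcFundamental_eq h hφ hz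

/-- Naturality of `d` under pull-back. Together with the law for `I` it makes `d^c ω_I` a tensor, so
its vanishing may be checked in any convenient chart. -/
theorem extDeriv_fundamentalForm_transition (h : Compatible g I) (hφ : φ ∈ charts m M)
    (hψ : ψ ∈ charts m M) (hy : y ∈ ψ.target) (hy' : ψ.symm y ∈ φ.source) :
    extDeriv ((fundamentalForm g I h).inChart ψ) y =
      (extDeriv ((fundamentalForm g I h).inChart φ) (transition φ ψ y)).compContinuousLinearMap
        (fderiv ℝ (transition φ ψ) y) := by
  rw [← extDeriv_pullback (r := ∞)
    ((contDiffAt_fundamentalForm_inChart h hφ (transition_mem_target hy')).differentiableAt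
      (by simp)) (contDiffAt_transition hφ hψ hy hy')
    (by simp only [minSmoothness_of_isRCLikeNormedField]; exact WithTop.coe_le_coe.2 le_top)]
  apply Filter.EventuallyEq.extDeriv_eq
  filter_upwards [eventually_overlap hy hy'] with z hz
  ext v
  rw [ContinuousAlternatingMap.compContinuousLinearMap_apply,
    fundamentalForm_inChart_apply h hψ hz.1,
    fundamentalForm_inChart_apply h hφ (transition_mem_target hz.2),
    metricInChart_transition g hφ hψ hz.1 hz.2, inChart_transition I hφ hψ hz.1 hz.2]
  rfl

theorem dcFundamental_transition (h : Compatible g I) (hφ : φ ∈ charts m M)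
    (hψ : ψ ∈ charts m M) (hy : y ∈ ψ.target) (hy' : ψ.symm y ∈ φ.source)
    (v : Fin 3 → Coord m) :
    dcFundamental g I h ψ y v =
      dcFundamental g I h φ (transition φ ψ y) (fun j => fderiv ℝ (transition φ ψ) y (v j)) := by
  rw [dcFundamental_eq h hψ hy, dcFundamental_eq h hφ (transition_mem_target hy'),
    extDeriv_fundamentalForm_transition h hφ hψ hy hy',
    ContinuousAlternatingMap.compContinuousLinearMap_apply,
    ContinuousAlternatingMap.compContinuousLinearMap_apply,
    ContinuousAlternatingMap.compContinuousLinearMap_apply]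
  congr 1
  funext j
  simp [inChart_transition I hφ hψ hy hy']

/-- `d^c ω` is `dω` precomposed with the invertible map `-I`; inserting `I v` undoes it. -/
theorem extDeriv_fundamentalForm_eq_zero (h : Compatible g I) (hφ : φ ∈ charts m M)
    (hy : y ∈ φ.target) (h0 : dcFundamental g I h φ y = 0) :
    extDeriv ((fundamentalForm g I h).inChart φ) y = 0 := by
  rw [dcFundamental_eq h hφ hy] at h0
  ext v
  have h1 := DFunLike.congr_fun h0 (fun j => I.inChart φ y (v j))
  rw [ContinuousAlternatingMap.compContinuousLinearMap_apply] at h1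
  have h2 : (-(I.inChart φ y)) ∘ (fun j => I.inChart φ y (v j)) = v := by
    funext j
    simp [inChart_sq I hφ hy]
  rwa [h2] at h1

end Torsion

/-! ### Partial derivatives, Jacobians and the Piola identity -/

section Calculus

variable {m : ℕ} {y : Coord m} {u v : Coord m → ℝ}

theorem contDiffAt_pd (i : Fin m) (h : ContDiffAt ℝ ∞ u y) : ContDiffAt ℝ ∞ (pd i u) y :=
  (h.fderiv_right (m := ∞) (by simp)).clm_apply contDiffAt_const

theorem ContDiffAt.diff {F : Type*} [NormedAddCommGroup F] [NormedSpace ℝ F] {f : Coord m → F}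
    (h : ContDiffAt ℝ ∞ f y) : DifferentiableAt ℝ f y :=
  h.differentiableAt (by simp)

theorem ContDiffAt.eventually_diff {F : Type*} [NormedAddCommGroup F] [NormedSpace ℝ F]
    {f : Coord m → F} (h : ContDiffAt ℝ ∞ f y) : ∀ᶠ z in 𝓝 y, DifferentiableAt ℝ f z :=
  ((h.of_le (m := 1) (WithTop.coe_le_coe.2 le_top)).eventually (by simp)).mono
    fun _ hz => hz.differentiableAt (by simp)

theorem pd_congr {i : Fin m} (h : u =ᶠ[𝓝 y] v) : pd i u y = pd i v y := by
  unfold pd; rw [h.fderiv_eq]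

theorem pd_add (i : Fin m) (hu : DifferentiableAt ℝ u y) (hv : DifferentiableAt ℝ v y) :
    pd i (fun z => u z + v z) y = pd i u y + pd i v y := by
  unfold pd; rw [fderiv_fun_add hu hv]; rfl

theorem pd_sub (i : Fin m) (hu : DifferentiableAt ℝ u y) (hv : DifferentiableAt ℝ v y) :
    pd i (fun z => u z - v z) y = pd i u y - pd i v y := by
  unfold pd; rw [fderiv_fun_sub hu hv]; rfl

theorem pd_mul (i : Fin m) (hu : DifferentiableAt ℝ u y) (hv : DifferentiableAt ℝ v y) :
    pd i (fun z => u z * v z) y = pd i u y * v y + u y * pd i v y := by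
  unfold pd; rw [fderiv_fun_mul hu hv]
  simp only [add_apply, smul_apply, smul_eq_mul]; ring

theorem pd_const (i : Fin m) (c : ℝ) : pd i (fun _ => c) y = 0 := by
  unfold pd; simp

theorem pd_const_mul (i : Fin m) (c : ℝ) (hu : DifferentiableAt ℝ u y) :
    pd i (fun z => c * u z) y = c * pd i u y := by
  rw [pd_mul i (differentiableAt_const c) hu, pd_const]; ring

theorem pd_sum (i : Fin m) {ι : Type*} (s : Finset ι) {f : ι → Coord m → ℝ}
    (hf : ∀ a ∈ s, DifferentiableAt ℝ (f a) y) :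
    pd i (fun z => ∑ a ∈ s, f a z) y = ∑ a ∈ s, pd i (f a) y := by
  unfold pd; rw [fderiv_fun_sum hf]; simp

theorem pd_comm_of_contDiffAt_two (i j : Fin m) (h : ContDiffAt ℝ 2 u y) :
    pd i (pd j u) y = pd j (pd i u) y := by
  have h1 : DifferentiableAt ℝ (fderiv ℝ u) y :=
    (h.fderiv_right (m := 1) (by norm_num)).differentiableAt (by simp)
  have h2 : IsSymmSndFDerivAt ℝ u y := h.isSymmSndFDerivAt (by simp)
  have key : ∀ a b : Fin m, pd a (pd b u) y = fderiv ℝ (fderiv ℝ u) y (e a) (e b) := by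
    intro a b
    unfold pd
    rw [fderiv_clm_apply h1 (differentiableAt_const _)]
    simp
  rw [key, key]
  exact h2 _ _

theorem ContDiffAt.of_le_two (h : ContDiffAt ℝ ∞ u y) : ContDiffAt ℝ 2 u y :=
  h.of_le (WithTop.coe_le_coe.2 le_top)

theorem pd_comm (i j : Fin m) (h : ContDiffAt ℝ ∞ u y) : pd i (pd j u) y = pd j (pd i u) y :=
  pd_comm_of_contDiffAt_two i j (ContDiffAt.of_le_two h)

theorem pd_pd_comm (k i j : Fin m) (h : ContDiffAt ℝ ∞ u y) :
    pd k (pd i (pd j u)) y = pd k (pd j (pd i u)) y := by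
  refine pd_congr ?_
  filter_upwards [(ContDiffAt.of_le_two h).eventually (by simp)] with z hz
    using pd_comm_of_contDiffAt_two i j hz

theorem fderiv_apply_eq_sum (u : Coord m → ℝ) (w : Coord m) :
    fderiv ℝ u y w = ∑ i, w i * pd i u y := by
  conv_lhs => rw [coord_eq_sum w]
  simp [pd]

theorem fderiv_apply_coord {τ : Coord m → Coord m} (hτ : DifferentiableAt ℝ τ y) (w : Coord m)
    (i : Fin m) : fderiv ℝ τ y w i = fderiv ℝ (fun z => τ z i) y w := by
  have h := ((EuclideanSpace.proj i : Coord m →L[ℝ] ℝ).hasFDerivAt.comp y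
    hτ.hasFDerivAt).fderiv
  have h2 : (fun z => τ z i) = (EuclideanSpace.proj i : Coord m →L[ℝ] ℝ) ∘ τ := rfl
  rw [h2, h]
  rfl

theorem differentiableAt_coord {τ : Coord m → Coord m} (hτ : DifferentiableAt ℝ τ y)
    (i : Fin m) : DifferentiableAt ℝ (fun z => τ z i) y :=
  differentiableAt_euclidean.1 hτ i

/-- The Jacobian matrix of a map. -/
def jacobian (τ : Coord m → Coord m) (y : Coord m) : Matrix (Fin m) (Fin m) ℝ :=
  Matrix.of fun i j => pd j (fun z => τ z i) y

theorem jacobian_apply (τ : Coord m → Coord m) (i j : Fin m) :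
    jacobian τ y i j = pd j (fun z => τ z i) y := rfl

theorem fderiv_apply_jacobian {τ : Coord m → Coord m} (hτ : DifferentiableAt ℝ τ y) (w : Coord m)
    (i : Fin m) : fderiv ℝ τ y w i = ∑ j, jacobian τ y i j * w j := by
  rw [fderiv_apply_coord hτ, fderiv_apply_eq_sum]
  exact Finset.sum_congr rfl fun j _ => mul_comm _ _

theorem det_fderiv_eq {τ : Coord m → Coord m} (hτ : DifferentiableAt ℝ τ y) :
    (fderiv ℝ τ y).det = (jacobian τ y).det := by
  have h := LinearMap.det_toMatrix (EuclideanSpace.basisFun (Fin m) ℝ).toBasis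
    (fderiv ℝ τ y).toLinearMap
  refine h.symm.trans (congrArg Matrix.det ?_)
  ext i j
  rw [LinearMap.toMatrix_apply, jacobian_apply]
  simp only [OrthonormalBasis.coe_toBasis, EuclideanSpace.basisFun_apply]
  exact fderiv_apply_coord hτ (e j) i

theorem pd_comp {τ : Coord m → Coord m} (hτ : DifferentiableAt ℝ τ y)
    (hu : DifferentiableAt ℝ u (τ y)) (j : Fin m) :
    pd j (fun z => u (τ z)) y = ∑ k, pd k u (τ y) * jacobian τ y k j := by
  have h := fderiv_comp y hu hτ
  unfold pd
  rw [show (fun z => u (τ z)) = u ∘ τ from rfl, h, ContinuousLinearMap.comp_apply,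
    fderiv_apply_eq_sum]
  refine Finset.sum_congr rfl fun k _ => ?_
  rw [fderiv_apply_coord hτ, mul_comm]
  rfl

theorem det_updateCol_eq {n : ℕ} (B : Matrix (Fin n) (Fin n) ℝ) (b : Fin n → ℝ) (i : Fin n) :
    (B.updateCol i b).det = ∑ j, B.adjugate i j * b j := by
  rw [← Matrix.cramer_apply, Matrix.cramer_eq_adjugate_mulVec]
  rfl

theorem differentiableAt_det {n : ℕ} {B : Coord m → Matrix (Fin n) (Fin n) ℝ}
    (hB : ∀ i j, DifferentiableAt ℝ (fun z => B z i j) y) :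
    DifferentiableAt ℝ (fun z => (B z).det) y := by
  simp_rw [Matrix.det_apply']
  fun_prop

theorem contDiffAt_det {n : ℕ} {B : Coord m → Matrix (Fin n) (Fin n) ℝ}
    (hB : ∀ i j, ContDiffAt ℝ ∞ (fun z => B z i j) y) :
    ContDiffAt ℝ ∞ (fun z => (B z).det) y := by
  simp_rw [Matrix.det_apply']
  exact ContDiffAt.sum fun σ _ => contDiffAt_const.mul (contDiffAt_prod fun j _ => hB _ _)

theorem contDiffAt_inv {n : ℕ} {B : Coord m → Matrix (Fin n) (Fin n) ℝ}
    (hB : ∀ i j, ContDiffAt ℝ ∞ (fun z => B z i j) y) (h : (B y).det ≠ 0) (i j : Fin n) :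
    ContDiffAt ℝ ∞ (fun z => (B z)⁻¹ i j) y := by
  simp_rw [Matrix.inv_def, Matrix.smul_apply, Matrix.adjugate_apply, Ring.inverse_eq_inv',
    smul_eq_mul]
  refine ((contDiffAt_det hB).inv h).mul (contDiffAt_det fun a b => ?_)
  by_cases ha : a = j
  · simp only [Matrix.updateRow_apply, ha, if_true]
    exact contDiffAt_const
  · simp only [Matrix.updateRow_apply, ha, if_false]
    exact hB _ _

/-- Jacobi's formula: the determinant is linear in each column, so its derivative is the sum of the
determinants with one column differentiated, each expanded by cofactors. -/
theorem pd_det {n : ℕ} {B : Coord m → Matrix (Fin n) (Fin n) ℝ}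
    (hB : ∀ i j, DifferentiableAt ℝ (fun z => B z i j) y) (l : Fin m) :
    pd l (fun z => (B z).det) y =
      ∑ i, ∑ j, (B y).adjugate i j * pd l (fun z => B z j i) y := by
  have h1 : ∀ i, ∑ j, (B y).adjugate i j * pd l (fun z => B z j i) y =
      ((B y).updateCol i fun j => pd l (fun z => B z j i) y).det := fun i =>
    (det_updateCol_eq _ _ _).symm
  simp_rw [h1, Matrix.det_apply']
  rw [pd_sum l _ (fun σ _ => by fun_prop), Finset.sum_comm]
  refine Finset.sum_congr rfl fun σ _ => ?_
  rw [pd_const_mul l _ (by fun_prop), ← Finset.mul_sum]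
  congr 1
  have h2 := HasFDerivAt.finsetProd (u := Finset.univ) (g := fun j z => B z (σ j) j)
    (x := y) (fun j _ => (hB (σ j) j).hasFDerivAt)
  unfold pd
  rw [h2.fderiv, sum_apply]
  refine Finset.sum_congr rfl fun i _ => ?_
  rw [← Finset.mul_prod_erase _ _ (Finset.mem_univ i)]
  rw [smul_apply, smul_eq_mul, Matrix.updateCol_self, mul_comm]
  congr 1
  refine Finset.prod_congr rfl fun j hj => ?_
  rw [Matrix.updateCol_ne (Finset.ne_of_mem_erase hj)]

/-- The Euclidean divergence of a vector field. -/
def divergence (Z : Coord m → Coord m) (y : Coord m) : ℝ := ∑ i, pd i (fun z => Z z i) y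

/-- The Piola identity: the divergence of a vector density is invariant. -/
theorem divergence_transform {τ Z Z' : Coord m → Coord m} (hτ : ContDiffAt ℝ ∞ τ y)
    (hdet : (fderiv ℝ τ y).det ≠ 0) (hZ : DifferentiableAt ℝ Z (τ y))
    (hZ' : DifferentiableAt ℝ Z' y)
    (h : ∀ᶠ z in 𝓝 y, fderiv ℝ τ z (Z' z) = |(fderiv ℝ τ z).det| • Z (τ z)) :
    divergence Z' y = |(fderiv ℝ τ y).det| * divergence Z (τ y) := by
  have hτi : ∀ i, ContDiffAt ℝ ∞ (fun z => τ z i) y := fun i => contDiffAt_euclidean.1 hτ i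
  have hτd : ∀ᶠ z in 𝓝 y, DifferentiableAt ℝ τ z :=
    ContDiffAt.eventually_diff hτ
  have hA : ∀ i j, ContDiffAt ℝ ∞ (fun z => jacobian τ z i j) y := fun i j =>
    contDiffAt_pd j (hτi i)
  have hdetA := contDiffAt_det hA
  rw [det_fderiv_eq (ContDiffAt.diff hτ)] at hdet ⊢
  -- The sign of the Jacobian determinant is locally constant; fixing it as `s` removes the absolute
  -- value before differentiating.
  obtain ⟨s, hs⟩ : ∃ s : ℝ, ∀ᶠ z in 𝓝 y, |(jacobian τ z).det| = s * (jacobian τ z).det := by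
    rcases lt_or_gt_of_ne hdet with h0 | h0
    · refine ⟨-1, ?_⟩
      filter_upwards [hdetA.continuousAt.eventually (gt_mem_nhds h0)] with z hz
      rw [abs_of_neg hz]; ring
    · refine ⟨1, ?_⟩
      filter_upwards [hdetA.continuousAt.eventually (lt_mem_nhds h0)] with z hz
      rw [abs_of_pos hz]; ring
  have hZ'i := fun j => differentiableAt_coord hZ' j
  have hZi := fun j => differentiableAt_coord hZ j
  have hZτ : ∀ j, DifferentiableAt ℝ (fun z => Z (τ z) j) y := fun j =>
    DifferentiableAt.comp y (hZi j) (ContDiffAt.diff hτ)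
  have hAd := fun i j => ContDiffAt.diff (hA i j)
  have hdetd := ContDiffAt.diff hdetA
  -- the transformation law in coordinates
  have hlaw : ∀ i, (fun z => ∑ j, jacobian τ z i j * Z' z j) =ᶠ[𝓝 y]
      fun z => s * ((jacobian τ z).det * Z (τ z) i) := by
    intro i
    filter_upwards [h, hs, hτd] with z h1 h2 h3
    rw [← fderiv_apply_jacobian h3, h1, det_fderiv_eq h3, h2]
    simp [mul_assoc]
  have hD : ∀ i l, ∑ j, (pd l (fun z => jacobian τ z i j) y * Z' y j
        + jacobian τ y i j * pd l (fun z => Z' z j) y)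
      = s * (pd l (fun z => (jacobian τ z).det) y * Z (τ y) i
        + (jacobian τ y).det * ∑ k, pd k (fun z => Z z i) (τ y) * jacobian τ y k l) := by
    intro i l
    have h1 := pd_congr (i := l) (hlaw i)
    rw [pd_sum l _ (fun j _ => (hAd i j).fun_mul (hZ'i j)),
      pd_const_mul l s (hdetd.fun_mul (hZτ i)), pd_mul l hdetd (hZτ i),
      pd_comp (ContDiffAt.diff hτ) (hZi i)] at h1
    rw [← h1]
    exact Finset.sum_congr rfl fun j _ => (pd_mul l (hAd i j) (hZ'i j)).symm
  set A := jacobian τ y with hAdef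
  set C := A.adjugate with hC
  have hsym : ∀ i j l, pd l (fun z => jacobian τ z i j) y = pd j (fun z => jacobian τ z i l) y :=
    fun i j l => pd_comm l j (hτi i)
  have hCA : ∀ l j, ∑ i, C l i * A i j = if l = j then A.det else 0 := by
    intro l j
    have := congrFun (congrFun (Matrix.adjugate_mul A) l) j
    rw [Matrix.mul_apply] at this
    rw [this]
    simp [Matrix.one_apply]
  have hAC : ∀ k i, ∑ l, A k l * C l i = if k = i then A.det else 0 := by
    intro l j
    have := congrFun (congrFun (Matrix.mul_adjugate A) l) j
    rw [Matrix.mul_apply] at this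
    rw [this]
    simp [Matrix.one_apply]
  -- the law solved for `Z'`
  have hsolve : ∀ l, s * ∑ i, C l i * Z (τ y) i = Z' y l := by
    intro l
    have h1 : ∑ i, C l i * (∑ j, A i j * Z' y j) = A.det * Z' y l := by
      simp_rw [Finset.mul_sum, ← mul_assoc]
      rw [Finset.sum_comm]
      simp_rw [← Finset.sum_mul, hCA]
      simp
    have h2 : ∀ i, ∑ j, A i j * Z' y j = s * (A.det * Z (τ y) i) := fun i =>
      (hlaw i).self_of_nhds
    simp_rw [h2] at h1
    have h3 : A.det * (s * ∑ i, C l i * Z (τ y) i) = A.det * Z' y l := by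
      rw [← h1, Finset.mul_sum, Finset.mul_sum]
      exact Finset.sum_congr rfl fun i _ => by ring
    exact mul_left_cancel₀ hdet h3
  -- The differentiated transformation law is contracted with the adjugate of the Jacobian, which
  -- isolates both divergences up to terms in the second derivatives of `τ`.
  have hsum : ∑ l, ∑ i, C l i * ∑ j, (pd l (fun z => jacobian τ z i j) y * Z' y j
        + A i j * pd l (fun z => Z' z j) y)
      = ∑ l, ∑ i, C l i * (s * (pd l (fun z => (jacobian τ z).det) y * Z (τ y) i
        + A.det * ∑ k, pd k (fun z => Z z i) (τ y) * A k l)) :=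
    Finset.sum_congr rfl fun l _ => Finset.sum_congr rfl fun i _ => by rw [hD i l]
  have hL : ∑ l, ∑ i, C l i * ∑ j, (pd l (fun z => jacobian τ z i j) y * Z' y j
        + A i j * pd l (fun z => Z' z j) y)
      = (∑ l, ∑ i, ∑ j, C l i * pd l (fun z => jacobian τ z i j) y * Z' y j)
        + A.det * divergence Z' y := by
    simp_rw [Finset.mul_sum, mul_add, Finset.sum_add_distrib, ← mul_assoc]
    congr 1
    unfold divergence
    rw [Finset.mul_sum]
    refine Finset.sum_congr rfl fun l _ => ?_
    rw [Finset.sum_comm]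
    simp_rw [← Finset.sum_mul, hCA]
    simp
  have hR : ∑ l, ∑ i, C l i * (s * (pd l (fun z => (jacobian τ z).det) y * Z (τ y) i
        + A.det * ∑ k, pd k (fun z => Z z i) (τ y) * A k l))
      = (∑ l, pd l (fun z => (jacobian τ z).det) y * Z' y l)
        + s * A.det * (A.det * divergence Z (τ y)) := by
    simp_rw [mul_add, Finset.sum_add_distrib]
    congr 1
    · refine Finset.sum_congr rfl fun l _ => ?_
      rw [← hsolve l, Finset.mul_sum, Finset.mul_sum]
      exact Finset.sum_congr rfl fun i _ => by ring
    · rw [Finset.sum_comm]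
      unfold divergence
      simp_rw [Finset.mul_sum]
      refine Finset.sum_congr rfl fun i _ => ?_
      rw [Finset.sum_comm]
      have : ∀ k, ∑ l, C l i * (s * (A.det * (pd k (fun z => Z z i) (τ y) * A k l)))
          = s * A.det * pd k (fun z => Z z i) (τ y) * ∑ l, A k l * C l i := by
        intro k
        rw [Finset.mul_sum]
        exact Finset.sum_congr rfl fun l _ => by ring
      simp_rw [this, hAC]
      simp
      ring
  -- The second-derivative terms of the two sides agree: Jacobi's formula turns one into the other
  -- once the order of differentiation is exchanged.
  have hX : ∑ l, pd l (fun z => (jacobian τ z).det) y * Z' y l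
      = ∑ l, ∑ i, ∑ j, C l i * pd l (fun z => jacobian τ z i j) y * Z' y j := by
    simp_rw [pd_det hAd, Finset.sum_mul]
    -- swap the differentiation index with the column index
    rw [Finset.sum_comm]
    refine Finset.sum_congr rfl fun l _ => ?_
    rw [Finset.sum_comm]
    refine Finset.sum_congr rfl fun i _ => Finset.sum_congr rfl fun j _ => ?_
    rw [hsym i l j]
  rw [hL, hR, hX, add_right_inj] at hsum
  have h3 : A.det * divergence Z' y = A.det * (s * A.det * divergence Z (τ y)) := by
    rw [hsum]; ring
  rw [hs.self_of_nhds]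
  exact mul_left_cancel₀ hdet h3

end Calculus

open MeasureTheory

/-! ### Integration by parts in coordinate space -/

section Integrals

variable {m : ℕ}

theorem integrableOn_of_compact {h : Coord m → ℝ} {U K : Set (Coord m)} (hU : IsOpen U)
    (hK : IsCompact K) (hKU : K ⊆ U) (hc : ContinuousOn h U) (h0 : ∀ y ∈ U \ K, h y = 0) :
    IntegrableOn h U :=
  ((hc.mono hKU).integrableOn_compact hK).of_forall_sdiff_eq_zero hU.measurableSet h0

theorem divergence_congr {V W : Coord m → Coord m} {y : Coord m} (h : V =ᶠ[𝓝 y] W) :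
    divergence V y = divergence W y := by
  unfold divergence
  refine Finset.sum_congr rfl fun i _ => pd_congr ?_
  filter_upwards [h] with z hz
  rw [hz]

theorem integral_pd_eq_zero {u : Coord m → ℝ} (hu : ContDiff ℝ 1 u) (hc : HasCompactSupport u)
    (i : Fin m) : ∫ y, pd i u y = 0 := by
  have hi : Integrable u := hu.continuous.integrable_of_hasCompactSupport hc
  have hd : Integrable (fun y => fderiv ℝ u y (e i)) :=
    ((hu.continuous_fderiv (by simp)).clm_apply
      continuous_const).integrable_of_hasCompactSupport (hc.fderiv_apply ℝ (e i))
  -- Integration by parts against the constant function 1, whose derivative is zero.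
  have h := integral_mul_fderiv_eq_neg_fderiv_mul_of_integrable (μ := volume)
    (f := fun _ : Coord m => (1 : ℝ)) (g := u) (v := e i)
    (by simp) (by simpa using hd) (by simpa using hi)
    (fun x _ => differentiableAt_const _) (fun x _ => hu.differentiable (by simp) x)
  simpa [pd] using h

/-- Extending `V` by zero outside `U` keeps it `C¹`, because `V` already vanishes on `U` off the
compact set `K`. The integral over `U` is then one over the whole space. -/
theorem setIntegral_divergence_eq_zero {V : Coord m → Coord m} {U K : Set (Coord m)}
    (hU : IsOpen U) (hK : IsCompact K) (hKU : K ⊆ U) (hV : ∀ y ∈ U, ContDiffAt ℝ 1 V y)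
    (h0 : ∀ y ∈ U \ K, V y = 0) : ∫ y in U, divergence V y = 0 := by
  classical
  set W := U.indicator V with hW
  have hWU : ∀ y ∈ U, W =ᶠ[𝓝 y] V := fun y hy => by
    filter_upwards [hU.mem_nhds hy] with z hz using Set.indicator_of_mem hz V
  have hWK : ∀ y ∉ K, W y = 0 := fun y hy => by
    by_cases hyU : y ∈ U
    · rw [hW, Set.indicator_of_mem hyU, h0 y ⟨hyU, hy⟩]
    · rw [hW, Set.indicator_of_notMem hyU]
  have hWK' : ∀ y ∉ K, W =ᶠ[𝓝 y] fun _ => 0 := fun y hy => by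
    filter_upwards [hK.isClosed.isOpen_compl.mem_nhds hy] with z hz using hWK z hz
  have hWs : ContDiff ℝ 1 W := contDiff_iff_contDiffAt.2 fun y => by
    by_cases hy : y ∈ K
    · exact (hV y (hKU hy)).congr_of_eventuallyEq (hWU y (hKU hy))
    · exact contDiffAt_const.congr_of_eventuallyEq (hWK' y hy)
  have hWc : ∀ i, HasCompactSupport fun y => W y i := fun i =>
    HasCompactSupport.intro hK fun y hy => by rw [hWK y hy]; rfl
  have hWi : ∀ i, ContDiff ℝ 1 fun y => W y i := fun i => contDiff_euclidean.1 hWs i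
  have h1 : ∫ y in U, divergence V y = ∫ y in U, divergence W y :=
    setIntegral_congr_fun hU.measurableSet fun y hy => (divergence_congr (hWU y hy)).symm
  have h2 : ∫ y in U, divergence W y = ∫ y, divergence W y := by
    refine setIntegral_eq_integral_of_forall_compl_eq_zero fun y hy => ?_
    rw [divergence_congr (hWK' y fun h => hy (hKU h))]
    unfold divergence
    refine Finset.sum_eq_zero fun i _ => ?_
    exact pd_const i _
  rw [h1, h2]
  unfold divergence
  rw [integral_finsetSum]
  · exact Finset.sum_eq_zero fun i _ => integral_pd_eq_zero (hWi i) (hWc i) i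
  · intro i _
    exact (((hWi i).continuous_fderiv (by simp)).clm_apply
      continuous_const).integrable_of_hasCompactSupport ((hWc i).fderiv_apply ℝ (e i))

end Integrals

/-! ### The divergence theorem for vector densities on a compact manifold -/

section DivergenceTheorem

variable {m : ℕ} {M : Type*} [TopologicalSpace M] [ChartedSpace (Coord m) M]
  [IsManifold 𝓘(ℝ, Coord m) ∞ M]

/-- A smooth vector density, given by its coordinate expressions. -/
structure IsVectorDensity
    (Z : OpenPartialHomeomorph M (Coord m) → Coord m → Coord m) : Prop where
  contDiffAt : ∀ φ ∈ charts m M, ∀ y ∈ φ.target, ContDiffAt ℝ ∞ (Z φ) y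
  law : ∀ φ ∈ charts m M, ∀ ψ ∈ charts m M, ∀ y ∈ ψ.target, ψ.symm y ∈ φ.source →
    fderiv ℝ (transition φ ψ) y (Z ψ y)
      = |(fderiv ℝ (transition φ ψ) y).det| • Z φ (transition φ ψ y)

theorem divergence_smul {r : Coord m → ℝ} {V : Coord m → Coord m} {y : Coord m}
    (hr : DifferentiableAt ℝ r y) (hV : DifferentiableAt ℝ V y) :
    divergence (fun z => r z • V z) y = r y * divergence V y + fderiv ℝ r y (V y) := by
  unfold divergence
  rw [fderiv_apply_eq_sum, Finset.mul_sum, ← Finset.sum_add_distrib]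
  refine Finset.sum_congr rfl fun i _ => ?_
  simp only [PiLp.smul_apply, smul_eq_mul]
  rw [pd_mul i hr (differentiableAt_coord hV i)]
  ring

variable {Z : OpenPartialHomeomorph M (Coord m) → Coord m → Coord m}

theorem continuousOn_fderiv_apply {r : Coord m → ℝ} {V : Coord m → Coord m} {U : Set (Coord m)}
    (hr : ∀ y ∈ U, ContDiffAt ℝ ∞ r y) (hV : ∀ y ∈ U, ContDiffAt ℝ ∞ V y) :
    ContinuousOn (fun y => fderiv ℝ r y (V y)) U := fun y hy =>
  ((((hr y hy).fderiv_right (m := ∞) (by simp)).clm_apply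
    (hV y hy)).continuousAt).continuousWithinAt

theorem continuousOn_divergence {V : Coord m → Coord m} {U : Set (Coord m)}
    (hV : ∀ y ∈ U, ContDiffAt ℝ ∞ V y) : ContinuousOn (divergence V) U := fun y hy =>
  (ContDiffAt.sum fun i _ =>
    contDiffAt_pd i (contDiffAt_euclidean.1 (hV y hy) i)).continuousAt.continuousWithinAt

/-- Invariance of the integral of `σ · dρ(Z)` under a change of charts. -/
theorem IsVectorDensity.integral_eq (hZ : IsVectorDensity Z)
    {φ ψ : OpenPartialHomeomorph M (Coord m)} (hφ : φ ∈ charts m M) (hψ : ψ ∈ charts m M)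
    {ρ σ : M → ℝ} (hρ : ContMDiff 𝓘(ℝ, Coord m) 𝓘(ℝ, ℝ) ∞ ρ)
    (hρs : tsupport ρ ⊆ ψ.source) (hσs : tsupport σ ⊆ φ.source) :
    ∫ y in ψ.target, σ (ψ.symm y) * fderiv ℝ (ρ ∘ ψ.symm) y (Z ψ y)
      = ∫ y in φ.target, σ (φ.symm y) * fderiv ℝ (ρ ∘ φ.symm) y (Z φ y) := by
  set τ := ψ.symm.trans φ with hτ
  have hsrc : τ.source ⊆ ψ.target := fun y hy => hy.1
  have htgt : τ.target ⊆ φ.target := fun y hy => hy.1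
  have h1 : ∫ y in τ.source, σ (ψ.symm y) * fderiv ℝ (ρ ∘ ψ.symm) y (Z ψ y)
      = ∫ y in ψ.target, σ (ψ.symm y) * fderiv ℝ (ρ ∘ ψ.symm) y (Z ψ y) := by
    -- Both integrands vanish off the overlap of the charts: in `ψ` because `σ` is supported in the
    -- domain of `φ`, in `φ` because `dρ` is supported in that of `ψ`. On the overlap the density
    -- law supplies the Jacobian factor.
    symm
    refine setIntegral_eq_of_subset_of_forall_sdiff_eq_zero ψ.open_target.measurableSet hsrc ?_
    intro y hy
    have : σ (ψ.symm y) = 0 := by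
      by_contra h
      exact hy.2 ⟨hy.1, hσs (subset_tsupport _ h)⟩
    rw [this, zero_mul]
  have h2 : ∫ y in τ.target, σ (φ.symm y) * fderiv ℝ (ρ ∘ φ.symm) y (Z φ y)
      = ∫ y in φ.target, σ (φ.symm y) * fderiv ℝ (ρ ∘ φ.symm) y (Z φ y) := by
    symm
    refine setIntegral_eq_of_subset_of_forall_sdiff_eq_zero φ.open_target.measurableSet htgt ?_
    intro y hy
    have hn : φ.symm y ∉ tsupport ρ := fun h => hy.2 ⟨hy.1, hρs h⟩
    have hev : ρ ∘ φ.symm =ᶠ[𝓝 y] fun _ => 0 :=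
      ((φ.continuousAt_symm hy.1).eventually
        ((isClosed_tsupport ρ).isOpen_compl.mem_nhds hn)).mono
        fun z hz => image_eq_zero_of_notMem_tsupport (f := ρ) hz
    rw [hev.fderiv_eq]
    simp
  rw [← h1, ← h2, integral_target_eq_integral_abs_det_fderiv_smul volume (f := τ)
    (f' := fun y => fderiv ℝ (transition φ ψ) y)]
  · refine setIntegral_congr_fun τ.open_source.measurableSet fun y hy => ?_
    have hy1 : y ∈ ψ.target := hy.1
    have hy2 : ψ.symm y ∈ φ.source := hy.2
    have e1 : τ y = transition φ ψ y := rfl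
    simp only [e1, smul_eq_mul]
    rw [symm_transition hy2, mul_left_comm]
    congr 1
    have h3 : ρ ∘ ψ.symm =ᶠ[𝓝 y] (ρ ∘ φ.symm) ∘ transition φ ψ := by
      filter_upwards [eventually_overlap hy1 hy2] with z hz
      simp only [Function.comp]
      rw [symm_transition hz.2]
    rw [h3.fderiv_eq, fderiv_comp y
      (ContDiffAt.diff (contDiffAt_comp_symm hρ hφ (transition_mem_target hy2)))
      (ContDiffAt.diff (contDiffAt_transition hφ hψ hy1 hy2)), ContinuousLinearMap.comp_apply,
      hZ.law φ hφ ψ hψ y hy1 hy2, map_smul, smul_eq_mul]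
  · intro y hy
    exact (ContDiffAt.diff (contDiffAt_transition hφ hψ hy.1 hy.2)).hasFDerivAt

set_option maxHeartbeats 800000 in
/-- On a compact manifold a vector density of nonnegative divergence is divergence free. -/
theorem IsVectorDensity.divergence_eq_zero [T2Space M] [CompactSpace M]
    (hZ : IsVectorDensity Z)
    (hpos : ∀ φ ∈ charts m M, ∀ y ∈ φ.target, 0 ≤ divergence (Z φ) y)
    {φ : OpenPartialHomeomorph M (Coord m)} (hφ : φ ∈ charts m M) {y : Coord m}
    (hy : y ∈ φ.target) : divergence (Z φ) y = 0 := by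
  classical
  set p := φ.symm y with hp
  -- The cover consists of `φ` itself, indexed by `none`, and of standard charts with `p` removed.
  -- Only the `none` function of a subordinate partition of unity can be nonzero at `p`, so it
  -- equals 1 there.
  let c : Option M → OpenPartialHomeomorph M (Coord m) := fun a => a.elim φ (chartAt (Coord m))
  let U : Option M → Set M :=
    fun a => a.elim φ.source (fun x => (chartAt (Coord m) x).source ∩ {p}ᶜ)
  have hc : ∀ a, c a ∈ charts m M := by
    rintro (_ | x)
    · exact hφ
    · exact IsManifold.chart_mem_maximalAtlas x
  have hUo : ∀ a, IsOpen (U a) := by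
    rintro (_ | x)
    · exact φ.open_source
    · exact (chartAt (Coord m) x).open_source.inter isOpen_compl_singleton
  have hUc : ∀ a, U a ⊆ (c a).source := by
    rintro (_ | x)
    · exact fun _ h => h
    · exact fun _ h => h.1
  have hcov : (Set.univ : Set M) ⊆ ⋃ a, U a := by
    intro x _
    rw [Set.mem_iUnion]
    by_cases hx : x = p
    · exact ⟨none, hx ▸ φ.map_target hy⟩
    · exact ⟨some x, mem_chart_source _ x, hx⟩
  obtain ⟨ρ, hρ⟩ := SmoothPartitionOfUnity.exists_isSubordinate 𝓘(ℝ, Coord m) isClosed_univ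
    U hUo hcov
  obtain ⟨t, ht⟩ : ∃ t : Finset (Option M), ∀ a ∉ t, ∀ x, ρ a x = 0 := by
    refine ⟨(ρ.locallyFinite.finite_nonempty_of_compact).toFinset, fun a ha x => ?_⟩
    by_contra h
    exact ha ((Set.Finite.mem_toFinset _).2 ⟨x, h⟩)
  have hsum : ∀ x, ∑ a ∈ t, ρ a x = 1 := by
    intro x
    rw [← ρ.sum_eq_one (Set.mem_univ x)]
    exact (finsum_eq_sum_of_support_subset _ fun a ha => by
      by_contra h
      exact ha (ht a h x)).symm
  have hρp : ρ none p = 1 := by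
    have h1 : ∀ x : M, ρ (some x) p = 0 := fun x => by
      by_contra h
      exact (hρ (some x) (subset_tsupport _ h)).2 rfl
    have hn : (none : Option M) ∈ t := by
      by_contra h
      have h2 : ∑ a ∈ t, ρ a p = 0 := by
        refine Finset.sum_eq_zero fun a ha => ?_
        rcases a with _ | x
        · exact absurd ha h
        · exact h1 x
      rw [hsum] at h2
      exact one_ne_zero h2
    rw [← hsum p]
    symm
    refine Finset.sum_eq_single_of_mem none hn fun a _ ha => ?_
    rcases a with _ | x
    · exact absurd rfl ha
    · exact h1 x
  have hρs : ∀ a, ContMDiff 𝓘(ℝ, Coord m) 𝓘(ℝ, ℝ) ∞ (ρ a) := fun a => (ρ a).contMDiff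
  have hr : ∀ a b, ∀ z ∈ (c b).target, ContDiffAt ℝ ∞ (ρ a ∘ (c b).symm) z := fun a b z hz =>
    contDiffAt_comp_symm (hρs a) (hc b) hz
  have hsupp : ∀ a, tsupport (ρ a) ⊆ (c a).source := fun a => (hρ a).trans (hUc a)
  let K : Option M → Set (Coord m) := fun a => c a '' tsupport (ρ a)
  have hK : ∀ a, IsCompact (K a) := fun a =>
    (isClosed_tsupport (ρ a)).isCompact.image_of_continuousOn
      ((c a).continuousOn.mono (hsupp a))
  have hKt : ∀ a, K a ⊆ (c a).target := by
    rintro a _ ⟨x, hx, rfl⟩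
    exact (c a).map_source (hsupp a hx)
  have hK0 : ∀ a, ∀ z ∈ (c a).target \ K a, (c a).symm z ∉ tsupport (ρ a) := by
    rintro a z hz h
    exact hz.2 ⟨_, h, (c a).right_inv hz.1⟩
  have hr0 : ∀ a, ∀ z ∈ (c a).target \ K a, ρ a ((c a).symm z) = 0 := fun a z hz =>
    image_eq_zero_of_notMem_tsupport (hK0 a z hz)
  have hdr0 : ∀ a, ∀ z ∈ (c a).target \ K a, fderiv ℝ (ρ a ∘ (c a).symm) z = 0 := by
    intro a z hz
    have hev : ρ a ∘ (c a).symm =ᶠ[𝓝 z] fun _ => 0 :=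
      (((c a).continuousAt_symm hz.1).eventually
        ((isClosed_tsupport (ρ a)).isOpen_compl.mem_nhds (hK0 a z hz))).mono
        fun z hz => image_eq_zero_of_notMem_tsupport (f := ρ a) hz
    rw [hev.fderiv_eq]
    simp
  have hZc : ∀ a, ∀ z ∈ (c a).target, ContDiffAt ℝ ∞ (Z (c a)) z := fun a =>
    hZ.contDiffAt _ (hc a)
  have hcr : ∀ a b, ContinuousOn (ρ a ∘ (c b).symm) (c b).target := fun a b z hz =>
    (hr a b z hz).continuousAt.continuousWithinAt
  have hcD : ∀ a b, ContinuousOn (fun z => fderiv ℝ (ρ a ∘ (c b).symm) z (Z (c b) z))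
      (c b).target := fun a b => continuousOn_fderiv_apply (hr a b) (hZc b)
  -- integration by parts in one chart
  have hI1 : ∀ a, IntegrableOn (fun z => ρ a ((c a).symm z) * divergence (Z (c a)) z)
      (c a).target := fun a =>
    integrableOn_of_compact (c a).open_target (hK a) (hKt a)
      ((hcr a a).mul (continuousOn_divergence (hZc a)))
      (fun z hz => by rw [hr0 a z hz, zero_mul])
  have hI2 : ∀ a, IntegrableOn (fun z => fderiv ℝ (ρ a ∘ (c a).symm) z (Z (c a) z))
      (c a).target := fun a =>
    integrableOn_of_compact (c a).open_target (hK a) (hKt a) (hcD a a)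
      (fun z hz => by rw [hdr0 a z hz]; rfl)
  have hI3 : ∀ a b, IntegrableOn (fun z => ρ b ((c a).symm z) *
      fderiv ℝ (ρ a ∘ (c a).symm) z (Z (c a) z)) (c a).target := fun a b =>
    integrableOn_of_compact (c a).open_target (hK a) (hKt a) ((hcr b a).mul (hcD a a))
      (fun z hz => by rw [hdr0 a z hz]; simp)
  have hI4 : ∀ a b, IntegrableOn (fun z => ρ b ((c b).symm z) *
      fderiv ℝ (ρ a ∘ (c b).symm) z (Z (c b) z)) (c b).target := fun a b =>
    integrableOn_of_compact (c b).open_target (hK b) (hKt b) ((hcr b b).mul (hcD a b))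
      (fun z hz => by rw [hr0 b z hz, zero_mul])
  have hparts : ∀ a, ∫ z in (c a).target, ρ a ((c a).symm z) * divergence (Z (c a)) z
      = - ∫ z in (c a).target, fderiv ℝ (ρ a ∘ (c a).symm) z (Z (c a) z) := by
    intro a
    have h := setIntegral_divergence_eq_zero
      (V := fun z => (ρ a ∘ (c a).symm) z • Z (c a) z) (c a).open_target (hK a) (hKt a)
      (fun z hz => ((hr a a z hz).smul (hZc a z hz)).of_le (WithTop.coe_le_coe.2 le_top))
      (fun z hz => by simp [hr0 a z hz])
    rw [setIntegral_congr_fun (c a).open_target.measurableSet (fun z hz =>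
      divergence_smul (ContDiffAt.diff (hr a a z hz)) (ContDiffAt.diff (hZc a z hz)))] at h
    have h' := integral_add (hI1 a) (hI2 a)
    exact eq_neg_of_add_eq_zero_left (h'.symm.trans h)
  -- Insert `1 = Σ ρ_b`, so that each term can be moved from chart `a` to chart `b`.
  have hexp : ∀ a, ∫ z in (c a).target, fderiv ℝ (ρ a ∘ (c a).symm) z (Z (c a) z)
      = ∑ b ∈ t, ∫ z in (c a).target, ρ b ((c a).symm z) *
          fderiv ℝ (ρ a ∘ (c a).symm) z (Z (c a) z) := by
    intro a
    rw [← integral_finsetSum _ (fun b _ => hI3 a b)]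
    refine setIntegral_congr_fun (c a).open_target.measurableSet fun z _ => ?_
    rw [← Finset.sum_mul, hsum, one_mul]
  have hchange : ∀ a b, ∫ z in (c a).target, ρ b ((c a).symm z) *
          fderiv ℝ (ρ a ∘ (c a).symm) z (Z (c a) z)
      = ∫ z in (c b).target, ρ b ((c b).symm z) *
          fderiv ℝ (ρ a ∘ (c b).symm) z (Z (c b) z) := fun a b =>
    hZ.integral_eq (hc b) (hc a) (hρs a) (hsupp a) (hsupp b)
  -- In the fixed chart `b` the sum over `a` contains `Σ dρ_a = d1 = 0`.
  have hzero : ∀ b, ∑ a ∈ t, ∫ z in (c b).target, ρ b ((c b).symm z) *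
          fderiv ℝ (ρ a ∘ (c b).symm) z (Z (c b) z) = 0 := by
    intro b
    rw [← integral_finsetSum _ (fun a _ => hI4 a b)]
    rw [← integral_zero (Coord m) ℝ (μ := volume.restrict (c b).target)]
    refine setIntegral_congr_fun (c b).open_target.measurableSet fun z hz => ?_
    rw [← Finset.mul_sum]
    have h1 : ∑ a ∈ t, fderiv ℝ (ρ a ∘ (c b).symm) z = 0 := by
      rw [← fderiv_fun_sum (fun a _ => ContDiffAt.diff (hr a b z hz))]
      have : (fun x => ∑ a ∈ t, (ρ a ∘ (c b).symm) x) = fun _ => (1 : ℝ) :=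
        funext fun x => hsum _
      rw [this]
      simp
    have h2 := congrArg (fun L : Coord m →L[ℝ] ℝ => L (Z (c b) z)) h1
    simp only [sum_apply, zero_apply] at h2
    rw [h2, mul_zero]
  have htotal : ∑ a ∈ t, ∫ z in (c a).target, ρ a ((c a).symm z) * divergence (Z (c a)) z
      = 0 := by
    rw [Finset.sum_congr rfl fun a _ => (hparts a).trans (congrArg Neg.neg ((hexp a).trans
      (Finset.sum_congr rfl fun b _ => hchange a b))), Finset.sum_neg_distrib, Finset.sum_comm,
      Finset.sum_eq_zero fun b _ => hzero b, neg_zero]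
  have hnn : ∀ a, ∀ z ∈ (c a).target, 0 ≤ ρ a ((c a).symm z) * divergence (Z (c a)) z :=
    fun a z hz => mul_nonneg (ρ.nonneg a _) (hpos _ (hc a) z hz)
  have hn : (none : Option M) ∈ t := by
    by_contra h
    rw [ht _ h] at hρp
    exact zero_ne_one hρp
  -- Nonnegative integrals with sum zero vanish separately. In the chart `φ` the continuous
  -- integrand is then identically zero, and at `y` its cutoff factor is 1.
  have h0 := (Finset.sum_eq_zero_iff_of_nonneg (fun a _ =>
    setIntegral_nonneg (c a).open_target.measurableSet (hnn a))).1 htotal none hn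
  have hae := (setIntegral_eq_zero_iff_of_nonneg_ae
    ((ae_restrict_iff' (c none).open_target.measurableSet).2
      (Filter.Eventually.of_forall (hnn none))) (hI1 none)).1 h0
  have heq := Measure.eqOn_open_of_ae_eq hae (c none).open_target
    ((hcr none none).mul (continuousOn_divergence (hZc none))) continuousOn_const
  have hfin := heq hy
  have h5 : ρ none ((c none).symm y) = 1 := hρp
  simp only [h5, one_mul] at hfin
  exact hfin

end DivergenceTheorem

/-! ### Orthonormalizing a positive definite bilinear form -/

section LinearAlgebra

variable {m : ℕ}

theorem bilin_apply_eq_sum (G : Coord m →L[ℝ] Coord m →L[ℝ] ℝ) (v w : Coord m) :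
    G v w = ∑ i, ∑ j, v i * w j * G (e i) (e j) := by
  conv_lhs => rw [coord_eq_sum v, coord_eq_sum w]
  simp only [map_sum, map_smul, sum_apply, smul_apply, smul_eq_mul, Finset.mul_sum]
  rw [Finset.sum_comm]
  exact Finset.sum_congr rfl fun i _ => Finset.sum_congr rfl fun j _ => by ring

theorem posDef_of_bilin {G : Coord m →L[ℝ] Coord m →L[ℝ] ℝ} (hsymm : ∀ v w, G v w = G w v)
    (hpos : ∀ v, v ≠ 0 → 0 < G v v) :
    (Matrix.of fun i j => G (e i) (e j) : Matrix (Fin m) (Fin m) ℝ).PosDef := by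
  refine Matrix.PosDef.of_dotProduct_mulVec_pos ?_ fun x hx => ?_
  · ext i j
    simp [Matrix.conjTranspose_apply, hsymm]
  · have h := hpos (WithLp.toLp 2 x) (by simpa using hx)
    rw [bilin_apply_eq_sum] at h
    refine h.trans_eq ?_
    simp only [dotProduct, Matrix.mulVec, Matrix.of_apply, Finset.mul_sum, star_trivial]
    exact Finset.sum_congr rfl fun i _ => Finset.sum_congr rfl fun j _ => by ring

-- Factor the Gram matrix as `star B * B`; then `B⁻¹` maps the standard basis to an orthonormal one.
open scoped MatrixOrder ComplexOrder in
theorem exists_orthonormalizing {G : Coord m →L[ℝ] Coord m →L[ℝ] ℝ}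
    (hsymm : ∀ v w, G v w = G w v) (hpos : ∀ v, v ≠ 0 → 0 < G v v) :
    ∃ A : Coord m ≃L[ℝ] Coord m, ∀ v w, G (A v) (A w) = ∑ i, v i * w i := by
  have hS := posDef_of_bilin hsymm hpos
  set S : Matrix (Fin m) (Fin m) ℝ := Matrix.of fun i j => G (e i) (e j) with hSdef
  obtain ⟨B, hB, hSB⟩ := CStarAlgebra.isStrictlyPositive_iff_eq_star_mul_self.mp
    hS.isStrictlyPositive
  have hdet : IsUnit B.det := (Matrix.isUnit_iff_isUnit_det B).1 hB
  let A : Coord m ≃L[ℝ] Coord m := ContinuousLinearEquiv.equivOfInverse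
    (Matrix.toEuclideanCLM (𝕜 := ℝ) B⁻¹) (Matrix.toEuclideanCLM (𝕜 := ℝ) B)
    (fun v => by
      rw [← mul_apply_eq_comp, ← map_mul, Matrix.mul_nonsing_inv B hdet, map_one]
      rfl)
    (fun v => by
      rw [← mul_apply_eq_comp, ← map_mul, Matrix.nonsing_inv_mul B hdet, map_one]
      rfl)
  refine ⟨A, fun v w => ?_⟩
  have hG : ∀ v w, G v w = v.ofLp ⬝ᵥ (S.mulVec w.ofLp) := by
    intro v w
    rw [bilin_apply_eq_sum]
    simp only [dotProduct, Matrix.mulVec, hSdef, Matrix.of_apply, Finset.mul_sum]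
    exact Finset.sum_congr rfl fun i _ => Finset.sum_congr rfl fun j _ => by ring
  have hA : ∀ v, (A v).ofLp = B⁻¹.mulVec v.ofLp := fun v => rfl
  rw [hG, hA, hA, hSB, Matrix.mulVec_mulVec, mul_assoc, Matrix.mul_nonsing_inv B hdet, mul_one,
    Matrix.dotProduct_mulVec, Matrix.vecMul_mulVec]
  have h1 : B⁻¹.transpose * star B = 1 := by
    rw [Matrix.star_eq_conjTranspose, Matrix.conjTranspose_eq_transpose_of_trivial,
      ← Matrix.transpose_mul, Matrix.mul_nonsing_inv B hdet, Matrix.transpose_one]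
  rw [h1, Matrix.vecMul_one]
  rfl

end LinearAlgebra

/-! ### Charts in which the metric is Euclidean to first order at a point -/

section NormalCharts

variable {m : ℕ} {M : Type*} [TopologicalSpace M] [ChartedSpace (Coord m) M]
  [IsManifold 𝓘(ℝ, Coord m) ∞ M] {φ : OpenPartialHomeomorph M (Coord m)} {y : Coord m}

/-- The inverse function theorem allows precomposing a chart inverse with `τ`, which is only assumed
to have an invertible derivative at one point. -/
theorem exists_chart_of_contDiff (hφ : φ ∈ charts m M) {τ : Coord m → Coord m} {x : Coord m}
    (hτ : ContDiff ℝ ∞ τ) {A : Coord m ≃L[ℝ] Coord m}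
    (hA : HasFDerivAt τ (A : Coord m →L[ℝ] Coord m) x) (hx : τ x ∈ φ.target) :
    ∃ ψ ∈ charts m M, x ∈ ψ.target ∧ ψ.symm x = φ.symm (τ x) ∧ ψ.symm x ∈ φ.source ∧
      ∀ᶠ z in 𝓝 x, transition φ ψ z = τ z := by
  have hn : (∞ : WithTop ℕ∞) ≠ 0 := by simp
  -- Restricting to nonvanishing Jacobian makes the local inverse smooth on its whole domain, as
  -- membership in the maximal atlas requires.
  set S : Set (Coord m) := {z | (fderiv ℝ τ z).det ≠ 0} with hS
  have hSo : IsOpen S := by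
    have : Continuous fun z => (fderiv ℝ τ z).det :=
      ContinuousLinearMap.continuous_det.comp (hτ.continuous_fderiv hn)
    exact isOpen_ne_fun this continuous_const
  set T := (hτ.contDiffAt.toOpenPartialHomeomorph τ hA hn).restrOpen S hSo with hT
  have hTc : ∀ z, T z = τ z := fun z => rfl
  have hxT : x ∈ T.source := by
    refine ⟨hτ.contDiffAt.mem_toOpenPartialHomeomorph_source hA hn, ?_⟩
    rw [hS, Set.mem_ofPred_eq, hA.fderiv]
    exact (LinearEquiv.isUnit_det' A.toLinearEquiv).ne_zero
  have hTs : ∀ z ∈ T.target, ContDiffAt ℝ ∞ T.symm z := by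
    intro z hz
    have h1 : T.symm z ∈ S := (T.map_target hz).2
    have h2 : DifferentiableAt ℝ τ (T.symm z) := hτ.differentiable hn _
    let B := (fderiv ℝ τ (T.symm z)).toContinuousLinearEquivOfDetNeZero h1
    have h3 : HasFDerivAt T (B : Coord m →L[ℝ] Coord m) (T.symm z) := by
      have : (B : Coord m →L[ℝ] Coord m) = fderiv ℝ τ (T.symm z) := by ext v; rfl
      rw [this]
      exact h2.hasFDerivAt
    exact T.contDiffAt_symm hz h3 hτ.contDiffAt
  refine ⟨φ.trans T.symm, ?_, ?_, ?_, ?_, ?_⟩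
  · refine OpenPartialHomeomorph.mem_maximalAtlas_of_contMDiffOn _ ?_ ?_
    · intro p hp
      have h1 := contMDiffAt_of_mem_maximalAtlas hφ hp.1
      exact ((hTs _ hp.2).contMDiffAt.comp p h1).contMDiffWithinAt
    · intro z hz
      have h1 := contMDiffAt_symm_of_mem_maximalAtlas hφ hz.2
      exact (h1.comp z hτ.contDiffAt.contMDiffAt).contMDiffWithinAt
  · exact ⟨hxT, hx⟩
  · rfl
  · exact φ.map_target hx
  · have hc : ContinuousAt τ x := hτ.continuous.continuousAt
    filter_upwards [hc.eventually (φ.open_target.mem_nhds hx)] with z hz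
    exact φ.right_inv hz

/-- A chart whose Christoffel symbols vanish and whose coordinate vectors are orthonormal at a
given point. -/
structure IsNormalAt (g : Metric m M) (ψ : OpenPartialHomeomorph M (Coord m)) (z : Coord m) :
    Prop where
  mem_charts : ψ ∈ charts m M
  mem_target : z ∈ ψ.target
  metric_eq : ∀ v w, metricInChart g ψ z v w = ∑ i, v i * w i
  fderiv_eq : fderiv ℝ (metricInChart g ψ) z = 0

/-- A linear change makes the coordinate vectors orthonormal, and a quadratic correction given by
minus the Christoffel symbols cancels the first derivatives of the metric. No geodesics are needed.
-/
theorem exists_isNormalAt (g : Metric m M) (hφ : φ ∈ charts m M) (hy : y ∈ φ.target) :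
    ∃ ψ z, IsNormalAt g ψ z ∧ ψ.symm z = φ.symm y := by
  obtain ⟨A, hA⟩ := exists_orthonormalizing (G := metricInChart g φ y)
    (metricInChart_symm g) (fun v hv => metricInChart_pos g hφ hy hv)
  set P := fderiv ℝ (metricInChart g φ) y with hP
  have hGd := ContDiffAt.diff (contDiffAt_metricInChart g hφ hy)
  have hPsymm : ∀ u v w, P u v w = P u w v := by
    intro u v w
    have h1 : ∀ v w, P u v w = fderiv ℝ (fun z => metricInChart g φ z v w) y u := by
      intro v w
      rw [fderiv_clm_apply (hGd.clm_apply (differentiableAt_const v)) (differentiableAt_const w),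
        fderiv_clm_apply hGd (differentiableAt_const v)]
      simp [hP]
    rw [h1, h1]
    congr 2
    funext z
    exact metricInChart_symm g v w
  -- The Koszul combination: it is symmetric in `u, v`, and `q u v w + q u w v = -P (A u) (A v) (A
  -- w)`, exactly what cancels the derivative of the metric at the end.
  let q : Coord m → Coord m → Coord m → ℝ := fun u v w =>
    -(1 / 2) * (P (A u) (A v) (A w) + P (A v) (A u) (A w) - P (A w) (A u) (A v))
  let Q : Coord m →L[ℝ] Coord m →L[ℝ] Coord m :=
    (LinearMap.mk₂ ℝ (fun u v => ∑ k, q u v (e k) • A (e k))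
      (fun u u' v => by
        simp only [q, map_add, add_apply, ← Finset.sum_add_distrib, ← add_smul]
        exact Finset.sum_congr rfl fun k _ => by congr 1; ring)
      (fun c u v => by
        simp only [q, map_smul, smul_apply, smul_eq_mul, Finset.smul_sum, smul_smul]
        exact Finset.sum_congr rfl fun k _ => by congr 1; ring)
      (fun u v v' => by
        simp only [q, map_add, add_apply, ← Finset.sum_add_distrib, ← add_smul]
        exact Finset.sum_congr rfl fun k _ => by congr 1; ring)
      (fun c u v => by
        simp only [q, map_smul, smul_apply, smul_eq_mul, Finset.smul_sum, smul_smul]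
        exact Finset.sum_congr rfl fun k _ => by congr 1; ring)).toContinuousBilinearMap
  have hQ : ∀ u v, Q u v = ∑ k, q u v (e k) • A (e k) := fun u v => rfl
  have hQsymm : ∀ u v, Q u v = Q v u := by
    intro u v
    rw [hQ, hQ]
    refine Finset.sum_congr rfl fun k _ => ?_
    congr 1
    simp only [q]
    rw [hPsymm (A (e k)) (A u) (A v)]
    ring
  have hqw : ∀ u v w, q u v w = ∑ k, w k * q u v (e k) := by
    intro u v w
    have h1 : A w = ∑ k, w k • A (e k) := by
      conv_lhs => rw [coord_eq_sum w]
      simp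
    simp only [q]
    rw [h1]
    simp only [map_sum, map_smul, sum_apply, smul_apply, smul_eq_mul, Finset.mul_sum,
      ← Finset.sum_add_distrib, ← Finset.sum_sub_distrib]
    exact Finset.sum_congr rfl fun k _ => by ring
  have hGQ : ∀ u v w, metricInChart g φ y (Q u v) (A w) = q u v w := by
    intro u v w
    rw [hQ, hqw]
    simp only [map_sum, map_smul, sum_apply, smul_apply, smul_eq_mul, hA]
    refine Finset.sum_congr rfl fun k _ => ?_
    rw [mul_comm]
    congr 1
    simp [e]
  -- The factor `1 / 2` makes the derivative of `τ` at `x` equal to `A + Q x`, by the symmetry of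
  -- `Q`.
  let τ : Coord m → Coord m := fun x => y + A x + (1 / 2 : ℝ) • Q x x
  have hτ0 : τ 0 = y := by simp [τ]
  have hτd : ∀ x, HasFDerivAt τ ((A : Coord m →L[ℝ] Coord m) + Q x) x := by
    intro x
    have h1 : HasFDerivAt (fun x => Q x x) (Q x + Q.flip x) x := by
      have := Q.hasFDerivAt (x := x) |>.clm_apply (hasFDerivAt_id x)
      refine this.congr_fderiv ?_
      ext v
      simp
    have h2 := ((A.hasFDerivAt (x := x)).const_add y).add (h1.const_smul (1 / 2 : ℝ))
    refine h2.congr_fderiv ?_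
    ext v
    simp only [add_apply, smul_apply, ContinuousLinearMap.flip_apply, hQsymm v x,
      ← two_smul ℝ (Q x v), smul_smul]
    norm_num
  have hτs : ContDiff ℝ ∞ τ :=
    (contDiff_const.add A.contDiff).add ((Q.contDiff.clm_apply contDiff_id).const_smul _)
  obtain ⟨ψ, hψ, h0, h0', h0'', hev⟩ := exists_chart_of_contDiff hφ hτs (x := 0) (A := A)
    (by simpa using hτd 0) (by rw [hτ0]; exact hy)
  rw [hτ0] at h0'
  have hmet : ∀ v w, (fun z => metricInChart g ψ z v w) =ᶠ[𝓝 0] fun z =>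
      metricInChart g φ (τ z) (A v + Q z v) (A w + Q z w) := by
    intro v w
    filter_upwards [eventually_overlap h0 h0'', hev.eventually_nhds] with z hz hz'
    have h1 : fderiv ℝ (transition φ ψ) z = (A : Coord m →L[ℝ] Coord m) + Q z := by
      have : transition φ ψ =ᶠ[𝓝 z] τ := hz'
      rw [this.fderiv_eq, (hτd z).fderiv]
    rw [metricInChart_transition g hφ hψ hz.1 hz.2, h1, hz'.self_of_nhds]
    rfl
  have hGψ := ContDiffAt.diff (contDiffAt_metricInChart g hψ h0)
  refine ⟨ψ, 0, ⟨hψ, h0, fun v w => ?_, ?_⟩, h0'⟩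
  · refine (hmet v w).self_of_nhds.trans ?_
    simp only [hτ0]
    simpa using hA v w
  · ext u v w
    have h1 : fderiv ℝ (metricInChart g ψ) 0 u v w
        = fderiv ℝ (fun z => metricInChart g ψ z v w) 0 u := by
      rw [fderiv_clm_apply (hGψ.clm_apply (differentiableAt_const v)) (differentiableAt_const w),
        fderiv_clm_apply hGψ (differentiableAt_const v)]
      simp
    have hG1 : HasFDerivAt (metricInChart g φ) P (τ 0) := by rw [hτ0]; exact hGd.hasFDerivAt
    have hG2 := HasFDerivAt.comp (g := metricInChart g φ) (f := τ) 0 hG1 (hτd 0)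
    have hlin : ∀ v, HasFDerivAt (fun z => A v + Q z v) (Q.flip v) (0 : Coord m) := fun v => by
      have := ((Q.flip v).hasFDerivAt (x := (0 : Coord m))).const_add (A v)
      exact this
    have h2 := (hG2.clm_apply (hlin v)).clm_apply (hlin w)
    rw [h1, (hmet v w).fderiv_eq]
    have h3 := congrArg (fun L : Coord m →L[ℝ] ℝ => L u) h2.fderiv
    refine h3.trans ?_
    simp only [add_apply, ContinuousLinearMap.comp_apply, ContinuousLinearMap.flip_apply,
      Function.comp, hτ0, map_zero, zero_apply, add_zero]
    have h4 : metricInChart g φ y (A v) (Q u w) = q u w v := by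
      rw [metricInChart_symm g, hGQ]
    have h5 := hGQ u v w
    simp only [ContinuousLinearEquiv.coe_coe] at *
    rw [h4, h5]
    simp only [q]
    rw [hPsymm (A u) (A w) (A v)]
    ring

end NormalCharts

/-! ### Scalars, 1-forms and densities, and their derivatives at normal centres -/

section TensorFields

variable {m : ℕ} {M : Type*} [TopologicalSpace M] [ChartedSpace (Coord m) M]
  [IsManifold 𝓘(ℝ, Coord m) ∞ M] {φ ψ : OpenPartialHomeomorph M (Coord m)} {y : Coord m}

/-- The Jacobian matrix of the coordinate change from `ψ` to `φ`. -/
def transitionMatrix (φ ψ : OpenPartialHomeomorph M (Coord m)) (y : Coord m) :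
    Matrix (Fin m) (Fin m) ℝ := jacobian (transition φ ψ) y

theorem fderiv_transition_apply (hφ : φ ∈ charts m M) (hψ : ψ ∈ charts m M) (hy : y ∈ ψ.target)
    (hy' : ψ.symm y ∈ φ.source) (v : Coord m) (i : Fin m) :
    fderiv ℝ (transition φ ψ) y v i = ∑ j, transitionMatrix φ ψ y i j * v j :=
  fderiv_apply_jacobian (ContDiffAt.diff (contDiffAt_transition hφ hψ hy hy')) v i

theorem fderiv_transition_e (hφ : φ ∈ charts m M) (hψ : ψ ∈ charts m M) (hy : y ∈ ψ.target)
    (hy' : ψ.symm y ∈ φ.source) (i : Fin m) :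
    fderiv ℝ (transition φ ψ) y (e i) = ∑ j, transitionMatrix φ ψ y j i • e j := by
  rw [coord_eq_sum (fderiv ℝ (transition φ ψ) y (e i))]
  refine Finset.sum_congr rfl fun j _ => ?_
  rw [fderiv_transition_apply hφ hψ hy hy']
  simp [e]

theorem det_transition_eq (hφ : φ ∈ charts m M) (hψ : ψ ∈ charts m M) (hy : y ∈ ψ.target)
    (hy' : ψ.symm y ∈ φ.source) :
    (fderiv ℝ (transition φ ψ) y).det = (transitionMatrix φ ψ y).det :=
  det_fderiv_eq (ContDiffAt.diff (contDiffAt_transition hφ hψ hy hy'))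

theorem det_transitionMatrix_ne_zero (hφ : φ ∈ charts m M) (hψ : ψ ∈ charts m M)
    (hy : y ∈ ψ.target) (hy' : ψ.symm y ∈ φ.source) : (transitionMatrix φ ψ y).det ≠ 0 :=
  det_transition_eq hφ hψ hy hy' ▸ det_fderiv_transition_ne_zero hφ hψ hy hy'

/-- A family of bilinear forms in coordinates transforms by congruence of matrices. -/
theorem bilin_matrix_law (hφ : φ ∈ charts m M) (hψ : ψ ∈ charts m M) (hy : y ∈ ψ.target)
    (hy' : ψ.symm y ∈ φ.source) {B B' : Coord m →L[ℝ] Coord m →L[ℝ] ℝ}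
    (h : ∀ v w, B' v w = B (fderiv ℝ (transition φ ψ) y v) (fderiv ℝ (transition φ ψ) y w)) :
    (Matrix.of fun i j => B' (e i) (e j)) = (transitionMatrix φ ψ y).transpose *
      (Matrix.of fun i j => B (e i) (e j)) * transitionMatrix φ ψ y := by
  ext i j
  simp only [Matrix.of_apply, Matrix.mul_apply, Matrix.transpose_apply]
  rw [h, fderiv_transition_e hφ hψ hy hy' i, fderiv_transition_e hφ hψ hy hy' j]
  simp only [map_sum, map_smul, sum_apply, smul_apply, smul_eq_mul, Finset.sum_mul,
    Finset.mul_sum]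
  exact Finset.sum_congr rfl fun k _ => Finset.sum_congr rfl fun l _ => by ring

section Gram

variable (g : Metric m M)

theorem gram_posDef (hφ : φ ∈ charts m M) (hy : y ∈ φ.target) :
    (gram (metricInChart g φ) y).PosDef :=
  posDef_of_bilin (metricInChart_symm g) fun _ hv => metricInChart_pos g hφ hy hv

theorem gram_transition (hφ : φ ∈ charts m M) (hψ : ψ ∈ charts m M) (hy : y ∈ ψ.target)
    (hy' : ψ.symm y ∈ φ.source) :
    gram (metricInChart g ψ) y = (transitionMatrix φ ψ y).transpose *
      gram (metricInChart g φ) (transition φ ψ y) * transitionMatrix φ ψ y :=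
  bilin_matrix_law hφ hψ hy hy' fun v w => metricInChart_transition g hφ hψ hy hy' v w

theorem contDiffAt_gram (hφ : φ ∈ charts m M) (hy : y ∈ φ.target) (i j : Fin m) :
    ContDiffAt ℝ ∞ (fun z => gram (metricInChart g φ) z i j) y :=
  ((contDiffAt_metricInChart g hφ hy).clm_apply contDiffAt_const).clm_apply contDiffAt_const

theorem contDiffAt_gram_inv (hφ : φ ∈ charts m M) (hy : y ∈ φ.target) (i j : Fin m) :
    ContDiffAt ℝ ∞ (fun z => (gram (metricInChart g φ) z)⁻¹ i j) y :=
  contDiffAt_inv (contDiffAt_gram g hφ hy) (gram_posDef g hφ hy).det_pos.ne' i j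

/-- The coordinate expression of the Riemannian density. -/
def volumeDensity (φ : OpenPartialHomeomorph M (Coord m)) (y : Coord m) : ℝ :=
  √(gram (metricInChart g φ) y).det

theorem contDiffAt_volumeDensity (hφ : φ ∈ charts m M) (hy : y ∈ φ.target) :
    ContDiffAt ℝ ∞ (volumeDensity g φ) y :=
  (contDiffAt_det (contDiffAt_gram g hφ hy)).sqrt (gram_posDef g hφ hy).det_pos.ne'

/-- The square root turns the squared Jacobian determinant into its absolute value; this is why
orientability plays no role. -/
theorem volumeDensity_transition (hφ : φ ∈ charts m M) (hψ : ψ ∈ charts m M) (hy : y ∈ ψ.target)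
    (hy' : ψ.symm y ∈ φ.source) :
    volumeDensity g ψ y =
      |(transitionMatrix φ ψ y).det| * volumeDensity g φ (transition φ ψ y) := by
  unfold volumeDensity
  rw [gram_transition g hφ hψ hy hy', Matrix.det_mul, Matrix.det_mul, Matrix.det_transpose,
    mul_right_comm, Real.sqrt_mul (mul_self_nonneg _), Real.sqrt_mul_self_eq_abs]

theorem mul_gram_inv_mul_transpose (hφ : φ ∈ charts m M) (hψ : ψ ∈ charts m M)
    (hy : y ∈ ψ.target) (hy' : ψ.symm y ∈ φ.source) :
    transitionMatrix φ ψ y * (gram (metricInChart g ψ) y)⁻¹ * (transitionMatrix φ ψ y).transpose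
      = (gram (metricInChart g φ) (transition φ ψ y))⁻¹ := by
  have hJ : IsUnit (transitionMatrix φ ψ y).det :=
    (det_transitionMatrix_ne_zero hφ hψ hy hy').isUnit
  have hJt : IsUnit (transitionMatrix φ ψ y).transpose.det := by rwa [Matrix.det_transpose]
  rw [gram_transition g hφ hψ hy hy', Matrix.mul_inv_rev, Matrix.mul_inv_rev, ← mul_assoc,
    Matrix.mul_nonsing_inv _ hJ, one_mul, mul_assoc, Matrix.nonsing_inv_mul _ hJt, mul_one]

end Gram

/-- A smooth function, given by its coordinate expressions. -/
structure IsScalarField (u : OpenPartialHomeomorph M (Coord m) → Coord m → ℝ) : Prop where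
  contDiffAt : ∀ φ ∈ charts m M, ∀ y ∈ φ.target, ContDiffAt ℝ ∞ (u φ) y
  law : ∀ φ ∈ charts m M, ∀ ψ ∈ charts m M, ∀ y ∈ ψ.target, ψ.symm y ∈ φ.source →
    u ψ y = u φ (transition φ ψ y)

/-- A smooth 1-form, given by its components in all charts. -/
structure IsCovectorField (α : OpenPartialHomeomorph M (Coord m) → Coord m → Fin m → ℝ) :
    Prop where
  contDiffAt : ∀ φ ∈ charts m M, ∀ y ∈ φ.target, ∀ i, ContDiffAt ℝ ∞ (fun z => α φ z i) y
  law : ∀ φ ∈ charts m M, ∀ ψ ∈ charts m M, ∀ y ∈ ψ.target, ψ.symm y ∈ φ.source →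
    α ψ y = (transitionMatrix φ ψ y).transpose.mulVec (α φ (transition φ ψ y))

theorem IsScalarField.of_contMDiff {f : M → ℝ} (hf : ContMDiff 𝓘(ℝ, Coord m) 𝓘(ℝ, ℝ) ∞ f) :
    IsScalarField (m := m) (fun φ => f ∘ φ.symm) where
  contDiffAt φ hφ y hy := contDiffAt_comp_symm hf hφ hy
  law φ hφ ψ hψ y hy hy' := by
    simp only [Function.comp]
    rw [symm_transition hy']

variable {u : OpenPartialHomeomorph M (Coord m) → Coord m → ℝ}
  {α : OpenPartialHomeomorph M (Coord m) → Coord m → Fin m → ℝ}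

theorem IsScalarField.exp_neg (hu : IsScalarField u) :
    IsScalarField fun φ y => Real.exp (-u φ y) where
  contDiffAt φ hφ y hy := (hu.contDiffAt φ hφ y hy).neg.exp
  law φ hφ ψ hψ y hy hy' := by rw [hu.law φ hφ ψ hψ y hy hy']

theorem IsScalarField.gradient (hu : IsScalarField u) :
    IsCovectorField fun φ y i => pd i (u φ) y where
  contDiffAt φ hφ y hy i := contDiffAt_pd i (hu.contDiffAt φ hφ y hy)
  law φ hφ ψ hψ y hy hy' := by
    funext i
    have h1 : u ψ =ᶠ[𝓝 y] fun z => u φ (transition φ ψ z) := by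
      filter_upwards [eventually_overlap hy hy'] with z hz
      exact hu.law φ hφ ψ hψ z hz.1 hz.2
    rw [pd_congr h1, pd_comp (ContDiffAt.diff (contDiffAt_transition hφ hψ hy hy'))
      (ContDiffAt.diff (hu.contDiffAt φ hφ _ (transition_mem_target hy')))]
    simp only [Matrix.mulVec, dotProduct, Matrix.transpose_apply]
    exact Finset.sum_congr rfl fun k _ => mul_comm _ _

theorem IsCovectorField.smul (hu : IsScalarField u) (hα : IsCovectorField α) :
    IsCovectorField fun φ y i => u φ y * α φ y i where
  contDiffAt φ hφ y hy i := (hu.contDiffAt φ hφ y hy).mul (hα.contDiffAt φ hφ y hy i)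
  law φ hφ ψ hψ y hy hy' := by
    have h1 : ∀ (c : ℝ) (β : Fin m → ℝ), (fun i => c * β i) = c • β := fun c β => rfl
    rw [h1, h1, Matrix.mulVec_smul, hu.law φ hφ ψ hψ y hy hy', hα.law φ hφ ψ hψ y hy hy']

/-- The squared norm of a 1-form. -/
def covectorNormSq (g : Metric m M) (α : OpenPartialHomeomorph M (Coord m) → Coord m → Fin m → ℝ)
    (φ : OpenPartialHomeomorph M (Coord m)) (y : Coord m) : ℝ :=
  ∑ k, ∑ l, (gram (metricInChart g φ) y)⁻¹ k l * α φ y k * α φ y l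

theorem IsCovectorField.isScalarField_normSq (g : Metric m M) (hα : IsCovectorField α) :
    IsScalarField (covectorNormSq g α) where
  contDiffAt φ hφ y hy := ContDiffAt.sum fun k _ => ContDiffAt.sum fun l _ =>
    ((contDiffAt_gram_inv g hφ hy k l).mul (hα.contDiffAt φ hφ y hy k)).mul
      (hα.contDiffAt φ hφ y hy l)
  law φ hφ ψ hψ y hy hy' := by
    have h1 : ∀ φ y, covectorNormSq g α φ y =
        α φ y ⬝ᵥ ((gram (metricInChart g φ) y)⁻¹.mulVec (α φ y)) := by
      intro φ y
      unfold covectorNormSq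
      simp only [dotProduct, Matrix.mulVec, Finset.mul_sum]
      exact Finset.sum_congr rfl fun k _ => Finset.sum_congr rfl fun l _ => by ring
    rw [h1, h1, hα.law φ hφ ψ hψ y hy hy', ← mul_gram_inv_mul_transpose g hφ hψ hy hy']
    rw [Matrix.mulVec_transpose, ← Matrix.dotProduct_mulVec, ← Matrix.mulVec_transpose,
      Matrix.mulVec_mulVec, Matrix.mulVec_mulVec, mul_assoc]

/-- The vector density `√det g · g^{il} α_l` of a 1-form. -/
def densityOf (g : Metric m M) (α : OpenPartialHomeomorph M (Coord m) → Coord m → Fin m → ℝ)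
    (φ : OpenPartialHomeomorph M (Coord m)) (y : Coord m) : Coord m :=
  WithLp.toLp 2 fun i => volumeDensity g φ y *
    ∑ l, (gram (metricInChart g φ) y)⁻¹ i l * α φ y l

theorem IsCovectorField.isVectorDensity (g : Metric m M) (hα : IsCovectorField α) :
    IsVectorDensity (densityOf g α) where
  contDiffAt φ hφ y hy := contDiffAt_euclidean.2 fun i =>
    (contDiffAt_volumeDensity g hφ hy).mul (ContDiffAt.sum fun l _ =>
      (contDiffAt_gram_inv g hφ hy i l).mul (hα.contDiffAt φ hφ y hy l))
  law φ hφ ψ hψ y hy hy' := by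
    have h0 : ∀ φ y, (densityOf g α φ y).ofLp =
        volumeDensity g φ y • (gram (metricInChart g φ) y)⁻¹.mulVec (α φ y) := fun φ y => rfl
    have h1 : ∀ v : Coord m, (fderiv ℝ (transition φ ψ) y v).ofLp =
        (transitionMatrix φ ψ y).mulVec v.ofLp := fun v =>
      funext fun i => fderiv_transition_apply hφ hψ hy hy' v i
    apply WithLp.ofLp_injective
    rw [h1, h0, WithLp.ofLp_smul, h0, det_transition_eq hφ hψ hy hy',
      hα.law φ hφ ψ hψ y hy hy', volumeDensity_transition g hφ hψ hy hy',
      ← mul_gram_inv_mul_transpose g hφ hψ hy hy', Matrix.mulVec_smul, Matrix.mulVec_mulVec,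
      Matrix.mulVec_mulVec, smul_smul, mul_assoc]

section Normal

variable {g : Metric m M}

theorem IsNormalAt.gram_eq (h : IsNormalAt g ψ y) : gram (metricInChart g ψ) y = 1 := by
  ext i j
  simp only [gram, Matrix.of_apply]
  rw [h.metric_eq]
  simp [e, Matrix.one_apply, Finset.sum_ite_eq, eq_comm]

theorem IsNormalAt.pd_gram (h : IsNormalAt g ψ y) (i j k : Fin m) :
    pd k (fun z => gram (metricInChart g ψ) z i j) y = 0 := by
  have hd := ContDiffAt.diff (contDiffAt_metricInChart g h.mem_charts h.mem_target)
  unfold pd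
  simp only [gram, Matrix.of_apply]
  rw [fderiv_clm_apply (hd.clm_apply (differentiableAt_const _)) (differentiableAt_const _),
    fderiv_clm_apply hd (differentiableAt_const _), h.fderiv_eq]
  simp

theorem gram_inv_mul_gram (hψ : ψ ∈ charts m M) (hy : y ∈ ψ.target) (i j : Fin m) :
    ∑ k, (gram (metricInChart g ψ) y)⁻¹ i k * gram (metricInChart g ψ) y k j
      = if i = j then 1 else 0 := by
  have h := Matrix.nonsing_inv_mul (gram (metricInChart g ψ) y)
    (gram_posDef g hψ hy).det_pos.ne'.isUnit
  have h' := congrFun (congrFun h i) j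
  rwa [Matrix.mul_apply, Matrix.one_apply] at h'

/-- The derivative of `g⁻¹ g = 1`. At a normal centre it shows `∂g⁻¹ = 0`; differentiated again it
gives `∂²g⁻¹ = -∂²g`. -/
theorem pd_gram_inv_eq (hψ : ψ ∈ charts m M) (hy : y ∈ ψ.target) (i j l : Fin m) :
    ∑ k, (pd l (fun z => (gram (metricInChart g ψ) z)⁻¹ i k) y * gram (metricInChart g ψ) y k j
      + (gram (metricInChart g ψ) y)⁻¹ i k * pd l (fun z => gram (metricInChart g ψ) z k j) y)
      = 0 := by
  have h1 : (fun z => ∑ k, (gram (metricInChart g ψ) z)⁻¹ i k * gram (metricInChart g ψ) z k j)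
      =ᶠ[𝓝 y] fun _ => if i = j then 1 else 0 := by
    filter_upwards [ψ.open_target.mem_nhds hy] with z hz using gram_inv_mul_gram hψ hz i j
  have h2 := pd_congr (i := l) h1
  have hi := fun k => ContDiffAt.diff (contDiffAt_gram_inv g hψ hy i k)
  have hg := fun k => ContDiffAt.diff (contDiffAt_gram g hψ hy k j)
  rw [pd_const, pd_sum l _ (fun k _ => (hi k).fun_mul (hg k))] at h2
  rw [← h2]
  exact Finset.sum_congr rfl fun k _ => (pd_mul l (hi k) (hg k)).symm

theorem IsNormalAt.gram_inv_eq (h : IsNormalAt g ψ y) : (gram (metricInChart g ψ) y)⁻¹ = 1 := by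
  rw [h.gram_eq, inv_one]

theorem IsNormalAt.pd_gram_inv (h : IsNormalAt g ψ y) (i j l : Fin m) :
    pd l (fun z => (gram (metricInChart g ψ) z)⁻¹ i j) y = 0 := by
  have h1 := pd_gram_inv_eq (g := g) h.mem_charts h.mem_target i j l
  simpa [h.gram_eq, h.pd_gram, Matrix.one_apply] using h1

theorem IsNormalAt.pd_pd_gram_inv (h : IsNormalAt g ψ y) (i j l p : Fin m) :
    pd p (pd l (fun z => (gram (metricInChart g ψ) z)⁻¹ i j)) y
      = -pd p (pd l (fun z => gram (metricInChart g ψ) z i j)) y := by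
  have hψ := h.mem_charts
  have hy := h.mem_target
  have h1 : (fun z => ∑ k, (pd l (fun z => (gram (metricInChart g ψ) z)⁻¹ i k) z *
        gram (metricInChart g ψ) z k j
      + (gram (metricInChart g ψ) z)⁻¹ i k * pd l (fun z => gram (metricInChart g ψ) z k j) z))
      =ᶠ[𝓝 y] fun _ => 0 := by
    filter_upwards [ψ.open_target.mem_nhds hy] with z hz using pd_gram_inv_eq hψ hz i j l
  have h2 := pd_congr (i := p) h1
  have hi := fun k => ContDiffAt.diff (contDiffAt_gram_inv g hψ hy i k)
  have hg := fun k => ContDiffAt.diff (contDiffAt_gram g hψ hy k j)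
  have hi' := fun k => ContDiffAt.diff (contDiffAt_pd l (contDiffAt_gram_inv g hψ hy i k))
  have hg' := fun k => ContDiffAt.diff (contDiffAt_pd l (contDiffAt_gram g hψ hy k j))
  rw [pd_const, pd_sum p _ (fun k _ => ((hi' k).fun_mul (hg k)).fun_add
    ((hi k).fun_mul (hg' k)))] at h2
  have h3 : ∀ k, pd p (fun z => pd l (fun z => (gram (metricInChart g ψ) z)⁻¹ i k) z *
        gram (metricInChart g ψ) z k j
      + (gram (metricInChart g ψ) z)⁻¹ i k * pd l (fun z => gram (metricInChart g ψ) z k j) z) y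
      = pd p (pd l (fun z => (gram (metricInChart g ψ) z)⁻¹ i k)) y * (if k = j then 1 else 0)
      + (if i = k then 1 else 0) * pd p (pd l (fun z => gram (metricInChart g ψ) z k j)) y := by
    intro k
    rw [pd_add p ((hi' k).fun_mul (hg k)) ((hi k).fun_mul (hg' k)), pd_mul p (hi' k) (hg k),
      pd_mul p (hi k) (hg' k), h.pd_gram, h.pd_gram_inv, h.gram_inv_eq, h.gram_eq,
      h.pd_gram_inv, Matrix.one_apply, Matrix.one_apply]
    ring
  simp only [h3, Finset.sum_add_distrib] at h2
  simp at h2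
  linarith

theorem IsNormalAt.volumeDensity_eq (h : IsNormalAt g ψ y) : volumeDensity g ψ y = 1 := by
  simp [volumeDensity, h.gram_eq]

theorem IsNormalAt.pd_volumeDensity (h : IsNormalAt g ψ y) (i : Fin m) :
    pd i (volumeDensity g ψ) y = 0 := by
  have hg := fun k j =>
    ContDiffAt.diff (contDiffAt_gram g h.mem_charts h.mem_target k j)
  have h1 : pd i (fun z => (gram (metricInChart g ψ) z).det) y = 0 := by
    rw [pd_det hg]
    simp [h.pd_gram]
  unfold volumeDensity pd at *
  rw [fderiv_sqrt (differentiableAt_det hg) (by rw [h.gram_eq]; simp), smul_apply, h1, smul_zero]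

/-- Both `√det g` and `g⁻¹` are stationary at a normal centre, with values 1 and the identity, so
only the components of the 1-form are differentiated. -/
theorem IsNormalAt.divergence_densityOf (h : IsNormalAt g ψ y) (hα : IsCovectorField α) :
    divergence (densityOf g α ψ) y = ∑ i, pd i (fun z => α ψ z i) y := by
  have hψ := h.mem_charts
  have hy := h.mem_target
  have hv := ContDiffAt.diff (contDiffAt_volumeDensity g hψ hy)
  have hi := fun k j => ContDiffAt.diff (contDiffAt_gram_inv g hψ hy k j)
  have ha := fun k => ContDiffAt.diff (hα.contDiffAt ψ hψ y hy k)
  unfold divergence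
  refine Finset.sum_congr rfl fun i _ => ?_
  have h1 : (fun z => densityOf g α ψ z i) = fun z => volumeDensity g ψ z *
    ∑ l, (gram (metricInChart g ψ) z)⁻¹ i l * α ψ z l := rfl
  rw [h1, pd_mul i hv (DifferentiableAt.fun_sum fun l _ => (hi i l).fun_mul (ha l)),
    h.pd_volumeDensity, h.volumeDensity_eq, pd_sum i _ (fun l _ => (hi i l).fun_mul (ha l))]
  simp only [zero_mul, zero_add, one_mul]
  have h2 : ∀ l, pd i (fun z => (gram (metricInChart g ψ) z)⁻¹ i l * α ψ z l) y
      = (if i = l then 1 else 0) * pd i (fun z => α ψ z l) y := by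
    intro l
    rw [pd_mul i (hi i l) (ha l), h.pd_gram_inv, h.gram_inv_eq, Matrix.one_apply]
    ring
  simp [h2]

/-- If the divergence of a 1-form is nonnegative, then it vanishes; it suffices to compute it at
the centres of normal charts. -/
theorem IsCovectorField.sum_pd_eq_zero [T2Space M] [CompactSpace M] (hα : IsCovectorField α)
    (hpos : ∀ ψ z, IsNormalAt g ψ z → 0 ≤ ∑ i, pd i (fun w => α ψ w i) z)
    (h : IsNormalAt g ψ y) : ∑ i, pd i (fun w => α ψ w i) y = 0 := by
  have hZ := hα.isVectorDensity g
  rw [← h.divergence_densityOf hα]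
  refine hZ.divergence_eq_zero (fun φ hφ x hx => ?_) h.mem_charts h.mem_target
  obtain ⟨χ, z, hn, hz⟩ := exists_isNormalAt g hφ hx
  have hx' : φ.symm x ∈ χ.source := hz ▸ χ.map_target hn.mem_target
  have hxz : transition χ φ x = z := by
    unfold transition
    rw [← hz, χ.right_inv hn.mem_target]
  -- The Piola identity carries the sign of the divergence from the normal chart to an arbitrary
  -- chart around the same point.
  rw [divergence_transform (τ := transition χ φ) (Z := densityOf g α χ)
    (contDiffAt_transition hn.mem_charts hφ hx hx')
    (det_fderiv_transition_ne_zero hn.mem_charts hφ hx hx')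
    (ContDiffAt.diff (hZ.contDiffAt χ hn.mem_charts _ (transition_mem_target hx')))
    (ContDiffAt.diff (hZ.contDiffAt φ hφ x hx)), hxz, hn.divergence_densityOf hα]
  · exact mul_nonneg (abs_nonneg _) (hpos χ z hn)
  · filter_upwards [eventually_overlap hx hx'] with w hw
    exact hZ.law χ hn.mem_charts φ hφ w hw.1 hw.2

end Normal

end TensorFields

/-! ### Algebra of the covariant derivative of a complex structure -/

section HermitianAlgebra

variable {V : Type*} [NormedAddCommGroup V] [NormedSpace ℝ V] {A : V →L[ℝ] V}
  {T H : V →L[ℝ] V →L[ℝ] V →L[ℝ] ℝ}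

/-- The algebraic properties of `T(x, y, z) = g((∇_x A) y, z)` for a complex structure `A`
compatible with `g` and without Nijenhuis tensor. -/
structure IsHermitianDerivative (A : V →L[ℝ] V) (T : V →L[ℝ] V →L[ℝ] V →L[ℝ] ℝ) : Prop where
  sq : ∀ x, A (A x) = -x
  skew : ∀ x y z, T x y z = -T x z y
  anti : ∀ x y z, T x (A y) z = T x y (A z)
  nijenhuis : ∀ x y z, T (A x) y z + T x y (A z) = T (A y) x z + T y x (A z)

/-- The expression `T (A x) y (A z) - T x y z` is symmetric in `x, y` by integrability and skew in
`y, z` by compatibility; such a trilinear form vanishes. This is the rule `∇_{Ax} A = A ∇_x A`. -/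
theorem IsHermitianDerivative.apply_left (h : IsHermitianDerivative A T) (x y z : V) :
    T (A x) y z = -T x y (A z) := by
  have hU1 : ∀ x y z, T (A x) y (A z) - T x y z = T (A y) x (A z) - T y x z := fun x y z => by
    have := h.nijenhuis x y (A z)
    simp only [h.sq, map_neg] at this
    linarith
  have hU2 : ∀ x y z, T (A x) y (A z) - T x y z = -(T (A x) z (A y) - T x z y) := fun x y z => by
    have h1 := h.skew (A x) y (A z)
    have h2 := h.anti (A x) z y
    have h3 := h.skew x y z
    linarith
  have hU : ∀ x y z, T (A x) y (A z) = T x y z := fun x y z => by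
    have h1 := hU2 x y z
    have h2 := hU1 x z y
    have h3 := hU2 z x y
    have h4 := hU1 z y x
    have h5 := hU2 y z x
    have h6 := hU1 y x z
    linarith
  have h1 := hU x y (A z)
  simp only [h.sq, map_neg] at h1
  linarith

/-- The 3-form `d^c ω` in terms of `∇ A`. -/
theorem IsHermitianDerivative.torsion_eq (h : IsHermitianDerivative A T)
    (hH : ∀ x y z, H x y z = -(T (A x) (A y) (A z) - T (A y) (A x) (A z) + T (A z) (A x) (A y)))
    (x y z : V) : H x y z = -(T x y (A z) - T y x (A z) + T z x (A y)) := by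
  rw [hH]
  simp only [h.apply_left, h.anti, h.sq, map_neg]
  ring

/-- The torsion determines `∇A`: the identity says that `A` is parallel for the Bismut connection `∇
- (1/2) g⁻¹H`. -/
theorem IsHermitianDerivative.two_mul_eq (h : IsHermitianDerivative A T)
    (hH : ∀ x y z, H x y z = -(T (A x) (A y) (A z) - T (A y) (A x) (A z) + T (A z) (A x) (A y)))
    (x y z : V) : 2 * T x y z = H x (A y) z + H x y (A z) := by
  rw [h.torsion_eq hH, h.torsion_eq hH]
  simp only [h.apply_left, h.anti, h.sq, map_neg]
  ring

/-- The real form of the statement that `H` has no `(3,0)` or `(0,3)` part. -/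
theorem IsHermitianDerivative.torsion_type (h : IsHermitianDerivative A T)
    (hH : ∀ x y z, H x y z = -(T (A x) (A y) (A z) - T (A y) (A x) (A z) + T (A z) (A x) (A y)))
    (x y z : V) : H (A x) (A y) z + H (A x) y (A z) + H x (A y) (A z) = H x y z := by
  simp only [h.torsion_eq hH, h.apply_left, h.anti, h.sq, map_neg]
  ring

/-- The cyclic sum which expresses that the torsion is exact. -/
theorem cyclic_sum_eq {A B : V →L[ℝ] V} {T T' H : V →L[ℝ] V →L[ℝ] V →L[ℝ] ℝ}
    (hA : ∀ x, A (A x) = -x) (hB : ∀ x, B (B x) = -x)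
    (hT : ∀ x y z, 2 * T x y z = H x (A y) z + H x y (A z))
    (hT' : ∀ x y z, 2 * T' x y z = -(H x (B y) z + H x y (B z)))
    (hHA : ∀ x y z, H (A x) (A y) z + H (A x) y (A z) + H x (A y) (A z) = H x y z)
    (hHB : ∀ x y z, H (B x) (B y) z + H (B x) y (B z) + H x (B y) (B z) = H x y z)
    (hcyc : ∀ x y z, H x y z = H y z x) (x y z : V) :
    (2 * T (A x + B x) y (A z) - 2 * T' (A x + B x) y (B z))
      + (2 * T (A y + B y) z (A x) - 2 * T' (A y + B y) z (B x))
      + (2 * T (A z + B z) x (A y) - 2 * T' (A z + B z) x (B y))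
      = H (A x + B x) (A y + B y) (A z + B z) := by
  -- The type condition at `A x, A y, A z` replaces the pure term `H(Ax, Ay, Az)` by terms with a
  -- single `A`; the same for `B`. The mixed terms match by cyclicity.
  have h1 := hHA (A x) (A y) (A z)
  have h2 := hHB (B x) (B y) (B z)
  simp only [hA, map_neg, neg_apply, neg_neg] at h1
  simp only [hB, map_neg, neg_apply, neg_neg] at h2
  simp only [hT, hT']
  simp only [hA, hB, map_add, map_neg, add_apply]
  linarith [hcyc (A x) (A y) (A z), hcyc (A x) (B y) (A z), hcyc (B x) (A y) (B z),
    hcyc (B x) (B y) (B z), hcyc x (A y) z, hcyc x (B y) z, hcyc (A z) (A x) (A y),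
    hcyc (B z) (A x) (A y), hcyc (A z) (B x) (B y), hcyc (B z) (B x) (B y), hcyc (A z) x y,
    hcyc (B z) x y]

end HermitianAlgebra

/-! ### Forms as multilinear maps -/

section Trilinear

variable {m : ℕ}

/-- A 2-form as a bilinear map. -/
def bilinearOf (β : Coord m [⋀^Fin 2]→L[ℝ] ℝ) : Coord m →L[ℝ] Coord m →L[ℝ] ℝ :=
  (LinearMap.mk₂ ℝ (fun v w => β ![v, w])
    (fun v v' w => by
      change β.curryLeft (v + v') ![w] = β.curryLeft v ![w] + β.curryLeft v' ![w]
      rw [map_add]; rfl)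
    (fun c v w => by
      change β.curryLeft (c • v) ![w] = c • β.curryLeft v ![w]
      rw [map_smul]; rfl)
    (fun v w w' => by
      change (β.curryLeft v).curryLeft (w + w') ![] =
        (β.curryLeft v).curryLeft w ![] + (β.curryLeft v).curryLeft w' ![]
      rw [map_add]; rfl)
    (fun c v w => by
      change (β.curryLeft v).curryLeft (c • w) ![] = c • (β.curryLeft v).curryLeft w ![]
      rw [map_smul]; rfl)).toContinuousBilinearMap

/-- A 3-form as a trilinear map. -/
def trilinearOf (α : Coord m [⋀^Fin 3]→L[ℝ] ℝ) :
    Coord m →L[ℝ] Coord m →L[ℝ] Coord m →L[ℝ] ℝ :=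
  LinearMap.toContinuousLinearMap
    { toFun := fun x => bilinearOf (α.curryLeft x)
      map_add' := fun x x' => by
        ext v w
        change α.curryLeft (x + x') ![v, w] = α.curryLeft x ![v, w] + α.curryLeft x' ![v, w]
        rw [map_add]; rfl
      map_smul' := fun c x => by
        ext v w
        change α.curryLeft (c • x) ![v, w] = c • α.curryLeft x ![v, w]
        rw [map_smul]; rfl }

theorem trilinearOf_apply (α : Coord m [⋀^Fin 3]→L[ℝ] ℝ) (x v w : Coord m) :
    trilinearOf α x v w = α ![x, v, w] := rfl

theorem trilinearOf_cyclic (α : Coord m [⋀^Fin 3]→L[ℝ] ℝ) (x v w : Coord m) :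
    trilinearOf α x v w = trilinearOf α v w x := by
  have h1 : ∀ a b c, α ![a, b, c] = -α ![b, a, c] := fun a b c => by
    have : α (![a, b, c] ∘ Equiv.swap 0 1) = -α ![a, b, c] :=
      α.toAlternatingMap.map_swap _ (by decide)
    rw [eq_comm, neg_eq_iff_eq_neg, ← this]
    congr 1
    funext k
    fin_cases k <;> rfl
  have h2 : ∀ a b c, α ![a, b, c] = -α ![a, c, b] := fun a b c => by
    have : α (![a, b, c] ∘ Equiv.swap 1 2) = -α ![a, b, c] :=
      α.toAlternatingMap.map_swap _ (by decide)
    rw [eq_comm, neg_eq_iff_eq_neg, ← this]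
    congr 1
    funext k
    fin_cases k <;> rfl
  rw [trilinearOf_apply, trilinearOf_apply, h1, h2, neg_neg]

/-- The trilinear form `G((D x) y, z)`. -/
def derivForm (G : Coord m →L[ℝ] Coord m →L[ℝ] ℝ) (D : Coord m →L[ℝ] Coord m →L[ℝ] Coord m) :
    Coord m →L[ℝ] Coord m →L[ℝ] Coord m →L[ℝ] ℝ :=
  (ContinuousLinearMap.compL ℝ (Coord m) (Coord m) (Coord m →L[ℝ] ℝ) G).comp D

theorem derivForm_apply (G : Coord m →L[ℝ] Coord m →L[ℝ] ℝ)
    (D : Coord m →L[ℝ] Coord m →L[ℝ] Coord m) (x y z : Coord m) :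
    derivForm G D x y z = G (D x y) z := rfl

end Trilinear

/-! ### Complex structures and `d^c ω` at a normal centre -/

section NormalCentre

variable {m : ℕ} {M : Type*} [TopologicalSpace M] [ChartedSpace (Coord m) M]
  [IsManifold 𝓘(ℝ, Coord m) ∞ M] {φ ψ : OpenPartialHomeomorph M (Coord m)} {y : Coord m}
  {g : Metric m M} {I J : AlmostComplex m M}

theorem inner_inChart_skew (hc : Compatible g I) (hφ : φ ∈ charts m M) (hy : y ∈ φ.target)
    (v w : Coord m) :
    metricInChart g φ y (I.inChart φ y v) w = -metricInChart g φ y v (I.inChart φ y w) := by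
  have h := metricInChart_compatible hc hφ hy v (I.inChart φ y w)
  rw [inChart_sq I hφ hy, map_neg] at h
  linarith

theorem fderiv_inChart_apply (I : AlmostComplex m M) (hφ : φ ∈ charts m M) (hy : y ∈ φ.target)
    (x v : Coord m) :
    fderiv ℝ (fun z => I.inChart φ z v) y x = fderiv ℝ (I.inChart φ) y x v := by
  rw [fderiv_clm_apply (ContDiffAt.diff (contDiffAt_inChart I hφ hy)) (differentiableAt_const v)]
  simp

/-- Derivative of `I² = -1`: the derivative of `I` anticommutes with `I`. -/
theorem fderiv_inChart_sq (I : AlmostComplex m M) (hφ : φ ∈ charts m M) (hy : y ∈ φ.target)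
    (x v : Coord m) :
    fderiv ℝ (I.inChart φ) y x (I.inChart φ y v)
      = -I.inChart φ y (fderiv ℝ (I.inChart φ) y x v) := by
  have hd := ContDiffAt.diff (contDiffAt_inChart I hφ hy)
  have h1 : (fun z => I.inChart φ z (I.inChart φ z v)) =ᶠ[𝓝 y] fun _ => -v := by
    filter_upwards [φ.open_target.mem_nhds hy] with z hz using inChart_sq I hφ hz v
  have h2 := congrArg (fun L : Coord m →L[ℝ] Coord m => L x) h1.fderiv_eq
  rw [fderiv_clm_apply hd (hd.clm_apply (differentiableAt_const v))] at h2
  simp only [add_apply, ContinuousLinearMap.comp_apply, ContinuousLinearMap.flip_apply,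
    fderiv_fun_const, Pi.zero_apply, zero_apply] at h2
  rw [fderiv_inChart_apply I hφ hy] at h2
  exact eq_neg_of_add_eq_zero_right h2

/-- Evaluating the Nijenhuis tensor on constant fields leaves only first derivatives of `I`. -/
theorem nijenhuis_eq (hI : I.Integrable) (hφ : φ ∈ charts m M) (hy : y ∈ φ.target)
    (v w : Coord m) :
    fderiv ℝ (I.inChart φ) y (I.inChart φ y v) w - fderiv ℝ (I.inChart φ) y (I.inChart φ y w) v
      + I.inChart φ y (fderiv ℝ (I.inChart φ) y w v)
      - I.inChart φ y (fderiv ℝ (I.inChart φ) y v w) = 0 := by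
  have h := hI φ hφ (fun _ => v) (fun _ => w) contDiffOn_const contDiffOn_const y hy
  unfold nijenhuis at h
  simp only [VectorField.lieBracket, fderiv_inChart_apply I hφ hy, fderiv_fun_const,
    Pi.zero_apply, zero_apply, map_sub, map_zero] at h
  rw [← h]
  abel

theorem IsNormalAt.fderiv_metric_apply (h : IsNormalAt g ψ y) {V W : Coord m → Coord m}
    (hV : DifferentiableAt ℝ V y) (hW : DifferentiableAt ℝ W y) (x : Coord m) :
    fderiv ℝ (fun z => metricInChart g ψ z (V z) (W z)) y x =
      metricInChart g ψ y (fderiv ℝ V y x) (W y) + metricInChart g ψ y (V y) (fderiv ℝ W y x) := by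
  have hd := ContDiffAt.diff (contDiffAt_metricInChart g h.mem_charts h.mem_target)
  rw [fderiv_clm_apply (hd.clm_apply hV) hW, fderiv_clm_apply hd hV, h.fderiv_eq]
  simp [add_comm]

theorem differentiableAt_inChart_apply (I : AlmostComplex m M) (hφ : φ ∈ charts m M)
    (hy : y ∈ φ.target) (v : Coord m) : DifferentiableAt ℝ (fun z => I.inChart φ z v) y :=
  (ContDiffAt.diff (contDiffAt_inChart I hφ hy)).clm_apply (differentiableAt_const v)

/-- At a normal centre `∇I` is the ordinary derivative, so the algebraic axioms follow by
differentiating compatibility and `I² = -1` and from integrability. -/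
theorem IsNormalAt.isHermitianDerivative (h : IsNormalAt g ψ y) (hI : I.Integrable)
    (hc : Compatible g I) :
    IsHermitianDerivative (I.inChart ψ y)
      (derivForm (metricInChart g ψ y) (fderiv ℝ (I.inChart ψ) y)) where
  sq := inChart_sq I h.mem_charts h.mem_target
  skew x v w := by
    have hψ := h.mem_charts
    have hy := h.mem_target
    have h1 : (fun z => metricInChart g ψ z (I.inChart ψ z v) w) =ᶠ[𝓝 y]
        fun z => -metricInChart g ψ z v (I.inChart ψ z w) := by
      filter_upwards [ψ.open_target.mem_nhds hy] with z hz using inner_inChart_skew hc hψ hz v w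
    have h2 := congrArg (fun L : Coord m →L[ℝ] ℝ => L x) h1.fderiv_eq
    simp only [fderiv_fun_neg, neg_apply] at h2
    rw [h.fderiv_metric_apply (differentiableAt_inChart_apply I hψ hy v)
      (differentiableAt_const w), h.fderiv_metric_apply (differentiableAt_const v)
      (differentiableAt_inChart_apply I hψ hy w), fderiv_inChart_apply I hψ hy,
      fderiv_inChart_apply I hψ hy] at h2
    simp only [fderiv_fun_const, Pi.zero_apply, zero_apply, map_zero, add_zero, zero_add] at h2
    rw [derivForm_apply, derivForm_apply, h2, metricInChart_symm g v]
  anti x v w := by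
    rw [derivForm_apply, derivForm_apply, fderiv_inChart_sq I h.mem_charts h.mem_target, map_neg,
      neg_apply, inner_inChart_skew hc h.mem_charts h.mem_target, neg_neg]
  nijenhuis x v w := by
    have h1 := congrArg (fun u => metricInChart g ψ y u w)
      (nijenhuis_eq hI h.mem_charts h.mem_target x v)
    simp only [map_sub, map_add, map_zero, sub_apply, add_apply, zero_apply,
      inner_inChart_skew hc h.mem_charts h.mem_target] at h1
    simp only [derivForm_apply]
    linarith

theorem IsNormalAt.extDeriv_fundamentalForm (h : IsNormalAt g ψ y) (hc : Compatible g I)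
    (v : Fin 3 → Coord m) :
    extDeriv ((fundamentalForm g I hc).inChart ψ) y v =
      derivForm (metricInChart g ψ y) (fderiv ℝ (I.inChart ψ) y) (v 0) (v 1) (v 2)
      - derivForm (metricInChart g ψ y) (fderiv ℝ (I.inChart ψ) y) (v 1) (v 0) (v 2)
      + derivForm (metricInChart g ψ y) (fderiv ℝ (I.inChart ψ) y) (v 2) (v 0) (v 1) := by
  have hψ := h.mem_charts
  have hy := h.mem_target
  have key : ∀ (x : Coord m) (w : Fin 2 → Coord m),
      fderiv ℝ (fun z => (fundamentalForm g I hc).inChart ψ z w) y x =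
        derivForm (metricInChart g ψ y) (fderiv ℝ (I.inChart ψ) y) x (w 0) (w 1) := by
    intro x w
    have h1 : (fun z => (fundamentalForm g I hc).inChart ψ z w) =ᶠ[𝓝 y]
        fun z => metricInChart g ψ z (I.inChart ψ z (w 0)) (w 1) := by
      filter_upwards [ψ.open_target.mem_nhds hy] with z hz
        using fundamentalForm_inChart_apply hc hψ hz w
    rw [h1.fderiv_eq, h.fderiv_metric_apply (differentiableAt_inChart_apply I hψ hy _)
      (differentiableAt_const _), fderiv_inChart_apply I hψ hy]
    simp [derivForm_apply]
  rw [extDeriv_apply (ContDiffAt.diff (contDiffAt_fundamentalForm_inChart hc hψ hy))]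
  simp only [key]
  refine (Fin.sum_univ_three _).trans ?_
  simp [Fin.removeNth, Fin.succAbove, sub_eq_add_neg]

theorem IsNormalAt.dcFundamental_apply (h : IsNormalAt g ψ y) (hc : Compatible g I)
    (x v w : Coord m) :
    let T := derivForm (metricInChart g ψ y) (fderiv ℝ (I.inChart ψ) y)
    let A := I.inChart ψ y
    trilinearOf (dcFundamental g I hc ψ y) x v w =
      -(T (A x) (A v) (A w) - T (A v) (A x) (A w) + T (A w) (A x) (A v)) := by
  intro T A
  rw [trilinearOf_apply, dcFundamental_eq hc h.mem_charts h.mem_target,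
    ContinuousAlternatingMap.compContinuousLinearMap_apply, h.extDeriv_fundamentalForm hc]
  simp only [Function.comp, neg_apply, Matrix.cons_val_zero, Matrix.cons_val_one,
    Matrix.cons_val, map_neg]
  ring

end NormalCentre

/-! ### The 2-form `b = g((I - sJ)(I + sJ)⁻¹ ·, ·)` and `db = H` -/

section Potential

variable {m : ℕ} {M : Type*} [TopologicalSpace M] [ChartedSpace (Coord m) M]
  [IsManifold 𝓘(ℝ, Coord m) ∞ M] {φ ψ : OpenPartialHomeomorph M (Coord m)} {y : Coord m}

namespace GKStructure

variable (K : GKStructure m M) (s : ℝ)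

/-- The coordinate expression of `I + s J`. -/
def sumOp (φ : OpenPartialHomeomorph M (Coord m)) (y : Coord m) : Coord m →L[ℝ] Coord m :=
  K.I.inChart φ y + s • K.J.inChart φ y

/-- The coordinate expression of `I - s J`. -/
def diffOp (φ : OpenPartialHomeomorph M (Coord m)) (y : Coord m) : Coord m →L[ℝ] Coord m :=
  K.I.inChart φ y - s • K.J.inChart φ y

/-- The coordinate expression of the 2-form `g((I - s J)(I + s J)⁻¹ ·, ·)`. -/
def potential (φ : OpenPartialHomeomorph M (Coord m)) (y : Coord m) :
    Coord m →L[ℝ] Coord m →L[ℝ] ℝ :=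
  (metricInChart K.g φ y).comp ((K.diffOp s φ y).comp (Ring.inverse (K.sumOp s φ y)))

variable {K s}

theorem isUnit_sumOp (hU : ∀ x, IsUnit (K.I.toEnd x + s • K.J.toEnd x)) (hφ : φ ∈ charts m M)
    (hy : y ∈ φ.target) : IsUnit (K.sumOp s φ y) := by
  obtain ⟨u, hu⟩ := hU (φ.symm y)
  have h0 : ∀ v, K.sumOp s φ y v =
      dChart φ y ((K.I.toEnd (φ.symm y) + s • K.J.toEnd (φ.symm y)) (dChartSymm φ y v)) := by
    intro v
    simp [sumOp, inChart_apply, map_add]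
  let R : Coord m →L[ℝ] Coord m := (dChart φ y).comp
    ((u⁻¹.val : T m (φ.symm y) →L[ℝ] T m (φ.symm y)).comp (dChartSymm φ y))
  have hR : ∀ v, R v = dChart φ y (u⁻¹.val (dChartSymm φ y v)) := fun v => rfl
  refine ⟨⟨K.sumOp s φ y, R, ?_, ?_⟩, rfl⟩
  · ext1 v
    change K.sumOp s φ y (R v) = v
    rw [h0, hR, dChartSymm_dChart hφ hy, ← hu]
    have h1 : u.val (u⁻¹.val (dChartSymm φ y v)) = dChartSymm φ y v :=
      DFunLike.congr_fun u.mul_inv (dChartSymm φ y v)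
    rw [h1, dChart_dChartSymm hφ hy]
  · ext1 v
    change R (K.sumOp s φ y v) = v
    rw [h0, hR, dChartSymm_dChart hφ hy, ← hu]
    have h1 : u⁻¹.val (u.val (dChartSymm φ y v)) = dChartSymm φ y v :=
      DFunLike.congr_fun u.inv_mul (dChartSymm φ y v)
    rw [h1, dChart_dChartSymm hφ hy]

theorem sumOp_inverse (hu : IsUnit (K.sumOp s φ y)) (v : Coord m) :
    K.sumOp s φ y (Ring.inverse (K.sumOp s φ y) v) = v :=
  DFunLike.congr_fun (Ring.mul_inverse_cancel _ hu) v

theorem inverse_sumOp (hu : IsUnit (K.sumOp s φ y)) (v : Coord m) :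
    Ring.inverse (K.sumOp s φ y) (K.sumOp s φ y v) = v :=
  DFunLike.congr_fun (Ring.inverse_mul_cancel _ hu) v

theorem contDiffAt_sumOp (hφ : φ ∈ charts m M) (hy : y ∈ φ.target) :
    ContDiffAt ℝ ∞ (K.sumOp s φ) y :=
  (contDiffAt_inChart K.I hφ hy).add ((contDiffAt_inChart K.J hφ hy).const_smul s)

theorem contDiffAt_diffOp (hφ : φ ∈ charts m M) (hy : y ∈ φ.target) :
    ContDiffAt ℝ ∞ (K.diffOp s φ) y :=
  (contDiffAt_inChart K.I hφ hy).sub ((contDiffAt_inChart K.J hφ hy).const_smul s)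

theorem contDiffAt_inverse_sumOp (hU : ∀ x, IsUnit (K.I.toEnd x + s • K.J.toEnd x))
    (hφ : φ ∈ charts m M) (hy : y ∈ φ.target) :
    ContDiffAt ℝ ∞ (fun z => Ring.inverse (K.sumOp s φ z)) y := by
  obtain ⟨u, hu⟩ := isUnit_sumOp hU hφ hy
  have h := contDiffAt_ringInverse ℝ (n := ∞) u
  rw [hu] at h
  exact h.comp y (contDiffAt_sumOp hφ hy)

theorem contDiffAt_potential (hU : ∀ x, IsUnit (K.I.toEnd x + s • K.J.toEnd x))
    (hφ : φ ∈ charts m M) (hy : y ∈ φ.target) : ContDiffAt ℝ ∞ (K.potential s φ) y :=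
  (contDiffAt_metricInChart K.g hφ hy).clm_comp
    ((contDiffAt_diffOp hφ hy).clm_comp (contDiffAt_inverse_sumOp hU hφ hy))

theorem potential_apply (v w : Coord m) : K.potential s φ y v w =
    metricInChart K.g φ y (K.diffOp s φ y (Ring.inverse (K.sumOp s φ y) v)) w := rfl

theorem sumOp_transition (hφ : φ ∈ charts m M) (hψ : ψ ∈ charts m M)
    (hy : y ∈ ψ.target) (hy' : ψ.symm y ∈ φ.source) (v : Coord m) :
    fderiv ℝ (transition φ ψ) y (K.sumOp s ψ y v) =
      K.sumOp s φ (transition φ ψ y) (fderiv ℝ (transition φ ψ) y v) := by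
  simp [sumOp, inChart_transition _ hφ hψ hy hy']

theorem diffOp_transition (hφ : φ ∈ charts m M) (hψ : ψ ∈ charts m M)
    (hy : y ∈ ψ.target) (hy' : ψ.symm y ∈ φ.source) (v : Coord m) :
    fderiv ℝ (transition φ ψ) y (K.diffOp s ψ y v) =
      K.diffOp s φ (transition φ ψ y) (fderiv ℝ (transition φ ψ) y v) := by
  simp [diffOp, inChart_transition _ hφ hψ hy hy']

theorem potential_transition (hU : ∀ x, IsUnit (K.I.toEnd x + s • K.J.toEnd x))
    (hφ : φ ∈ charts m M) (hψ : ψ ∈ charts m M)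
    (hy : y ∈ ψ.target) (hy' : ψ.symm y ∈ φ.source) (v w : Coord m) :
    K.potential s ψ y v w = K.potential s φ (transition φ ψ y)
      (fderiv ℝ (transition φ ψ) y v) (fderiv ℝ (transition φ ψ) y w) := by
  -- Writing the argument as an image of `I + sJ` cancels the inverse, and the law reduces to those
  -- of `I`, `J` and `g`.
  obtain ⟨r, rfl⟩ : ∃ r, K.sumOp s ψ y r = v := ⟨_, sumOp_inverse (isUnit_sumOp hU hψ hy) v⟩
  rw [potential_apply, potential_apply, inverse_sumOp (isUnit_sumOp hU hψ hy),
    sumOp_transition hφ hψ hy hy',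
    inverse_sumOp (isUnit_sumOp hU hφ (transition_mem_target hy')),
    ← diffOp_transition hφ hψ hy hy', metricInChart_transition K.g hφ hψ hy hy']

/-- The squares cancel because `s² = 1`; both products are multiples of the commutator of `I` and
`J`, with opposite signs. -/
theorem sumOp_diffOp (hs : s * s = 1) (hφ : φ ∈ charts m M) (hy : y ∈ φ.target) (v : Coord m) :
    K.sumOp s φ y (K.diffOp s φ y v) = -K.diffOp s φ y (K.sumOp s φ y v) := by
  simp only [sumOp, diffOp, add_apply, sub_apply, smul_apply, map_sub, map_add, map_smul,
    inChart_sq K.I hφ hy, inChart_sq K.J hφ hy, smul_smul, hs, smul_sub, smul_add]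
  simp only [one_smul]
  abel

theorem inner_sumOp (hφ : φ ∈ charts m M) (hy : y ∈ φ.target) (v w : Coord m) :
    metricInChart K.g φ y (K.sumOp s φ y v) w = -metricInChart K.g φ y v (K.sumOp s φ y w) := by
  simp only [sumOp, add_apply, smul_apply, map_add, map_smul, smul_eq_mul,
    inner_inChart_skew K.compatible_I hφ hy, inner_inChart_skew K.compatible_J hφ hy]
  ring

theorem inner_diffOp (hφ : φ ∈ charts m M) (hy : y ∈ φ.target) (v w : Coord m) :
    metricInChart K.g φ y (K.diffOp s φ y v) w = -metricInChart K.g φ y v (K.diffOp s φ y w) := by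
  simp only [diffOp, sub_apply, smul_apply, map_sub, map_smul, smul_eq_mul,
    inner_inChart_skew K.compatible_I hφ hy, inner_inChart_skew K.compatible_J hφ hy]
  ring

theorem fderiv_sumOp_inverse (hU : ∀ x, IsUnit (K.I.toEnd x + s • K.J.toEnd x))
    (hφ : φ ∈ charts m M) (hy : y ∈ φ.target) (x v : Coord m) :
    K.sumOp s φ y (fderiv ℝ (fun z => Ring.inverse (K.sumOp s φ z) v) y x) =
      -fderiv ℝ (K.sumOp s φ) y x (Ring.inverse (K.sumOp s φ y) v) := by
  have h1 : (fun z => K.sumOp s φ z (Ring.inverse (K.sumOp s φ z) v)) =ᶠ[𝓝 y] fun _ => v := by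
    filter_upwards [φ.open_target.mem_nhds hy] with z hz
      using sumOp_inverse (isUnit_sumOp hU hφ hz) v
  have h2 := congrArg (fun L : Coord m →L[ℝ] Coord m => L x) h1.fderiv_eq
  rw [fderiv_clm_apply (ContDiffAt.diff (contDiffAt_sumOp hφ hy))
    ((ContDiffAt.diff (contDiffAt_inverse_sumOp hU hφ hy)).clm_apply
      (differentiableAt_const v))] at h2
  simp only [add_apply, ContinuousLinearMap.comp_apply, ContinuousLinearMap.flip_apply,
    fderiv_fun_const, Pi.zero_apply, zero_apply] at h2
  exact eq_neg_of_add_eq_zero_left h2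

theorem fderiv_sumOp (hφ : φ ∈ charts m M) (hy : y ∈ φ.target) (x v : Coord m) :
    fderiv ℝ (K.sumOp s φ) y x v =
      fderiv ℝ (K.I.inChart φ) y x v + s • fderiv ℝ (K.J.inChart φ) y x v := by
  have hI := ContDiffAt.diff (contDiffAt_inChart K.I hφ hy)
  have hJ := ContDiffAt.diff (contDiffAt_inChart K.J hφ hy)
  unfold sumOp
  rw [fderiv_fun_add hI (hJ.fun_const_smul s), fderiv_fun_const_smul hJ]
  rfl

theorem fderiv_diffOp (hφ : φ ∈ charts m M) (hy : y ∈ φ.target) (x v : Coord m) :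
    fderiv ℝ (K.diffOp s φ) y x v =
      fderiv ℝ (K.I.inChart φ) y x v - s • fderiv ℝ (K.J.inChart φ) y x v := by
  have hI := ContDiffAt.diff (contDiffAt_inChart K.I hφ hy)
  have hJ := ContDiffAt.diff (contDiffAt_inChart K.J hφ hy)
  unfold diffOp
  rw [fderiv_fun_sub hI (hJ.fun_const_smul s), fderiv_fun_const_smul hJ]
  rfl

/-- Evaluating `b` on images under `P = I + sJ`, frozen at `y`, removes the inverse from the result.
With `Q = I - sJ` the derivative is `g((∂Q)v, Pw) + g((∂P)v, Qw)`, and the cross terms in `I` and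
`J` cancel. -/
theorem fderiv_potential (hs : s * s = 1) (hU : ∀ x, IsUnit (K.I.toEnd x + s • K.J.toEnd x))
    (h : IsNormalAt K.g ψ y) (x v w : Coord m) :
    fderiv ℝ (fun z => K.potential s ψ z (K.sumOp s ψ y v) (K.sumOp s ψ y w)) y x =
      2 * derivForm (metricInChart K.g ψ y) (fderiv ℝ (K.I.inChart ψ) y) x v (K.I.inChart ψ y w)
      - 2 * derivForm (metricInChart K.g ψ y) (fderiv ℝ (K.J.inChart ψ) y) x v
        (K.J.inChart ψ y w) := by
  have hψ := h.mem_charts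
  have hy := h.mem_target
  have hu := isUnit_sumOp hU hψ hy
  have hr := (ContDiffAt.diff (contDiffAt_inverse_sumOp hU hψ hy)).clm_apply
      (differentiableAt_const (K.sumOp s ψ y v))
  have hd := ContDiffAt.diff (contDiffAt_diffOp (K := K) (s := s) hψ hy)
  have h1 := h.fderiv_metric_apply (hd.clm_apply hr)
    (differentiableAt_const (K.sumOp s ψ y w)) x
  simp only [potential_apply]
  rw [h1, fderiv_clm_apply hd hr]
  simp only [add_apply, ContinuousLinearMap.comp_apply, ContinuousLinearMap.flip_apply,
    fderiv_fun_const, Pi.zero_apply, zero_apply, map_zero, add_zero, inverse_sumOp hu, map_add]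
  have h2 := fderiv_sumOp_inverse hU hψ hy x (K.sumOp s ψ y v)
  rw [inverse_sumOp hu] at h2
  -- The derivative of `P⁻¹` is traded for that of `P`, and `P`, `Q` are moved across the metric by
  -- skewness and anticommutation.
  have h3 : metricInChart K.g ψ y (K.diffOp s ψ y
      (fderiv ℝ (fun z => Ring.inverse (K.sumOp s ψ z) (K.sumOp s ψ y v)) y x))
      (K.sumOp s ψ y w) =
      metricInChart K.g ψ y (fderiv ℝ (K.sumOp s ψ) y x v) (K.diffOp s ψ y w) := by
    rw [← neg_neg (fderiv ℝ (K.sumOp s ψ) y x v), ← h2, map_neg, neg_apply,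
      inner_sumOp hψ hy, inner_diffOp hψ hy, sumOp_diffOp hs hψ hy]
    simp
  rw [h3, fderiv_sumOp hψ hy, fderiv_diffOp hψ hy]
  simp only [sumOp, diffOp, add_apply, sub_apply, smul_apply, map_sub, map_add, map_smul,
    smul_eq_mul, derivForm_apply]
  linear_combination (-2 * metricInChart K.g ψ y (fderiv ℝ (K.J.inChart ψ) y x v)
    (K.J.inChart ψ y w)) * hs

theorem torsion_eq_neg (hφ : φ ∈ charts m M) (hy : y ∈ φ.target) (x v w : Coord m) :
    trilinearOf (dcFundamental K.g K.J K.compatible_J φ y) x v w =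
      -trilinearOf (K.torsion φ y) x v w := by
  rw [trilinearOf_apply, trilinearOf_apply, torsion, K.dc_eq φ hφ y hy]
  simp

end GKStructure

/-- The sign change `A ↦ -A`. -/
theorem IsHermitianDerivative.smul {V : Type*} [NormedAddCommGroup V] [NormedSpace ℝ V]
    {A : V →L[ℝ] V} {T : V →L[ℝ] V →L[ℝ] V →L[ℝ] ℝ} (h : IsHermitianDerivative A T) {s : ℝ}
    (hs : s * s = 1) : IsHermitianDerivative (s • A) (s • T) where
  sq x := by simp [smul_smul, hs, h.sq]
  skew x y z := by simp [h.skew x y z]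
  anti x y z := by simp [h.anti x y z]
  nijenhuis x y z := by
    simp only [smul_apply, map_smul, smul_eq_mul, ← mul_assoc, hs, one_mul]
    exact h.nijenhuis x y z

/-- This is `db = H`. After substituting `P x, P v, P w`, each derivative of `b` is expressed
through `∇I` and `∇J`, hence through `H`, and the cyclic sum collapses to `H(Px, Pv, Pw)`. Working
with `sJ` in place of `J` treats both signs at once. -/
theorem GKStructure.fderiv_potential_cyclic {K : GKStructure m M} {s : ℝ} (hs : s * s = 1)
    (hU : ∀ x, IsUnit (K.I.toEnd x + s • K.J.toEnd x)) (h : IsNormalAt K.g ψ y)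
    (x v w : Coord m) :
    fderiv ℝ (fun z => K.potential s ψ z v w) y x + fderiv ℝ (fun z => K.potential s ψ z w x) y v
      + fderiv ℝ (fun z => K.potential s ψ z x v) y w = K.torsion ψ y ![x, v, w] := by
  have hψ := h.mem_charts
  have hy := h.mem_target
  have hu := isUnit_sumOp hU hψ hy
  obtain ⟨x, rfl⟩ : ∃ r, K.sumOp s ψ y r = x := ⟨_, sumOp_inverse hu x⟩
  obtain ⟨v, rfl⟩ : ∃ r, K.sumOp s ψ y r = v := ⟨_, sumOp_inverse hu v⟩
  obtain ⟨w, rfl⟩ : ∃ r, K.sumOp s ψ y r = w := ⟨_, sumOp_inverse hu w⟩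
  have hI := h.isHermitianDerivative K.integrable_I K.compatible_I
  have hJ := (h.isHermitianDerivative K.integrable_J K.compatible_J).smul hs
  have dI := h.dcFundamental_apply K.compatible_I
  have dJ := h.dcFundamental_apply K.compatible_J
  have hneg := torsion_eq_neg (K := K) hψ hy
  have hcyc := trilinearOf_cyclic (K.torsion ψ y)
  simp only [fderiv_potential hs hU h, ← trilinearOf_apply]
  unfold sumOp at *
  change ∀ x v w, trilinearOf (K.torsion ψ y) x v w = _ at dI
  generalize derivForm (metricInChart K.g ψ y) (fderiv ℝ (K.I.inChart ψ) y) = T at *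
  generalize derivForm (metricInChart K.g ψ y) (fderiv ℝ (K.J.inChart ψ) y) = S at *
  generalize K.I.inChart ψ y = A at *
  generalize K.J.inChart ψ y = B at *
  generalize trilinearOf (K.torsion ψ y) = H at *
  generalize trilinearOf (dcFundamental K.g K.J K.compatible_J ψ y) = H' at *
  -- Replacing `J` and its derivative by their multiples by `s` introduces four factors `s`, and `s⁴
  -- = 1`: the torsion of `-J` is that of `J`.
  have dJ' : ∀ x y z, H' x y z = -((s • S) ((s • B) x) ((s • B) y) ((s • B) z)
      - (s • S) ((s • B) y) ((s • B) x) ((s • B) z)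
      + (s • S) ((s • B) z) ((s • B) x) ((s • B) y)) := by
    intro x y z
    have h1 := dJ x y z
    simp only [smul_apply, map_smul, smul_eq_mul]
    rw [h1]
    linear_combination ((S (B x) (B y) (B z) - S (B y) (B x) (B z) + S (B z) (B x) (B y)) *
      (s * s + 1)) * hs
  have h1 := cyclic_sum_eq hI.sq hJ.sq (hI.two_mul_eq dI)
    (fun x y z => (hJ.two_mul_eq dJ' x y z).trans (by rw [hneg, hneg]; ring))
    (hI.torsion_type dI)
    (fun x y z => by
      have := hJ.torsion_type dJ' x y z
      simp only [hneg] at this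
      linarith) hcyc x v w
  simp only [map_add, map_smul, add_apply, smul_apply, smul_eq_mul] at h1 ⊢
  linear_combination h1 + 2 * (S (A x) v (B w) + s * S (B x) v (B w) + S (A v) w (B x)
    + s * S (B v) w (B x) + S (A w) x (B v) + s * S (B w) x (B v)) * hs

end Potential

/-! ### The torsion vanishes -/

section TorsionVanishing

variable {m : ℕ} {M : Type*} [TopologicalSpace M] [ChartedSpace (Coord m) M]
  [IsManifold 𝓘(ℝ, Coord m) ∞ M] {φ ψ : OpenPartialHomeomorph M (Coord m)} {y : Coord m}

namespace GKStructure

variable {K : GKStructure m M} {s : ℝ}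

theorem contDiffAt_comp3 (hφ : φ ∈ charts m M) (hy : y ∈ φ.target) (i j k : Fin m) :
    ContDiffAt ℝ ∞ (comp3 (K.torsion φ) i j k) y :=
  contDiffAt_form_const_apply (contDiffAt_dcFundamental K.compatible_I hφ hy) _

/-- The contraction of the torsion with a bilinear form, `g^{jp} g^{qk} H_{lpq} b_{jk}`. -/
def torsionTrace (K : GKStructure m M) (s : ℝ) (φ : OpenPartialHomeomorph M (Coord m))
    (y : Coord m) (l : Fin m) : ℝ :=
  ∑ j, ∑ k, (∑ q, (∑ p, (gram (metricInChart K.g φ) y)⁻¹ j p * comp3 (K.torsion φ) l p q y) *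
    (gram (metricInChart K.g φ) y)⁻¹ q k) * gram (K.potential s φ) y j k

/-- The matrix of the bilinear form `H(e_l, ·, ·)`. -/
def torsionMatrix (K : GKStructure m M) (φ : OpenPartialHomeomorph M (Coord m)) (y : Coord m)
    (l : Fin m) : Matrix (Fin m) (Fin m) ℝ :=
  Matrix.of fun j k => trilinearOf (K.torsion φ y) (e l) (e j) (e k)

theorem torsionTrace_eq (φ : OpenPartialHomeomorph M (Coord m)) (y : Coord m) (l : Fin m) :
    K.torsionTrace s φ y l = Matrix.trace ((gram (metricInChart K.g φ) y)⁻¹ *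
      K.torsionMatrix φ y l * (gram (metricInChart K.g φ) y)⁻¹ *
      (gram (K.potential s φ) y).transpose) := by
  simp only [Matrix.trace, Matrix.diag_apply, Matrix.mul_apply, Matrix.transpose_apply]
  rfl

theorem torsionMatrix_transition (hφ : φ ∈ charts m M) (hψ : ψ ∈ charts m M) (hy : y ∈ ψ.target)
    (hy' : ψ.symm y ∈ φ.source) (l : Fin m) :
    K.torsionMatrix ψ y l = (transitionMatrix φ ψ y).transpose *
      (∑ a, transitionMatrix φ ψ y a l • K.torsionMatrix φ (transition φ ψ y) a) *
      transitionMatrix φ ψ y := by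
  have h1 := bilin_matrix_law hφ hψ hy hy' (B' := trilinearOf (K.torsion ψ y) (e l))
    (B := ∑ a, transitionMatrix φ ψ y a l • trilinearOf (K.torsion φ (transition φ ψ y)) (e a))
    (fun v w => by
      have h2 := dcFundamental_transition K.compatible_I hφ hψ hy hy' ![e l, v, w]
      have h3 : trilinearOf (K.torsion φ (transition φ ψ y)) (fderiv ℝ (transition φ ψ) y (e l)) =
        ∑ a, transitionMatrix φ ψ y a l • trilinearOf (K.torsion φ (transition φ ψ y)) (e a) := by
        rw [fderiv_transition_e hφ hψ hy hy']
        simp only [map_sum, map_smul]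
      rw [← h3, trilinearOf_apply, trilinearOf_apply]
      refine h2.trans ?_
      unfold torsion
      congr 1
      funext j
      fin_cases j <;> rfl)
  refine h1.trans ?_
  congr 2
  ext j k
  simp [torsionMatrix, Matrix.sum_apply]

theorem gram_potential_transition (hU : ∀ x, IsUnit (K.I.toEnd x + s • K.J.toEnd x))
    (hφ : φ ∈ charts m M) (hψ : ψ ∈ charts m M) (hy : y ∈ ψ.target)
    (hy' : ψ.symm y ∈ φ.source) :
    gram (K.potential s ψ) y = (transitionMatrix φ ψ y).transpose *
      gram (K.potential s φ) (transition φ ψ y) * transitionMatrix φ ψ y :=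
  bilin_matrix_law hφ hψ hy hy' (potential_transition hU hφ hψ hy hy')

theorem contDiffAt_gram_potential (hU : ∀ x, IsUnit (K.I.toEnd x + s • K.J.toEnd x))
    (hφ : φ ∈ charts m M) (hy : y ∈ φ.target) (j k : Fin m) :
    ContDiffAt ℝ ∞ (fun z => gram (K.potential s φ) z j k) y :=
  ((contDiffAt_potential hU hφ hy).clm_apply contDiffAt_const).clm_apply contDiffAt_const

/-- Written as a trace, the Jacobians from `H`, from `b` and from the two inverse metrics recombine
by cyclicity; only the one for the free index `l` survives. -/
theorem isCovectorField_torsionTrace (hU : ∀ x, IsUnit (K.I.toEnd x + s • K.J.toEnd x)) :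
    IsCovectorField (K.torsionTrace s) where
  contDiffAt φ hφ y hy l := ContDiffAt.sum fun j _ => ContDiffAt.sum fun k _ =>
    (ContDiffAt.sum fun q _ => (ContDiffAt.sum fun p _ =>
      (contDiffAt_gram_inv K.g hφ hy j p).mul (contDiffAt_comp3 hφ hy l p q)).mul
      (contDiffAt_gram_inv K.g hφ hy q k)).mul (contDiffAt_gram_potential hU hφ hy j k)
  law φ hφ ψ hψ y hy hy' := by
    have hR := mul_gram_inv_mul_transpose K.g hφ hψ hy hy'
    have hH := fun l => torsionMatrix_transition (K := K) hφ hψ hy hy' l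
    have hb := gram_potential_transition hU hφ hψ hy hy'
    funext l
    simp only [Matrix.mulVec, dotProduct, Matrix.transpose_apply, torsionTrace_eq]
    rw [hH, hb, Matrix.transpose_mul, Matrix.transpose_mul, Matrix.transpose_transpose, ← hR]
    generalize transitionMatrix φ ψ y = L
    generalize (gram (metricInChart K.g ψ) y)⁻¹ = G
    generalize (gram (K.potential s φ) (transition φ ψ y)).transpose = b
    generalize K.torsionMatrix φ (transition φ ψ y) = N
    have h1 : ∀ X, Matrix.trace (G * (L.transpose * X * L) * G * (L.transpose * (b * L))) =
        Matrix.trace (L * G * L.transpose * X * (L * G * L.transpose) * b) := by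
      intro X
      rw [← mul_assoc L.transpose b L, ← mul_assoc, Matrix.trace_mul_comm]
      simp only [mul_assoc]
    rw [h1]
    simp only [Finset.mul_sum, Finset.sum_mul, Matrix.trace_sum, Matrix.mul_smul, Matrix.smul_mul,
      Matrix.trace_smul, smul_eq_mul]

theorem pd_torsionTrace (hU : ∀ x, IsUnit (K.I.toEnd x + s • K.J.toEnd x))
    (h : IsNormalAt K.g ψ y) (i l : Fin m) :
    pd i (fun z => K.torsionTrace s ψ z l) y =
      ∑ j, ∑ k, (pd i (comp3 (K.torsion ψ) l j k) y * gram (K.potential s ψ) y j k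
        + comp3 (K.torsion ψ) l j k y * pd i (fun z => gram (K.potential s ψ) z j k) y) := by
  have hψ := h.mem_charts
  have hy := h.mem_target
  have hg := fun j k => ContDiffAt.diff (contDiffAt_gram_inv K.g hψ hy j k)
  have hc := fun j k => ContDiffAt.diff (contDiffAt_comp3 (K := K) hψ hy l j k)
  have hb := fun j k => ContDiffAt.diff (contDiffAt_gram_potential hU hψ hy j k)
  have h1 := fun j q => DifferentiableAt.fun_sum (u := Finset.univ)
    fun p _ => (hg j p).fun_mul (hc p q)
  have h2 := fun j k => DifferentiableAt.fun_sum (u := Finset.univ)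
    fun q _ => (h1 j q).fun_mul (hg q k)
  have e1 : ∀ j q, pd i (fun z => ∑ p, (gram (metricInChart K.g ψ) z)⁻¹ j p *
      comp3 (K.torsion ψ) l p q z) y = pd i (comp3 (K.torsion ψ) l j q) y := by
    intro j q
    rw [pd_sum i _ fun p _ => (hg j p).fun_mul (hc p q)]
    simp only [pd_mul i (hg _ _) (hc _ _), h.pd_gram_inv, h.gram_inv_eq, Matrix.one_apply]
    simp
  have e2 : ∀ j k, pd i (fun z => ∑ q, (∑ p, (gram (metricInChart K.g ψ) z)⁻¹ j p *
      comp3 (K.torsion ψ) l p q z) * (gram (metricInChart K.g ψ) z)⁻¹ q k) y =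
      pd i (comp3 (K.torsion ψ) l j k) y := by
    intro j k
    rw [pd_sum i _ fun q _ => (h1 j q).fun_mul (hg q k)]
    simp only [pd_mul i (h1 _ _) (hg _ _), e1, h.pd_gram_inv, h.gram_inv_eq, Matrix.one_apply]
    simp
  unfold torsionTrace
  rw [pd_sum i _ fun j _ => DifferentiableAt.fun_sum fun k _ => (h2 j k).fun_mul (hb j k)]
  refine Finset.sum_congr rfl fun j _ => ?_
  rw [pd_sum i _ fun k _ => (h2 j k).fun_mul (hb j k)]
  refine Finset.sum_congr rfl fun k _ => ?_
  rw [pd_mul i (h2 j k) (hb j k), e2, h.gram_inv_eq]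
  simp [Matrix.one_apply]

theorem comp3_cyclic (i j k : Fin m) :
    comp3 (K.torsion φ) i j k y = comp3 (K.torsion φ) j k i y :=
  trilinearOf_cyclic (K.torsion φ y) (e i) (e j) (e k)

end GKStructure

theorem IsNormalAt.christoffel_eq {g : Metric m M} (h : IsNormalAt g ψ y) (i j k : Fin m) :
    christoffel (metricInChart g ψ) k i j y = 0 := by
  simp [christoffel, h.pd_gram]

namespace GKStructure

variable {K : GKStructure m M} {s : ℝ} {f : M → ℝ}

/-- The weighted coclosedness of the torsion at the centre of a normal chart. -/
theorem IsSteadySoliton.sum_pd_comp3 (hf : K.IsSteadySoliton f) (h : IsNormalAt K.g ψ y)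
    (j k : Fin m) :
    ∑ l, (pd l (comp3 (K.torsion ψ) l j k) y
      - pd l (f ∘ ψ.symm) y * comp3 (K.torsion ψ) l j k y) = 0 := by
  have h1 := (hf.2 ψ h.mem_charts y h.mem_target j k).2
  simp only [codiff3, gradContract, covDeriv3, h.christoffel_eq, h.gram_inv_eq,
    Matrix.one_apply] at h1
  simp at h1
  rw [Finset.sum_sub_distrib]
  linarith

/-- By cyclicity of `H` the three rotations of the left-hand sum are equal, and together they
contract `H` with `db = H`. -/
theorem sum_comp3_mul_pd (hs : s * s = 1) (hU : ∀ x, IsUnit (K.I.toEnd x + s • K.J.toEnd x))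
    (h : IsNormalAt K.g ψ y) :
    ∑ l, ∑ j, ∑ k, comp3 (K.torsion ψ) l j k y * pd l (fun z => gram (K.potential s ψ) z j k) y =
      (1 / 3 : ℝ) * ∑ l, ∑ j, ∑ k, comp3 (K.torsion ψ) l j k y ^ 2 := by
  have key : ∀ l j k, pd l (fun z => gram (K.potential s ψ) z j k) y
      + pd j (fun z => gram (K.potential s ψ) z k l) y
      + pd k (fun z => gram (K.potential s ψ) z l j) y = comp3 (K.torsion ψ) l j k y :=
    fun l j k => fderiv_potential_cyclic hs hU h (e l) (e j) (e k)
  have hc : ∀ F : Fin m → Fin m → Fin m → ℝ, ∑ l, ∑ j, ∑ k, F j k l = ∑ l, ∑ j, ∑ k, F l j k := by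
    intro F
    rw [Finset.sum_comm]
    exact Finset.sum_congr rfl fun j _ => Finset.sum_comm
  set X : Fin m → Fin m → Fin m → ℝ := fun l j k =>
    comp3 (K.torsion ψ) l j k y * pd l (fun z => gram (K.potential s ψ) z j k) y with hX
  have h1 : ∀ l j k, comp3 (K.torsion ψ) l j k y ^ 2 = X l j k + X j k l + X k l j := by
    intro l j k
    simp only [hX]
    rw [← comp3_cyclic l j k, comp3_cyclic k l j, ← mul_add, ← mul_add, key, sq]
  simp only [h1, Finset.sum_add_distrib]
  rw [hc X, hc fun k l j => X l j k, hc X]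
  ring

end GKStructure

theorem pd_exp_neg {u : Coord m → ℝ} (hu : DifferentiableAt ℝ u y) (i : Fin m) :
    pd i (fun z => Real.exp (-u z)) y = -(Real.exp (-u y) * pd i u y) := by
  unfold pd
  rw [fderiv_exp hu.fun_neg, smul_apply, fderiv_fun_neg, neg_apply, smul_eq_mul, mul_neg]

namespace GKStructure

variable {K : GKStructure m M} {s : ℝ} {f : M → ℝ}

theorem torsionTrace_normal (h : IsNormalAt K.g ψ y) (l : Fin m) :
    K.torsionTrace s ψ y l =
      ∑ j, ∑ k, comp3 (K.torsion ψ) l j k y * gram (K.potential s ψ) y j k := by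
  simp [torsionTrace, h.gram_inv_eq, Matrix.one_apply]

/-- The product rule gives a term with `∂H - ∂f · H` contracted with `b`, which is zero by weighted
coclosedness, and a term `H · ∂b`, which is the multiple of `|H|²` above. -/
theorem IsSteadySoliton.sum_pd_torsionTrace (hf : K.IsSteadySoliton f) (hs : s * s = 1)
    (hU : ∀ x, IsUnit (K.I.toEnd x + s • K.J.toEnd x)) (h : IsNormalAt K.g ψ y) :
    ∑ l, pd l (fun z => Real.exp (-(f ∘ ψ.symm) z) * K.torsionTrace s ψ z l) y =
      Real.exp (-(f ∘ ψ.symm) y) * ((1 / 3 : ℝ) * ∑ l, ∑ j, ∑ k,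
        comp3 (K.torsion ψ) l j k y ^ 2) := by
  have hu := contDiffAt_comp_symm hf.1 h.mem_charts h.mem_target
  have he := ContDiffAt.diff hu.neg.exp
  have ht := fun l => ContDiffAt.diff ((isCovectorField_torsionTrace hU).contDiffAt ψ
    h.mem_charts y h.mem_target l)
  rw [← sum_comp3_mul_pd hs hU h, Finset.mul_sum]
  -- The weighted coclosedness paired with `b`; this zero is added to the right-hand side so that
  -- both sides agree term by term.
  have h0 : ∑ l, ∑ j, ∑ k, (pd l (comp3 (K.torsion ψ) l j k) y
      - pd l (f ∘ ψ.symm) y * comp3 (K.torsion ψ) l j k y) * gram (K.potential s ψ) y j k = 0 := by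
    rw [Finset.sum_comm]
    refine Finset.sum_eq_zero fun j _ => ?_
    rw [Finset.sum_comm]
    refine Finset.sum_eq_zero fun k _ => ?_
    rw [← Finset.sum_mul, hf.sum_pd_comp3 h, zero_mul]
  rw [← add_zero (∑ l, Real.exp (-(f ∘ ψ.symm) y) * _), ← mul_zero (Real.exp (-(f ∘ ψ.symm) y)),
    ← h0, Finset.mul_sum, ← Finset.sum_add_distrib]
  refine Finset.sum_congr rfl fun l _ => ?_
  rw [pd_mul l he (ht l), pd_exp_neg (ContDiffAt.diff hu), pd_torsionTrace hU h,
    torsionTrace_normal h]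
  simp only [Finset.mul_sum, ← Finset.sum_add_distrib]
  exact Finset.sum_congr rfl fun j _ => Finset.sum_congr rfl fun k _ => by ring

/-- The weighted contraction of `H` with `b` has nonnegative divergence, hence none; what remains is
a sum of squares times a positive factor. -/
theorem IsSteadySoliton.comp3_eq_zero [T2Space M] [CompactSpace M] (hf : K.IsSteadySoliton f)
    (hs : s * s = 1) (hU : ∀ x, IsUnit (K.I.toEnd x + s • K.J.toEnd x)) (h : IsNormalAt K.g ψ y)
    (l j k : Fin m) : comp3 (K.torsion ψ) l j k y = 0 := by
  have hα := (isCovectorField_torsionTrace hU).smul (IsScalarField.of_contMDiff hf.1).exp_neg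
  have h1 := hα.sum_pd_eq_zero (g := K.g) (fun χ z hz => by
    rw [hf.sum_pd_torsionTrace hs hU hz]
    positivity) h
  rw [hf.sum_pd_torsionTrace hs hU h] at h1
  have h2 : ∑ l, ∑ j, ∑ k, comp3 (K.torsion ψ) l j k y ^ 2 = 0 := by
    simpa [(Real.exp_pos _).ne'] using h1
  have h3 : ∀ l j k, 0 ≤ comp3 (K.torsion ψ) l j k y ^ 2 := fun l j k => sq_nonneg _
  rw [Finset.sum_eq_zero_iff_of_nonneg fun l _ => Finset.sum_nonneg fun j _ =>
    Finset.sum_nonneg fun k _ => h3 l j k] at h2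
  have h4 := h2 l (Finset.mem_univ l)
  rw [Finset.sum_eq_zero_iff_of_nonneg fun j _ => Finset.sum_nonneg fun k _ => h3 l j k] at h4
  have h5 := h4 j (Finset.mem_univ j)
  rw [Finset.sum_eq_zero_iff_of_nonneg fun k _ => h3 l j k] at h5
  exact pow_eq_zero_iff two_ne_zero |>.1 (h5 k (Finset.mem_univ k))

theorem IsSteadySoliton.torsionFree [T2Space M] [CompactSpace M] (hf : K.IsSteadySoliton f)
    (hs : s * s = 1) (hU : ∀ x, IsUnit (K.I.toEnd x + s • K.J.toEnd x)) : K.TorsionFree := by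
  intro φ hφ y hy
  obtain ⟨ψ, z, hn, hz⟩ := exists_isNormalAt K.g hφ hy
  have hy' : φ.symm y ∈ ψ.source := hz ▸ ψ.map_target hn.mem_target
  have hyz : transition ψ φ y = z := by
    unfold transition
    rw [← hz, ψ.right_inv hn.mem_target]
  have h0 : K.torsion ψ z = 0 := by
    apply ContinuousAlternatingMap.toAlternatingMap_injective
    refine Module.Basis.ext_alternating (EuclideanSpace.basisFun (Fin m) ℝ).toBasis fun v _ => ?_
    have h1 := hf.comp3_eq_zero hs hU hn (v 0) (v 1) (v 2)
    have h2 : (fun i => (EuclideanSpace.basisFun (Fin m) ℝ).toBasis (v i)) =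
        ![e (v 0), e (v 1), e (v 2)] := by
      funext i
      fin_cases i <;> simp [e]
    rw [h2]
    exact h1
  ext v
  have h1 := dcFundamental_transition K.compatible_I hn.mem_charts hφ hy hy' v
  rw [hyz] at h1
  refine h1.trans ?_
  change K.torsion ψ z _ = _
  rw [h0]
  rfl

/-- The two alternatives differ by replacing `J` with `-J`; the sign `s` covers both. -/
theorem SymplecticType.exists_sign (hK : K.SymplecticType) :
    ∃ s : ℝ, s * s = 1 ∧ ∀ x, IsUnit (K.I.toEnd x + s • K.J.toEnd x) := by
  rcases hK with h | h
  · exact ⟨1, by norm_num, fun x => by simpa using h x⟩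
  · exact ⟨-1, by norm_num, fun x => by simpa [sub_eq_add_neg] using h x⟩

end GKStructure

end TorsionVanishing

/-! ### Rules for second partial derivatives -/

section SecondDerivatives

variable {m : ℕ} {y : Coord m} {u v : Coord m → ℝ}

theorem pd_pd_add (p q : Fin m) (hu : ContDiffAt ℝ ∞ u y) (hv : ContDiffAt ℝ ∞ v y) :
    pd p (pd q (fun z => u z + v z)) y = pd p (pd q u) y + pd p (pd q v) y := by
  have h1 : pd q (fun z => u z + v z) =ᶠ[𝓝 y] fun z => pd q u z + pd q v z := by
    filter_upwards [ContDiffAt.eventually_diff hu, ContDiffAt.eventually_diff hv] with z h h'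
      using pd_add q h h'
  rw [pd_congr h1, pd_add p (ContDiffAt.diff (contDiffAt_pd q hu))
    (ContDiffAt.diff (contDiffAt_pd q hv))]

theorem pd_pd_sub (p q : Fin m) (hu : ContDiffAt ℝ ∞ u y) (hv : ContDiffAt ℝ ∞ v y) :
    pd p (pd q (fun z => u z - v z)) y = pd p (pd q u) y - pd p (pd q v) y := by
  have h1 : pd q (fun z => u z - v z) =ᶠ[𝓝 y] fun z => pd q u z - pd q v z := by
    filter_upwards [ContDiffAt.eventually_diff hu, ContDiffAt.eventually_diff hv] with z h h'
      using pd_sub q h h'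
  rw [pd_congr h1, pd_sub p (ContDiffAt.diff (contDiffAt_pd q hu))
    (ContDiffAt.diff (contDiffAt_pd q hv))]

theorem pd_pd_const_mul (p q : Fin m) (c : ℝ) (hu : ContDiffAt ℝ ∞ u y) :
    pd p (pd q (fun z => c * u z)) y = c * pd p (pd q u) y := by
  have h1 : pd q (fun z => c * u z) =ᶠ[𝓝 y] fun z => c * pd q u z := by
    filter_upwards [ContDiffAt.eventually_diff hu] with z h using pd_const_mul q c h
  rw [pd_congr h1, pd_const_mul p c (ContDiffAt.diff (contDiffAt_pd q hu))]

theorem pd_pd_sum (p q : Fin m) {ι : Type*} (s : Finset ι) {f : ι → Coord m → ℝ}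
    (hf : ∀ k ∈ s, ContDiffAt ℝ ∞ (f k) y) :
    pd p (pd q (fun z => ∑ k ∈ s, f k z)) y = ∑ k ∈ s, pd p (pd q (f k)) y := by
  have h1 : pd q (fun z => ∑ k ∈ s, f k z) =ᶠ[𝓝 y] fun z => ∑ k ∈ s, pd q (f k) z := by
    have h2 : ∀ᶠ z in 𝓝 y, ∀ k ∈ s, DifferentiableAt ℝ (f k) z :=
      (Filter.eventually_all_finset s).2 fun k hk => ContDiffAt.eventually_diff (hf k hk)
    filter_upwards [h2] with z h using pd_sum q s h
  rw [pd_congr h1, pd_sum p s fun k hk => ContDiffAt.diff (contDiffAt_pd q (hf k hk))]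

theorem pd_pd_mul (p q : Fin m) (hu : ContDiffAt ℝ ∞ u y) (hv : ContDiffAt ℝ ∞ v y) :
    pd p (pd q (fun z => u z * v z)) y = pd p (pd q u) y * v y + pd q u y * pd p v y
      + (pd p u y * pd q v y + u y * pd p (pd q v) y) := by
  have h1 : pd q (fun z => u z * v z) =ᶠ[𝓝 y] fun z => pd q u z * v z + u z * pd q v z := by
    filter_upwards [ContDiffAt.eventually_diff hu, ContDiffAt.eventually_diff hv] with z h h'
      using pd_mul q h h'
  have du := ContDiffAt.diff hu
  have dv := ContDiffAt.diff hv
  have du' := ContDiffAt.diff (contDiffAt_pd q hu)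
  have dv' := ContDiffAt.diff (contDiffAt_pd q hv)
  rw [pd_congr h1, pd_add p (du'.fun_mul dv) (du.fun_mul dv'), pd_mul p du' dv, pd_mul p du dv']

end SecondDerivatives

/-! ### Christoffel symbols, Ricci tensor and Hessian at a normal centre -/

section Curvature

variable {m : ℕ} {M : Type*} [TopologicalSpace M] [ChartedSpace (Coord m) M]
  [IsManifold 𝓘(ℝ, Coord m) ∞ M] {φ ψ : OpenPartialHomeomorph M (Coord m)} {y : Coord m}
  {g : Metric m M}

theorem gram_symm (i j : Fin m) (z : Coord m) :
    gram (metricInChart g φ) z i j = gram (metricInChart g φ) z j i :=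
  metricInChart_symm g (e i) (e j)

theorem contDiffAt_christoffel (hφ : φ ∈ charts m M) (hy : y ∈ φ.target) (k i j : Fin m) :
    ContDiffAt ℝ ∞ (christoffel (metricInChart g φ) k i j) y := by
  have hg := fun i j => contDiffAt_gram g hφ hy i j
  exact contDiffAt_const.mul (ContDiffAt.sum fun l _ => (contDiffAt_gram_inv g hφ hy k l).mul
    (((contDiffAt_pd i (hg j l)).add (contDiffAt_pd j (hg i l))).sub (contDiffAt_pd l (hg i j))))

theorem IsNormalAt.pd_christoffel (h : IsNormalAt g ψ y) (p k i j : Fin m) :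
    pd p (christoffel (metricInChart g ψ) k i j) y =
      (1 / 2 : ℝ) * (pd p (pd i (fun z => gram (metricInChart g ψ) z j k)) y
        + pd p (pd j (fun z => gram (metricInChart g ψ) z i k)) y
        - pd p (pd k (fun z => gram (metricInChart g ψ) z i j)) y) := by
  have hg := fun p i j => ContDiffAt.diff
    (contDiffAt_pd p (contDiffAt_gram g h.mem_charts h.mem_target i j))
  have hi := fun i j => ContDiffAt.diff (contDiffAt_gram_inv g h.mem_charts h.mem_target i j)
  have hL := fun l => ((hg i j l).fun_add (hg j i l)).fun_sub (hg l i j)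
  unfold christoffel
  rw [pd_const_mul p _ (DifferentiableAt.fun_sum fun l _ => (hi k l).fun_mul (hL l)),
    pd_sum p _ fun l _ => (hi k l).fun_mul (hL l)]
  have h1 : ∀ l, pd p (fun z => (gram (metricInChart g ψ) z)⁻¹ k l *
      (pd i (fun z => gram (metricInChart g ψ) z j l) z
        + pd j (fun z => gram (metricInChart g ψ) z i l) z
        - pd l (fun z => gram (metricInChart g ψ) z i j) z)) y = if k = l then
      pd p (pd i (fun z => gram (metricInChart g ψ) z j l)) y
        + pd p (pd j (fun z => gram (metricInChart g ψ) z i l)) y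
        - pd p (pd l (fun z => gram (metricInChart g ψ) z i j)) y else 0 := by
    intro l
    rw [pd_mul p (hi k l) (hL l), pd_sub p ((hg i j l).fun_add (hg j i l)) (hg l i j),
      pd_add p (hg i j l) (hg j i l), h.pd_gram_inv, h.gram_inv_eq, Matrix.one_apply]
    simp
  simp [h1]

/-- No correction terms appear: `∂g⁻¹ = 0` kills the mixed products, and `∂²g⁻¹` multiplies first
derivatives of the metric, which vanish. -/
theorem IsNormalAt.pd_pd_christoffel (h : IsNormalAt g ψ y) (q p k i j : Fin m) :
    pd q (pd p (christoffel (metricInChart g ψ) k i j)) y =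
      (1 / 2 : ℝ) * (pd q (pd p (pd i (fun z => gram (metricInChart g ψ) z j k))) y
        + pd q (pd p (pd j (fun z => gram (metricInChart g ψ) z i k))) y
        - pd q (pd p (pd k (fun z => gram (metricInChart g ψ) z i j))) y) := by
  have hg := fun p i j => contDiffAt_pd p (contDiffAt_gram g h.mem_charts h.mem_target i j)
  have hi := fun i j => contDiffAt_gram_inv g h.mem_charts h.mem_target i j
  have hL := fun l => ((hg i j l).add (hg j i l)).sub (hg l i j)
  unfold christoffel
  rw [pd_pd_const_mul q p _ (ContDiffAt.sum fun l _ => (hi k l).mul (hL l)),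
    pd_pd_sum q p _ fun l _ => (hi k l).mul (hL l)]
  have h1 : ∀ l, pd q (pd p (fun z => (gram (metricInChart g ψ) z)⁻¹ k l *
      (pd i (fun z => gram (metricInChart g ψ) z j l) z
        + pd j (fun z => gram (metricInChart g ψ) z i l) z
        - pd l (fun z => gram (metricInChart g ψ) z i j) z))) y = if k = l then
      pd q (pd p (pd i (fun z => gram (metricInChart g ψ) z j l))) y
        + pd q (pd p (pd j (fun z => gram (metricInChart g ψ) z i l))) y
        - pd q (pd p (pd l (fun z => gram (metricInChart g ψ) z i j))) y else 0 := by
    intro l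
    rw [pd_pd_mul q p (hi k l) (hL l), pd_pd_sub q p ((hg i j l).add (hg j i l)) (hg l i j),
      pd_pd_add q p (hg i j l) (hg j i l), h.pd_gram_inv, h.pd_gram_inv, h.gram_inv_eq,
      Matrix.one_apply]
    simp [h.pd_gram]
  simp [h1]

theorem IsNormalAt.ricci_eq (h : IsNormalAt g ψ y) (i j : Fin m) :
    ricci (metricInChart g ψ) i j y =
      ∑ k, (pd k (christoffel (metricInChart g ψ) k i j) y
        - pd i (christoffel (metricInChart g ψ) k k j) y) := by
  simp [ricci, h.christoffel_eq]

/-- The quadratic terms in the Christoffel symbols vanish to second order at the centre, so they do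
not contribute. -/
theorem IsNormalAt.pd_ricci (h : IsNormalAt g ψ y) (p i j : Fin m) :
    pd p (ricci (metricInChart g ψ) i j) y =
      ∑ k, (pd p (pd k (christoffel (metricInChart g ψ) k i j)) y
        - pd p (pd i (christoffel (metricInChart g ψ) k k j)) y) := by
  have hC := fun k i j => contDiffAt_christoffel (g := g) h.mem_charts h.mem_target k i j
  have hd := fun k i j => ContDiffAt.diff (hC k i j)
  have hd' := fun p k i j => ContDiffAt.diff (contDiffAt_pd p (hC k i j))
  have h1 := fun k => (hd' k k i j).fun_sub (hd' i k k j)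
  have h2 := fun k l => ((hd k k l).fun_mul (hd l i j)).fun_sub ((hd k i l).fun_mul (hd l k j))
  have h3 := fun k => DifferentiableAt.fun_sum (u := Finset.univ) fun l _ => h2 k l
  unfold ricci
  rw [pd_add p (DifferentiableAt.fun_sum fun k _ => h1 k)
    (DifferentiableAt.fun_sum fun k _ => h3 k), pd_sum p _ fun k _ => h1 k,
    pd_sum p _ fun k _ => h3 k]
  have h4 : ∀ k, pd p (fun z => ∑ l, (christoffel (metricInChart g ψ) k k l z *
      christoffel (metricInChart g ψ) l i j z - christoffel (metricInChart g ψ) k i l z *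
      christoffel (metricInChart g ψ) l k j z)) y = 0 := by
    intro k
    rw [pd_sum p _ fun l _ => h2 k l]
    refine Finset.sum_eq_zero fun l _ => ?_
    rw [pd_sub p ((hd k k l).fun_mul (hd l i j)) ((hd k i l).fun_mul (hd l k j)),
      pd_mul p (hd k k l) (hd l i j), pd_mul p (hd k i l) (hd l k j)]
    simp [h.christoffel_eq]
  simp only [h4, Finset.sum_const_zero, add_zero]
  exact Finset.sum_congr rfl fun k _ => pd_sub p (hd' k k i j) (hd' i k k j)

theorem IsNormalAt.hessian_eq (h : IsNormalAt g ψ y) (u : Coord m → ℝ) (i j : Fin m) :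
    hessian (metricInChart g ψ) u i j y = pd i (pd j u) y := by
  simp [hessian, h.christoffel_eq]

theorem IsNormalAt.pd_hessian (h : IsNormalAt g ψ y) {u : Coord m → ℝ} (hu : ContDiffAt ℝ ∞ u y)
    (p i j : Fin m) :
    pd p (hessian (metricInChart g ψ) u i j) y = pd p (pd i (pd j u)) y
      - ∑ k, pd p (christoffel (metricInChart g ψ) k i j) y * pd k u y := by
  have hd := fun k => ContDiffAt.diff
    (contDiffAt_christoffel (g := g) h.mem_charts h.mem_target k i j)
  have hu' := fun k => ContDiffAt.diff (contDiffAt_pd k hu)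
  unfold hessian
  rw [pd_sub p (ContDiffAt.diff (contDiffAt_pd i (contDiffAt_pd j hu)))
    (DifferentiableAt.fun_sum fun k _ => (hd k).fun_mul (hu' k)),
    pd_sum p _ fun k _ => (hd k).fun_mul (hu' k)]
  congr 1
  refine Finset.sum_congr rfl fun k _ => ?_
  rw [pd_mul p (hd k) (hu' k), h.christoffel_eq]
  ring

end Curvature

/-! ### The contracted Bianchi identity and the Bochner formula as algebra -/

section Bianchi

variable {m : ℕ}

/-- The contracted Bianchi identity, in terms of the third derivatives `t` of the metric at the
centre of a normal chart. -/
theorem contracted_bianchi (t : Fin m → Fin m → Fin m → Fin m → Fin m → ℝ)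
    (h12 : ∀ p q r i j, t p q r i j = t q p r i j) (h23 : ∀ p q r i j, t p q r i j = t p r q i j)
    (h45 : ∀ p q r i j, t p q r i j = t p q r j i) (l : Fin m) :
    2 * ∑ i, ∑ k, ((1 / 2 : ℝ) * (t i k i l k + t i k l i k - t i k k i l)
        - (1 / 2 : ℝ) * (t i i k l k + t i i l k k - t i i k k l))
      = ∑ i, ∑ k, ((1 / 2 : ℝ) * (t l k i i k + t l k i i k - t l k k i i)
        - (1 / 2 : ℝ) * (t l i k i k + t l i i k k - t l i k k i)) := by
  -- The discrepancy between the two sides is this sum, antisymmetric under exchange of `i` and `k`.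
  have h1 : ∑ i, ∑ k, ((t i k i l k - (1 / 2 : ℝ) * t i i l k k)
      - (t k i k l i - (1 / 2 : ℝ) * t k k l i i)) = 0 := by
    simp only [Finset.sum_sub_distrib]
    rw [Finset.sum_comm (f := fun i k => t k i k l i),
      Finset.sum_comm (f := fun i k => (1 / 2 : ℝ) * t k k l i i)]
    ring
  rw [← sub_eq_zero, ← h1, Finset.mul_sum, ← Finset.sum_sub_distrib]
  refine Finset.sum_congr rfl fun i _ => ?_
  rw [Finset.mul_sum, ← Finset.sum_sub_distrib]
  refine Finset.sum_congr rfl fun k _ => ?_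
  have e1 : t k i k l i = t i k k i l := by rw [h12, h45]
  have e2 : t i k l i k = t l k i i k := by rw [h23, h12, h23]
  have e3 : t i i k l k = t i i k k l := h45 _ _ _ _ _
  have e4 : t k k l i i = t l k k i i := by rw [h23, h12]
  have e5 : t i i l k k = t l i i k k := by rw [h23, h12]
  have e6 : t l i k i k = t l i k k i := h45 _ _ _ _ _
  rw [e1, e2, e3, e4, e5, e6]
  ring

/-- The Bochner formula for the potential of a steady soliton at the centre of a normal chart, in
terms of the second and third derivatives `a`, `t` of the metric. -/
theorem bochner_identity (a : Fin m → Fin m → Fin m → Fin m → ℝ)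
    (t : Fin m → Fin m → Fin m → Fin m → Fin m → ℝ) (f₁ : Fin m → ℝ) (f₂ : Fin m → Fin m → ℝ)
    (f₃ : Fin m → Fin m → Fin m → ℝ) (D : Fin m → Fin m → Fin m → Fin m → ℝ)
    (ha : ∀ p q i j, a p q i j = a q p i j) (ha' : ∀ p q i j, a p q i j = a p q j i)
    (h12 : ∀ p q r i j, t p q r i j = t q p r i j) (h23 : ∀ p q r i j, t p q r i j = t p r q i j)
    (h45 : ∀ p q r i j, t p q r i j = t p q r j i)
    (hf : ∀ l i, f₃ l i i = f₃ i i l)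
    (hD : ∀ p k i j, D p k i j = (1 / 2 : ℝ) * (a p i j k + a p j i k - a p k i j))
    (hE : ∀ i j, ∑ k, (D k k i j - D i k k j) + f₂ i j = 0)
    (hE' : ∀ p i j, ∑ k, ((1 / 2 : ℝ) * (t p k i j k + t p k j i k - t p k k i j)
        - (1 / 2 : ℝ) * (t p i k j k + t p i j k k - t p i k k j))
      + (f₃ p i j - ∑ k, D p k i j * f₁ k) = 0) :
    ∑ i, ∑ k, ∑ l, -a i i k l * f₁ k * f₁ l + 2 * ∑ i, ∑ k, f₁ k * f₃ i i k =
      2 * ∑ k, ∑ l, f₂ k l * f₁ k * f₁ l := by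
  -- Twice the divergence of the soliton equation minus the gradient of its trace: the contracted
  -- Bianchi identity removes the third derivatives of the metric, and of `f₃` the combination `2 f₃
  -- i i l - f₃ l i i = f₃ i i l` remains.
  have h1 : ∀ l, ∑ i, f₃ i i l = ∑ i, ∑ k, (2 * D i k i l - D l k i i) * f₁ k := by
    intro l
    have e1 : ∑ i, (2 * (∑ k, ((1 / 2 : ℝ) * (t i k i l k + t i k l i k - t i k k i l)
        - (1 / 2 : ℝ) * (t i i k l k + t i i l k k - t i i k k l))
      + (f₃ i i l - ∑ k, D i k i l * f₁ k))
      - (∑ k, ((1 / 2 : ℝ) * (t l k i i k + t l k i i k - t l k k i i)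
        - (1 / 2 : ℝ) * (t l i k i k + t l i i k k - t l i k k i))
      + (f₃ l i i - ∑ k, D l k i i * f₁ k))) = 0 :=
      Finset.sum_eq_zero fun i _ => by rw [hE', hE']; ring
    have e2 := contracted_bianchi t h12 h23 h45 l
    rw [Finset.sum_sub_distrib, ← Finset.mul_sum, Finset.sum_add_distrib, Finset.sum_add_distrib,
      mul_add, e2, Finset.sum_sub_distrib, Finset.sum_sub_distrib] at e1
    simp only [hf l] at e1
    simp only [sub_mul, mul_assoc, Finset.sum_sub_distrib, ← Finset.mul_sum]
    linarith
  have h2 : ∑ i, ∑ k, f₁ k * f₃ i i k =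
      ∑ i, ∑ k, ∑ l, (2 * D i k i l - D l k i i) * f₁ k * f₁ l := by
    rw [Finset.sum_comm]
    simp only [← Finset.mul_sum, h1]
    simp only [Finset.mul_sum]
    rw [Finset.sum_comm]
    refine Finset.sum_congr rfl fun i _ => ?_
    rw [Finset.sum_comm]
    exact Finset.sum_congr rfl fun k _ => Finset.sum_congr rfl fun l _ => by ring
  -- The Hessian is replaced by minus the Ricci tensor, so that both sides are expressed in second
  -- derivatives of the metric.
  have h3 : ∑ k, ∑ l, f₂ k l * f₁ k * f₁ l =
      ∑ i, ∑ k, ∑ l, -(D i i k l - D k i i l) * f₁ k * f₁ l := by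
    symm
    rw [Finset.sum_comm]
    refine Finset.sum_congr rfl fun k _ => ?_
    rw [Finset.sum_comm]
    refine Finset.sum_congr rfl fun l _ => ?_
    symm
    rw [eq_neg_of_add_eq_zero_right (hE k l), ← Finset.sum_neg_distrib, Finset.sum_mul,
      Finset.sum_mul]
  rw [h2, h3, ← sub_eq_zero, Finset.mul_sum, Finset.mul_sum, ← Finset.sum_add_distrib,
    ← Finset.sum_sub_distrib]
  refine Finset.sum_eq_zero fun i _ => ?_
  -- The remaining difference is antisymmetric in `k, l` and is contracted with the symmetric `f₁ k
  -- * f₁ l`.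
  have h4 : ∑ k, ∑ l, (a i l i k - a i k i l) * f₁ k * f₁ l = 0 := by
    simp only [sub_mul, Finset.sum_sub_distrib]
    rw [sub_eq_zero, Finset.sum_comm]
    exact Finset.sum_congr rfl fun k _ => Finset.sum_congr rfl fun l _ => by ring
  rw [← h4]
  simp only [Finset.mul_sum, ← Finset.sum_add_distrib, ← Finset.sum_sub_distrib]
  refine Finset.sum_congr rfl fun k _ => Finset.sum_congr rfl fun l _ => ?_
  simp only [hD]
  have e1 : a i i l k = a i i k l := ha' _ _ _ _
  have e2 : a l i i k = a i l i k := ha _ _ _ _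
  have e3 : a l k i i = a k l i i := ha _ _ _ _
  have e4 : a i k l i = a i k i l := ha' _ _ _ _
  have e5 : a i l k i = a i l i k := ha' _ _ _ _
  have e6 : a k i l i = a k i i l := ha' _ _ _ _
  rw [e1, e2, e3, e4, e5, e6]
  ring

end Bianchi

/-! ### Compact steady gradient Ricci solitons are trivial -/

section RicciSoliton

variable {m : ℕ} {M : Type*} [TopologicalSpace M] [ChartedSpace (Coord m) M]
  [IsManifold 𝓘(ℝ, Coord m) ∞ M] {φ ψ : OpenPartialHomeomorph M (Coord m)} {y : Coord m}
  {g : Metric m M} {f : M → ℝ}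

/-- The coordinate expression of `|∇f|²`. -/
def gradNormSq (g : Metric m M) (f : M → ℝ) : OpenPartialHomeomorph M (Coord m) → Coord m → ℝ :=
  covectorNormSq g fun φ y i => pd i (f ∘ φ.symm) y

theorem IsNormalAt.pd_gradNormSq (h : IsNormalAt g ψ y)
    (hf : ContMDiff 𝓘(ℝ, Coord m) 𝓘(ℝ, ℝ) ∞ f) (i : Fin m) :
    pd i (gradNormSq g f ψ) y =
      2 * ∑ k, pd k (f ∘ ψ.symm) y * pd i (pd k (f ∘ ψ.symm)) y := by
  have hg := fun k l => ContDiffAt.diff (contDiffAt_gram_inv g h.mem_charts h.mem_target k l)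
  have hu := fun k => ContDiffAt.diff
    (contDiffAt_pd k (contDiffAt_comp_symm hf h.mem_charts h.mem_target))
  have h1 := fun k l => ((hg k l).fun_mul (hu k)).fun_mul (hu l)
  unfold gradNormSq covectorNormSq
  rw [pd_sum i _ fun k _ => DifferentiableAt.fun_sum fun l _ => h1 k l, Finset.mul_sum]
  refine Finset.sum_congr rfl fun k _ => ?_
  rw [pd_sum i _ fun l _ => h1 k l]
  simp only [pd_mul i ((hg _ _).fun_mul (hu _)) (hu _), pd_mul i (hg _ _) (hu _), h.pd_gram_inv,
    h.gram_inv_eq, Matrix.one_apply]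
  simp only [zero_mul, zero_add, ite_mul, one_mul, Finset.sum_add_distrib, Finset.sum_ite_eq,
    Finset.mem_univ, if_true]
  ring

/-- The term in second derivatives of the metric comes from `∂²g⁻¹ = -∂²g`; it is part of what the
Bochner formula turns into curvature. -/
theorem IsNormalAt.pd_pd_gradNormSq (h : IsNormalAt g ψ y)
    (hf : ContMDiff 𝓘(ℝ, Coord m) 𝓘(ℝ, ℝ) ∞ f) (i : Fin m) :
    pd i (pd i (gradNormSq g f ψ)) y =
      ∑ k, ∑ l, -pd i (pd i (fun z => gram (metricInChart g ψ) z k l)) y * pd k (f ∘ ψ.symm) y *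
        pd l (f ∘ ψ.symm) y
      + 2 * ∑ k, pd k (f ∘ ψ.symm) y * pd i (pd i (pd k (f ∘ ψ.symm))) y
      + 2 * ∑ k, pd i (pd k (f ∘ ψ.symm)) y ^ 2 := by
  have hg := fun k l => contDiffAt_gram_inv g h.mem_charts h.mem_target k l
  have hu := fun k => contDiffAt_pd k (contDiffAt_comp_symm hf h.mem_charts h.mem_target)
  have h1 := fun k l => ((hg k l).mul (hu k)).mul (hu l)
  unfold gradNormSq covectorNormSq
  rw [pd_pd_sum i i _ fun k _ => ContDiffAt.sum fun l _ => h1 k l, Finset.mul_sum, Finset.mul_sum,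
    ← Finset.sum_add_distrib, ← Finset.sum_add_distrib]
  refine Finset.sum_congr rfl fun k _ => ?_
  rw [pd_pd_sum i i _ fun l _ => h1 k l]
  simp only [pd_pd_mul i i ((hg _ _).mul (hu _)) (hu _), pd_pd_mul i i (hg _ _) (hu _),
    pd_mul i (ContDiffAt.diff (hg _ _)) (ContDiffAt.diff (hu _)), h.pd_pd_gram_inv, h.pd_gram_inv,
    h.gram_inv_eq, Matrix.one_apply]
  simp only [zero_mul, zero_add, add_zero, ite_mul, one_mul, add_mul, Finset.sum_add_distrib,
    Finset.sum_ite_eq, Finset.mem_univ, if_true]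
  ring

/-- `f` is the potential of a steady gradient Ricci soliton. -/
def IsRicciSoliton (g : Metric m M) (f : M → ℝ) : Prop :=
  ∀ φ ∈ charts m M, ∀ y ∈ φ.target, ∀ i j,
    ricci (metricInChart g φ) i j y + hessian (metricInChart g φ) (f ∘ φ.symm) i j y = 0

theorem contDiffAt_ricci (hφ : φ ∈ charts m M) (hy : y ∈ φ.target) (i j : Fin m) :
    ContDiffAt ℝ ∞ (ricci (metricInChart g φ) i j) y := by
  have hC := fun k i j => contDiffAt_christoffel (g := g) hφ hy k i j
  exact (ContDiffAt.sum fun k _ => (contDiffAt_pd k (hC k i j)).sub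
    (contDiffAt_pd i (hC k k j))).add (ContDiffAt.sum fun k _ => ContDiffAt.sum fun l _ =>
    ((hC k k l).mul (hC l i j)).sub ((hC k i l).mul (hC l k j)))

theorem contDiffAt_hessian (hφ : φ ∈ charts m M) (hy : y ∈ φ.target) {u : Coord m → ℝ}
    (hu : ContDiffAt ℝ ∞ u y) (i j : Fin m) :
    ContDiffAt ℝ ∞ (hessian (metricInChart g φ) u i j) y :=
  (contDiffAt_pd i (contDiffAt_pd j hu)).sub (ContDiffAt.sum fun k _ =>
    (contDiffAt_christoffel hφ hy k i j).mul (contDiffAt_pd k hu))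

/-- The Bochner formula `Δ|∇f|² = ⟨∇f, ∇|∇f|²⟩ + 2|∇²f|²`: `bochner_identity` handles every term
except the square of the Hessian. -/
theorem IsRicciSoliton.sum_pd_pd_gradNormSq (hs : IsRicciSoliton g f)
    (hf : ContMDiff 𝓘(ℝ, Coord m) 𝓘(ℝ, ℝ) ∞ f) (h : IsNormalAt g ψ y) :
    ∑ i, pd i (pd i (gradNormSq g f ψ)) y = ∑ i, pd i (f ∘ ψ.symm) y * pd i (gradNormSq g f ψ) y
      + 2 * ∑ i, ∑ k, pd i (pd k (f ∘ ψ.symm)) y ^ 2 := by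
  have hψ := h.mem_charts
  have hy := h.mem_target
  have hu := contDiffAt_comp_symm hf hψ hy
  have hg := fun i j => contDiffAt_gram g hψ hy i j
  have hsymm : ∀ i j, (fun z => gram (metricInChart g ψ) z i j) =
      fun z => gram (metricInChart g ψ) z j i := fun i j => funext fun z => gram_symm i j z
  have key := bochner_identity
    (fun p q i j => pd p (pd q (fun z => gram (metricInChart g ψ) z i j)) y)
    (fun p q r i j => pd p (pd q (pd r (fun z => gram (metricInChart g ψ) z i j))) y)
    (fun i => pd i (f ∘ ψ.symm) y) (fun i j => pd i (pd j (f ∘ ψ.symm)) y)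
    (fun p i j => pd p (pd i (pd j (f ∘ ψ.symm))) y)
    (fun p k i j => pd p (christoffel (metricInChart g ψ) k i j) y)
    (fun p q i j => pd_comm p q (hg i j)) (fun p q i j => by simp only [hsymm i j])
    (fun p q r i j => pd_comm p q (contDiffAt_pd r (hg i j)))
    (fun p q r i j => pd_pd_comm p q r (hg i j))
    (fun p q r i j => by simp only [hsymm i j])
    (fun l i => by
      rw [pd_comm l i (contDiffAt_pd i hu)]
      exact pd_pd_comm i l i hu)
    (fun p k i j => h.pd_christoffel p k i j)
    (fun i j => by
      have h1 := hs ψ hψ y hy i j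
      rwa [h.ricci_eq, h.hessian_eq] at h1)
    (fun p i j => by
      have h1 : (fun z => ricci (metricInChart g ψ) i j z
          + hessian (metricInChart g ψ) (f ∘ ψ.symm) i j z) =ᶠ[𝓝 y] fun _ => 0 := by
        filter_upwards [ψ.open_target.mem_nhds hy] with z hz using hs ψ hψ z hz i j
      have h2 := pd_congr (i := p) h1
      rw [pd_add p (ContDiffAt.diff (contDiffAt_ricci hψ hy i j))
        (ContDiffAt.diff (contDiffAt_hessian hψ hy hu i j)), pd_const, h.pd_ricci,
        h.pd_hessian hu] at h2
      simpa only [h.pd_pd_christoffel] using h2)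
  simp only [h.pd_pd_gradNormSq hf, h.pd_gradNormSq hf, Finset.sum_add_distrib, ← Finset.mul_sum]
  rw [key]
  congr 1
  rw [Finset.mul_sum]
  refine Finset.sum_congr rfl fun k _ => ?_
  simp only [Finset.mul_sum]
  exact Finset.sum_congr rfl fun l _ => by ring

variable [T2Space M] [CompactSpace M]

/-- The weight `exp (-f)` absorbs the drift term of the Bochner formula, so `exp (-f) ∇|∇f|²` has
divergence `2 exp (-f) |∇²f|² ≥ 0`. -/
theorem IsRicciSoliton.pd_pd_eq_zero (hs : IsRicciSoliton g f)
    (hf : ContMDiff 𝓘(ℝ, Coord m) 𝓘(ℝ, ℝ) ∞ f) (h : IsNormalAt g ψ y) (i k : Fin m) :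
    pd i (pd k (f ∘ ψ.symm)) y = 0 := by
  have hF := IsScalarField.of_contMDiff hf
  have hN : IsScalarField (gradNormSq g f) := hF.gradient.isScalarField_normSq g
  have hα := hN.gradient.smul hF.exp_neg
  have hdiv : ∀ ψ y, IsNormalAt g ψ y →
      ∑ l, pd l (fun z => Real.exp (-(f ∘ ψ.symm) z) * pd l (gradNormSq g f ψ) z) y =
      Real.exp (-(f ∘ ψ.symm) y) * (2 * ∑ i, ∑ k, pd i (pd k (f ∘ ψ.symm)) y ^ 2) := by
    intro ψ y h
    have hu := contDiffAt_comp_symm hf h.mem_charts h.mem_target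
    have h1 := fun l => ContDiffAt.diff (hN.gradient.contDiffAt ψ h.mem_charts y h.mem_target l)
    rw [← sub_eq_of_eq_add' (hs.sum_pd_pd_gradNormSq hf h), ← Finset.sum_sub_distrib,
      Finset.mul_sum]
    refine Finset.sum_congr rfl fun l _ => ?_
    rw [pd_mul l (ContDiffAt.diff hu.neg.exp) (h1 l), pd_exp_neg (ContDiffAt.diff hu)]
    ring
  have h1 := hα.sum_pd_eq_zero (g := g) (fun χ z hz => by
    rw [hdiv χ z hz]
    positivity) h
  rw [hdiv ψ y h] at h1
  have h2 : ∑ i, ∑ k, pd i (pd k (f ∘ ψ.symm)) y ^ 2 = 0 := by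
    simpa [(Real.exp_pos _).ne'] using h1
  rw [Finset.sum_eq_zero_iff_of_nonneg fun i _ => Finset.sum_nonneg fun k _ => sq_nonneg _] at h2
  have h3 := h2 i (Finset.mem_univ i)
  rw [Finset.sum_eq_zero_iff_of_nonneg fun k _ => sq_nonneg _] at h3
  exact pow_eq_zero_iff two_ne_zero |>.1 (h3 k (Finset.mem_univ k))

/-- Once the Hessian vanishes, `f∇f` has divergence `|∇f|² ≥ 0`. -/
theorem IsRicciSoliton.pd_eq_zero_of_isNormalAt (hs : IsRicciSoliton g f)
    (hf : ContMDiff 𝓘(ℝ, Coord m) 𝓘(ℝ, ℝ) ∞ f) (h : IsNormalAt g ψ y) (i : Fin m) :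
    pd i (f ∘ ψ.symm) y = 0 := by
  have hF := IsScalarField.of_contMDiff hf
  have hα := hF.gradient.smul hF
  have hdiv : ∀ ψ y, IsNormalAt g ψ y →
      ∑ l, pd l (fun z => (f ∘ ψ.symm) z * pd l (f ∘ ψ.symm) z) y =
      ∑ l, pd l (f ∘ ψ.symm) y ^ 2 := by
    intro ψ y h
    have hu := contDiffAt_comp_symm hf h.mem_charts h.mem_target
    refine Finset.sum_congr rfl fun l _ => ?_
    rw [pd_mul l (ContDiffAt.diff hu) (ContDiffAt.diff (contDiffAt_pd l hu)),
      hs.pd_pd_eq_zero hf h]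
    ring
  have h1 := hα.sum_pd_eq_zero (g := g) (fun χ z hz => by
    rw [hdiv χ z hz]
    positivity) h
  rw [hdiv ψ y h, Finset.sum_eq_zero_iff_of_nonneg fun k _ => sq_nonneg _] at h1
  exact pow_eq_zero_iff two_ne_zero |>.1 (h1 i (Finset.mem_univ i))

theorem IsRicciSoliton.pd_eq_zero (hs : IsRicciSoliton g f)
    (hf : ContMDiff 𝓘(ℝ, Coord m) 𝓘(ℝ, ℝ) ∞ f) (hφ : φ ∈ charts m M) (hy : y ∈ φ.target)
    (i : Fin m) : pd i (f ∘ φ.symm) y = 0 := by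
  obtain ⟨ψ, z, hn, hz⟩ := exists_isNormalAt g hφ hy
  have hy' : φ.symm y ∈ ψ.source := hz ▸ ψ.map_target hn.mem_target
  have hyz : transition ψ φ y = z := by
    unfold transition
    rw [← hz, ψ.right_inv hn.mem_target]
  have h1 := (IsScalarField.of_contMDiff hf).gradient.law ψ hn.mem_charts φ hφ y hy hy'
  have h2 := congrFun h1 i
  rw [hyz] at h2
  rw [h2]
  simp [Matrix.mulVec, dotProduct, hs.pd_eq_zero_of_isNormalAt hf hn]

theorem IsRicciSoliton.ricciFlat (hs : IsRicciSoliton g f)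
    (hf : ContMDiff 𝓘(ℝ, Coord m) 𝓘(ℝ, ℝ) ∞ f) : RicciFlat g := by
  intro φ hφ y hy i j
  have h1 := hs φ hφ y hy i j
  have h2 : pd j (f ∘ φ.symm) =ᶠ[𝓝 y] fun _ => 0 := by
    filter_upwards [φ.open_target.mem_nhds hy] with z hz using hs.pd_eq_zero hf hφ hz j
  have h3 : hessian (metricInChart g φ) (f ∘ φ.symm) i j y = 0 := by
    simp [hessian, hs.pd_eq_zero hf hφ hy, pd_congr h2, pd_const]
  rwa [h3, add_zero] at h1

/-- A zero gradient makes `f` constant on coordinate balls, hence locally constant; connectedness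
does the rest. -/
theorem IsRicciSoliton.exists_eq_const [ConnectedSpace M] (hs : IsRicciSoliton g f)
    (hf : ContMDiff 𝓘(ℝ, Coord m) 𝓘(ℝ, ℝ) ∞ f) : ∃ c : ℝ, ∀ x : M, f x = c := by
  have hloc : IsLocallyConstant f := by
    refine (IsLocallyConstant.iff_eventually_eq f).2 fun x => ?_
    set φ := chartAt (Coord m) x with hφ'
    have hφ : φ ∈ charts m M := IsManifold.chart_mem_maximalAtlas x
    have hx : x ∈ φ.source := mem_chart_source _ x
    obtain ⟨ε, hε, hb⟩ := Metric.isOpen_iff.1 φ.open_target (φ x) (φ.map_source hx)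
    have hz : ∀ z ∈ Metric.ball (φ x) ε, fderiv ℝ (f ∘ φ.symm) z = 0 := by
      intro z hz
      ext w
      rw [fderiv_apply_eq_sum]
      simp [hs.pd_eq_zero hf hφ (hb hz)]
    have hd : DifferentiableOn ℝ (f ∘ φ.symm) (Metric.ball (φ x) ε) := fun z hz =>
      (ContDiffAt.diff (contDiffAt_comp_symm hf hφ (hb hz))).differentiableWithinAt
    have hc : ContinuousAt φ x := φ.continuousAt hx
    filter_upwards [hc.preimage_mem_nhds (Metric.ball_mem_nhds _ hε),
      φ.open_source.mem_nhds hx] with x' h1 h2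
    have h3 := Metric.isOpen_ball.is_const_of_fderiv_eq_zero
      (convex_ball (φ x) ε).isPreconnected hd hz h1 (Metric.mem_ball_self hε)
    simpa only [Function.comp, φ.left_inv h2, φ.left_inv hx] using h3
  obtain ⟨x₀⟩ := (inferInstance : Nonempty M)
  exact ⟨f x₀, fun x => hloc.apply_eq_of_preconnectedSpace x x₀⟩

end RicciSoliton

/-! ### From vanishing torsion to the Kähler and Ricci-flat conclusions -/

namespace GKStructure

variable {m : ℕ} {M : Type*} [TopologicalSpace M] [ChartedSpace (Coord m) M]
  [IsManifold 𝓘(ℝ, Coord m) ∞ M] {K : GKStructure m M} {f : M → ℝ}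

theorem IsSteadySoliton.isRicciSoliton (hf : K.IsSteadySoliton f) (hH : K.TorsionFree) :
    IsRicciSoliton K.g f := by
  intro φ hφ y hy i j
  have h1 := (hf.2 φ hφ y hy i j).1
  have h2 : formSq (metricInChart K.g φ) (K.torsion φ) i j y = 0 := by
    simp [formSq, comp3, hH φ hφ y hy]
  rwa [h2, mul_zero, sub_zero] at h1

theorem TorsionFree.isKahler_I (hH : K.TorsionFree) : IsKahler K.g K.I :=
  ⟨K.integrable_I, K.compatible_I, fun φ hφ y hy =>
    extDeriv_fundamentalForm_eq_zero K.compatible_I hφ hy (hH φ hφ y hy)⟩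

theorem TorsionFree.isKahler_J (hH : K.TorsionFree) : IsKahler K.g K.J :=
  ⟨K.integrable_J, K.compatible_J, fun φ hφ y hy =>
    extDeriv_fundamentalForm_eq_zero K.compatible_J hφ hy
      (neg_eq_zero.1 ((K.dc_eq φ hφ y hy).symm.trans (hH φ hφ y hy)))⟩

end GKStructure

end GenKahler

end

theorem mainTheorem10 {m : ℕ} {M : Type*} [TopologicalSpace M] [T2Space M] [CompactSpace M]
    [ConnectedSpace M] [ChartedSpace (GenKahler.Coord m) M]
    [IsManifold 𝓘(ℝ, GenKahler.Coord m) ∞ M]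
    (K : GenKahler.GKStructure m M) (hK : K.SymplecticType)
    (f : M → ℝ) (hf : K.IsSteadySoliton f) :
    (∃ c : ℝ, ∀ x : M, f x = c) ∧
      GenKahler.IsKahler K.g K.I ∧ GenKahler.IsKahler K.g K.J ∧
      GenKahler.RicciFlat K.g ∧ K.TorsionFree := by
  obtain ⟨s, hs, hU⟩ := hK.exists_sign
  have hH := hf.torsionFree hs hU
  have hR := hf.isRicciSoliton hH
  exact ⟨hR.exists_eq_const hf.1, hH.isKahler_I, hH.isKahler_J, hR.ricciFlat hf.1, hH⟩
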